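/- **Setting.** Let $\Lambda$ be a finite set of spins, each with Hilbert space $\mathbb C^d$, let $T>0$, $J>0$, $k\ge 1$, and let $$H(t)=H_0+V(t),\qquad H_0=\sum_{1\le |X|\le k}h_X,\qquad V(t)=\sum_{1\le|X|\le k}v_X(t),\qquad v_X(t+T)=v_X(t),$$ where $h_X$ and $v_X(t)$ act on the spins of $X\subseteq\Lambda$ only, $H_0$ and $V(t)$ are Hermitian, $v_X$ is measurable in $t$, and $\sum_{X\ni i}(\|h_X\|+\|v_X(t)\|)\le J$ for all $i\in\Lambda$ and all $t$ ($\|\cdot\|$ is the operator norm). Put $\lambda=2kJ$. Let $U(t)=\mathcal T\exp\bigl(-i\int_0^tH(s)\,ds\bigr)$, $O(t)=U(t)^\dagger O\,U(t)$ and $e^{-iH_{\rm F}T}=U(T)$. The truncated Floquet Hamiltonian is $H_{\rm F}^{(n)}=\sum_{q=0}^{n}T^q\Omega_q$ with the Floquet–Magnus terms $$\Omega_q=\frac1{(q+1)^2}\sum_{\sigma\in S_{q+1}}(-1)^{q-\theta(\sigma)}\frac{\theta(\sigma)!\,(q-\theta(\sigma))!}{q!}\,\frac1{i^qT^{q+1}}\int_0^T\!dt_{q+1}\cdots\int_0^{t_2}\!dt_1\,\bigl[H(t_{\sigma(q+1)}),\bigl[\ldots,[H(t_{\sigma(2)}),H(t_{\sigma(1)})]\ldots\bigr]\bigr],$$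 where $\theta(\sigma)$ is the number of $i\le q$ with $\sigma(i)<\sigma(i+1)$. Let $\Lambda$ be the vertex set of a connected graph (the lattice) with graph distance $\mathrm{dist}$, of dimension $D\ge1$ in the sense that, for a constant $C>0$, every ball of radius $r\ge 1$ has at most $C r^D$ sites. Suppose that the system satisfies a Lieb–Robinson bound with a function $\mathcal G(l,t)\ge 0$ ($l\in\mathbb N$, $t\ge0$) that is non-decreasing in $t$: for all non-empty $X,Y\subseteq\Lambda$, all operators $O_X,O_Y$ supported on $X,Y$, and all $t\ge 0$, $$\|[O_X(t),O_Y]\|\le \mathcal G(\mathrm{dist}(X,Y),t)\,\min(|X|,|Y|)\,\|O_X\|\,\|O_Y\|.$$ **Theorem.** Let $n_0=\lfloor 1/(16\lambda T)\rfloor$ and $l_0=\lceil C^{-1/D}\,2^{n_0/(2D)}\rceil$. For every region $L\subseteq\Lambda$, every density matrix $\rho$ and every $m\in\mathbb N$, the reduced states $$\rho_L(mT)=\mathrm{tr}_{L^{\rm c}}\bigl(e^{-iH_{\rm F}mT}\rho\,e^{iH_{\rm F}mT}\bigr),\qquad \rho_L^{(n_0)}(mT)=\mathrm{tr}_{L^{\rm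 c}}\bigl(e^{-iH_{\rm F}^{(n_0)}mT}\rho\,e^{iH_{\rm F}^{(n_0)}mT}\bigr)$$ satisfy, in trace norm, $$\|\rho_L(mT)-\rho_L^{(n_0)}(mT)\|_1\le 12J|L|\,mT\,2^{-n_0/2}+2|L|\,m\,\mathcal G(l_0,mT).$$ In particular the bound depends neither on the number of spins nor on the driving amplitude $V_0=\sum_X\frac1T\int_0^T\|v_X(t)\|\,dt$. -/

import Mathlib

open scoped Matrix Kronecker ComplexOrder MatrixOrder Matrix.Norms.L2Operator

namespace Floquet

/-- Operators on the Hilbert space `⨂_{i ∈ Λ} ℂ^d`, as matrices in the product basis.  Throughout,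
`‖A‖` is the operator norm induced by the Hilbert space norm. -/
abbrev Op (Λ : Type*) (d : ℕ) := Matrix (Λ → Fin d) (Λ → Fin d) ℂ

section Regions

variable {Λ : Type*} [Fintype Λ] [DecidableEq Λ] {d : ℕ}

/-- The splitting of the product basis into the part in `X` and the part outside of `X`. -/
def splitting (X : Finset Λ) :
    (Λ → Fin d) ≃ ({i // i ∈ X} → Fin d) × ({i // ¬ i ∈ X} → Fin d) :=
  Equiv.piEquivPiSubtypeProd (fun i => i ∈ X) (fun _ => Fin d)

/-- `A` acts on the spins of `X` only: `A = B ⊗ 1` with `B` an operator on the spins of `X`. -/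
def SupportedOn (X : Finset Λ) (A : Op Λ d) : Prop :=
  ∃ B : Op {i // i ∈ X} d,
    A = (B ⊗ₖ (1 : Op {i // ¬ i ∈ X} d)).submatrix (splitting X) (splitting X)

/-- The partial trace over the spins outside of `L`. -/
def reducedTo (L : Finset Λ) (A : Op Λ d) : Op {i // i ∈ L} d :=
  Matrix.of fun a b => ∑ c : {i // ¬ i ∈ L} → Fin d,
    A ((splitting L).symm (a, c)) ((splitting L).symm (b, c))

/-- Density matrices. -/
def IsState (ρ : Op Λ d) : Prop := ρ.PosSemidef ∧ ρ.trace = 1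

end Regions

/-- The trace norm `tr √(A† A)`. -/
noncomputable def traceNorm {n : Type*} [Fintype n] [DecidableEq n] (A : Matrix n n ℂ) : ℝ :=
  (CFC.abs A).trace.re

section Magnus

variable {n : Type*} [Fintype n] [DecidableEq n]

/-- Terms of the Dyson series:
`(-i)^q ∫_0^t dt_q ∫_0^{t_q} dt_{q-1} ⋯ ∫_0^{t_2} dt_1 H(t_q) ⋯ H(t_1)`. -/
noncomputable def dysonTerm (H : ℝ → Matrix n n ℂ) : ℕ → ℝ → Matrix n n ℂ
  | 0, _ => 1
  | q + 1, t => (-Complex.I) • ∫ s in (0 : ℝ)..t, H s * dysonTerm H q s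

/-- The time-ordered exponential `𝒯 exp (-i ∫_0^t H(s) ds)`, given by its Dyson series. -/
noncomputable def propagator (H : ℝ → Matrix n n ℂ) (t : ℝ) : Matrix n n ℂ :=
  ∑' q : ℕ, dysonTerm H q t

/-- The ordered integral `∫_0^T dt_q ∫_0^{t_q} dt_{q-1} ⋯ ∫_0^{t_2} dt_1 f(t_1, …, t_q)`. -/
noncomputable def orderedIntegral :
    (q : ℕ) → ℝ → ((Fin q → ℝ) → Matrix n n ℂ) → Matrix n n ℂ
  | 0, _, f => f Fin.elim0
  | q + 1, T, f =>
      ∫ s in (0 : ℝ)..T, orderedIntegral q s fun t => f (Fin.snoc t s : Fin (q + 1) → ℝ)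

/-- The multi-commutator `[A_{q+1}, [A_q, …, [A_2, A_1]…]]`. -/
def multiCommutator : (q : ℕ) → (Fin (q + 1) → Matrix n n ℂ) → Matrix n n ℂ
  | 0, A => A 0
  | q + 1, A => ⁅A (Fin.last (q + 1)), multiCommutator q fun i => A i.castSucc⁆

/-- The number `θ(σ)` of ascents of a permutation. -/
def ascents {q : ℕ} (σ : Equiv.Perm (Fin (q + 1))) : ℕ :=
  (Finset.univ.filter fun i : Fin q => σ i.castSucc < σ i.succ).card

/-- The term `Ω_q` of the Floquet-Magnus expansion over the period `T`. -/
noncomputable def magnusTerm (H : ℝ → Matrix n n ℂ) (T : ℝ) (q : ℕ) : Matrix n n ℂ :=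
  (1 / ((q : ℂ) + 1) ^ 2) • ∑ σ : Equiv.Perm (Fin (q + 1)),
    ((-1 : ℂ) ^ (q - ascents σ) *
        (((ascents σ).factorial : ℂ) * ((q - ascents σ).factorial : ℂ) / (q.factorial : ℂ))) •
      (1 / (Complex.I ^ q * (T : ℂ) ^ (q + 1))) •
        orderedIntegral (q + 1) T fun t => multiCommutator q fun i => H (t (σ i))

/-- The truncated Floquet Hamiltonian `H_F^{(q)} = ∑_{m ≤ q} T^m Ω_m`. -/
noncomputable def truncatedFloquet (H : ℝ → Matrix n n ℂ) (T : ℝ) (q : ℕ) : Matrix n n ℂ :=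
  ∑ m ∈ Finset.range (q + 1), ((T : ℂ) ^ m) • magnusTerm H T m

/-- The one-period evolution `e^{-i H_F^{(q)} T}` of the truncated Floquet Hamiltonian. -/
noncomputable def truncatedStep (H : ℝ → Matrix n n ℂ) (T : ℝ) (q : ℕ) : Matrix n n ℂ :=
  NormedSpace.exp ((-Complex.I * (T : ℂ)) • truncatedFloquet H T q)

end Magnus

section Systems

variable {Λ : Type*} [Fintype Λ] [DecidableEq Λ] {d : ℕ}

/-- A periodically driven spin system `H(t) = ∑_X h_X + ∑_X v_X(t)` with at most `k`-body
interactions, local interaction strength `J` and period `T`. -/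
structure DrivenSystem (Λ : Type*) [Fintype Λ] [DecidableEq Λ] (d k : ℕ) (J T : ℝ) where
  /-- static interaction terms -/
  h : Finset Λ → Op Λ d
  /-- driving terms -/
  v : Finset Λ → ℝ → Op Λ d
  h_supported : ∀ X, SupportedOn X (h X)
  v_supported : ∀ X t, SupportedOn X (v X t)
  h_fewBody : ∀ X, h X ≠ 0 → X.Nonempty ∧ X.card ≤ k
  v_fewBody : ∀ X t, v X t ≠ 0 → X.Nonempty ∧ X.card ≤ k
  static_hermitian : (∑ X, h X).IsHermitian
  driving_hermitian : ∀ t, (∑ X, v X t).IsHermitian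
  v_measurable : ∀ X a b, Measurable fun t => v X t a b
  v_periodic : ∀ X t, v X (t + T) = v X t
  extensive : ∀ i t, ∑ X ∈ Finset.univ.filter (fun X : Finset Λ => i ∈ X), (‖h X‖ + ‖v X t‖) ≤ J

namespace DrivenSystem

variable {k : ℕ} {J T : ℝ} (S : DrivenSystem Λ d k J T)

/-- The Hamiltonian `H(t) = H_0 + V(t)`. -/
def hamiltonian (t : ℝ) : Op Λ d := ∑ X, S.h X + ∑ X, S.v X t

/-- The exact evolution operator `U(t) = 𝒯 exp (-i ∫_0^t H(s) ds)`. -/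
noncomputable def evolution (t : ℝ) : Op Λ d := propagator S.hamiltonian t

/-- The Heisenberg picture `O(t) = U(t)† O U(t)`. -/
noncomputable def heisenberg (t : ℝ) (O : Op Λ d) : Op Λ d :=
  (S.evolution t)ᴴ * O * S.evolution t

/-- The state at time `mT` under the exact evolution, `e^{-i H_F m T} ρ e^{i H_F m T}`, with
`e^{-i H_F T} = U(T)`. -/
noncomputable def exactState (m : ℕ) (ρ : Op Λ d) : Op Λ d :=
  S.evolution T ^ m * ρ * (S.evolution T ^ m)ᴴ

/-- The state at time `mT` under the evolution of the truncated Floquet Hamiltonian of order `q`. -/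
noncomputable def truncatedState (q m : ℕ) (ρ : Op Λ d) : Op Λ d :=
  truncatedStep S.hamiltonian T q ^ m * ρ * (truncatedStep S.hamiltonian T q ^ m)ᴴ

end DrivenSystem

/-- The graph distance of two (non-empty) regions of a connected lattice. -/
noncomputable def regionDist (Γ : SimpleGraph Λ) (X Y : Finset Λ) : ℕ :=
  sInf {r | ∃ i ∈ X, ∃ j ∈ Y, Γ.dist i j = r}

/-- The lattice has dimension `D`, with constant `C`: balls of radius `r ≥ 1` contain at most
`C r^D` sites. -/
def HasDimension (Γ : SimpleGraph Λ) (D : ℕ) (C : ℝ) : Prop :=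
  ∀ (i : Λ) (r : ℕ), 1 ≤ r →
    ((Finset.univ.filter fun j : Λ => Γ.dist i j ≤ r).card : ℝ) ≤ C * (r : ℝ) ^ D

/-- The Lieb-Robinson bound with the function `G`:
`‖[O_X(t), O_Y]‖ ≤ G(dist(X, Y), t) min(|X|, |Y|) ‖O_X‖ ‖O_Y‖`. -/
def LiebRobinson {k : ℕ} {J T : ℝ} (S : DrivenSystem Λ d k J T) (Γ : SimpleGraph Λ)
    (G : ℕ → ℝ → ℝ) : Prop :=
  ∀ X Y : Finset Λ, X.Nonempty → Y.Nonempty → ∀ A B : Op Λ d, SupportedOn X A → SupportedOn Y B →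
    ∀ t : ℝ, 0 ≤ t →
      ‖⁅S.heisenberg t A, B⁆‖ ≤
        G (regionDist Γ X Y) t * (min X.card Y.card : ℕ) * (‖A‖ * ‖B‖)

/-- The truncation order `n₀ = ⌊1 / (16 λ T)⌋` with `λ = 2kJ`. -/
noncomputable def truncationOrder (k : ℕ) (J T : ℝ) : ℕ := ⌊1 / (16 * (2 * k * J) * T)⌋₊

/-- The length `l₀ = ⌈C^{-1/D} 2^{n₀/(2D)}⌉`. -/
noncomputable def localityLength (D : ℕ) (C : ℝ) (n₀ : ℕ) : ℕ :=
  ⌈C ^ (-(1 / (D : ℝ))) * (2 : ℝ) ^ ((n₀ : ℝ) / (2 * (D : ℝ)))⌉₊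

end Systems

end Floquet

/-! The two evolutions are compared in the Heisenberg picture, where the error made on an observable
is a commutator with a sum of local terms. Such a commutator only sees the terms that meet the
support of the observable, so the local strength J enters the bound and the volume does not.

One period. Scale the Hamiltonian by ε and put K = iH. Let u be the one-period propagator of εH, v
its inverse, and X(ε) = ∑_{p ≤ n} ε^(p+1) x_p with x_p = i T^(p+1) Ω_p; at ε = 1 the adjoints of the
two one-period evolutions are v and e^X. Both satisfy a linear equation in ε: v' = β v with β =
∫_0^T v K u ds, and (e^X)' = φ(ad X)(X') e^X with φ(z) = (e^z - 1)/z. Hence the derivative of u e^X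
O e^{-X} v has norm ‖[D, O]‖, where D = e^{-ad X}(φ(ad X) X' - β) (`hasDerivAt_interpolation`). Two
facts control D.

The first is algebraic: D = O(ε^(n+1)), that is, the Floquet-Magnus terms really are the expansion
of a logarithm. The sum over permutations weighted by ascents is an average over y in [0, 1] of
nested integrals (`magnusCoeff_eq`), because the weights j! (p - j)! are Beta integrals. The
generating function Q of these integrals solves Q + y W Q = ε β up to high order, with W = Ad_v - 1
(`nestSum_equation`), and averaging (1 + y W)⁻¹ over y produces log(1 + W)/W, the inverse of φ(ad X)
when e^(ad X) = 1 + W. A bootstrap in the order of agreement closes the argument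
(`phi_sub_scaleGen_isBigO`).

The second is quantitative: ε D = ∑_j ε^j κ_j, where κ_j consists of terms on at most jk sites, of
strength at most 8JT 2^(-j) per site. A commutator of total degree j costs a factor proportional to
kj. The resulting factorials in x_p are absorbed by n ≤ 1/(16λT), and those in the series in ad X by
1/m! (`loc_magnusCoeff`, `loc_adSum`). By the first fact κ_j = 0 for j < n + 2, so only an
exponentially small tail remains (`norm_adL_genDefect_le`, `norm_step_sub_le`).

Many periods. Telescoping reduces the claim to single periods applied to the exactly evolved
observables (`norm_pow_conj_sub_le`). By the Lieb-Robinson bound and a twirl over unitaries far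
away, each of these is within |L| G(l₀, ·) of an operator supported on sites closer than l₀ to L
(`exists_localized`). The choice of l₀ allows at most |L| 2^(n₀/2) such sites, which turns 2^(-n₀)
into 2^(-n₀/2). Duality of the trace norm passes from observables to reduced states. -/

namespace Floquet

set_option linter.unusedSectionVars false

open MeasureTheory Set Filter Topology Asymptotics

/-! ### Calculus of Lipschitz primitives of merely measurable functions -/

section Primitives

variable {E F G : Type*} [NormedAddCommGroup E] [NormedSpace ℝ E]
  [NormedAddCommGroup F] [NormedSpace ℝ F] [NormedAddCommGroup G] [NormedSpace ℝ G]

/-- Measurable functions on `[0, ∞)` that are bounded on bounded sets. -/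
structure LocBdd (f : ℝ → E) : Prop where
  meas : AEStronglyMeasurable f (volume.restrict (Ici 0))
  bdd : ∀ R : ℝ, ∃ c : ℝ, ∀ t ∈ Icc 0 R, ‖f t‖ ≤ c

namespace LocBdd

theorem of_continuousOn {f : ℝ → E} (hf : ContinuousOn f (Ici 0)) : LocBdd f where
  meas := hf.aestronglyMeasurable measurableSet_Ici
  bdd _ := isCompact_Icc.exists_bound_of_continuousOn (hf.mono Icc_subset_Ici_self)

theorem const (a : E) : LocBdd fun _ : ℝ => a := of_continuousOn continuousOn_const

theorem add {f g : ℝ → E} (hf : LocBdd f) (hg : LocBdd g) : LocBdd fun t => f t + g t where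
  meas := hf.meas.add hg.meas
  bdd R := by
    obtain ⟨c, hc⟩ := hf.bdd R
    obtain ⟨c', hc'⟩ := hg.bdd R
    exact ⟨c + c', fun t ht => (norm_add_le _ _).trans (add_le_add (hc t ht) (hc' t ht))⟩

theorem clm_comp {f : ℝ → E} (hf : LocBdd f) (A : E →L[ℝ] F) : LocBdd fun t => A (f t) where
  meas := A.continuous.comp_aestronglyMeasurable hf.meas
  bdd R := by
    obtain ⟨c, hc⟩ := hf.bdd R
    exact ⟨‖A‖ * c, fun t ht => (A.le_opNorm _).trans
      (mul_le_mul_of_nonneg_left (hc t ht) (norm_nonneg _))⟩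

theorem bilin {f : ℝ → E} {g : ℝ → F} (B : E →L[ℝ] F →L[ℝ] G) (hf : LocBdd f) (hg : LocBdd g) :
    LocBdd fun t => B (f t) (g t) where
  meas := B.aestronglyMeasurable_comp₂ hf.meas hg.meas
  bdd R := by
    obtain ⟨c, hc⟩ := hf.bdd R
    obtain ⟨c', hc'⟩ := hg.bdd R
    refine ⟨‖B‖ * c * c', fun t ht => (B.le_opNorm₂ _ _).trans ?_⟩
    have := (norm_nonneg _).trans (hc t ht)
    gcongr
    exacts [hc t ht, hc' t ht]

theorem smul {f : ℝ → E} (hf : LocBdd f) (r : ℝ) : LocBdd fun t => r • f t :=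
  hf.clm_comp (r • ContinuousLinearMap.id ℝ E)

theorem neg {f : ℝ → E} (hf : LocBdd f) : LocBdd fun t => -f t := by
  simpa using hf.smul (-1)

theorem sub {f g : ℝ → E} (hf : LocBdd f) (hg : LocBdd g) : LocBdd fun t => f t - g t := by
  simpa [sub_eq_add_neg] using hf.add hg.neg

theorem mul {A : Type*} [NormedRing A] [NormedAlgebra ℝ A] {f g : ℝ → A} (hf : LocBdd f)
    (hg : LocBdd g) : LocBdd fun t => f t * g t :=
  bilin (ContinuousLinearMap.mul ℝ A) hf hg

theorem clm_apply {f : ℝ → E →L[ℝ] F} {g : ℝ → E} (hf : LocBdd f)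
    (hg : LocBdd g) : LocBdd fun t => f t (g t) :=
  bilin (ContinuousLinearMap.id ℝ (E →L[ℝ] F)) hf hg

theorem integrableOn {f : ℝ → E} (hf : LocBdd f) (R : ℝ) : IntegrableOn f (Icc 0 R) := by
  obtain ⟨c, hc⟩ := hf.bdd R
  refine IntegrableOn.of_bound (by simp)
    (hf.meas.mono_measure (Measure.restrict_mono Icc_subset_Ici_self le_rfl)) c ?_
  exact (ae_restrict_iff' measurableSet_Icc).2 (ae_of_all _ hc)

theorem intervalIntegrable {f : ℝ → E} (hf : LocBdd f) {a b : ℝ} (ha : 0 ≤ a) (hb : 0 ≤ b) :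
    IntervalIntegrable f volume a b := by
  rw [intervalIntegrable_iff]
  refine (hf.integrableOn (max a b)).mono_set fun x hx => ⟨?_, ?_⟩
  · exact (le_min ha hb).trans hx.1.le
  · exact hx.2

end LocBdd

/-- `F` is, on `[0, ∞)`, a locally Lipschitz primitive of `f`. -/
structure IsPrimitive (F f : ℝ → E) : Prop where
  lip : ∀ R : ℝ, ∃ K : ℝ, 0 ≤ K ∧ ∀ s ∈ Icc 0 R, ∀ t ∈ Icc 0 R, ‖F s - F t‖ ≤ K * |s - t|
  locBdd : LocBdd f
  deriv : ∀ᵐ t : ℝ, 0 < t → HasDerivAt F (f t) t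

namespace IsPrimitive

theorem of_integral [CompleteSpace E] {Φ φ : ℝ → E} (hφ : LocBdd φ)
    (h : ∀ t, 0 ≤ t → Φ t = Φ 0 + ∫ s in (0 : ℝ)..t, φ s) : IsPrimitive Φ φ where
  lip R := by
    obtain ⟨c, hc⟩ := hφ.bdd R
    refine ⟨max c 0, le_max_right _ _, fun s hs t ht => ?_⟩
    rw [h s hs.1, h t ht.1, add_sub_add_left_eq_sub,
      intervalIntegral.integral_interval_sub_left (hφ.intervalIntegrable le_rfl hs.1)
        (hφ.intervalIntegrable le_rfl ht.1)]
    refine intervalIntegral.norm_integral_le_of_norm_le_const fun x hx => ?_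
    refine (hc x ⟨?_, ?_⟩).trans (le_max_left _ _)
    · exact (le_min ht.1 hs.1).trans hx.1.le
    · exact hx.2.trans (max_le ht.2 hs.2)
  locBdd := hφ
  deriv := by
    have key : ∀ n : ℕ, ∀ᵐ t : ℝ, t ∈ uIcc (0 : ℝ) n → ∀ c ∈ uIcc (0 : ℝ) n,
        HasDerivAt (fun x => ∫ s in c..x, φ s) (φ t) t := fun n =>
      (hφ.intervalIntegrable le_rfl n.cast_nonneg).ae_hasDerivAt_integral
    filter_upwards [ae_all_iff.2 key] with t ht ht0
    obtain ⟨n, hn⟩ := exists_nat_ge t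
    have hu : uIcc (0 : ℝ) n = Icc (0 : ℝ) n := uIcc_of_le n.cast_nonneg
    have h1 := ht n (by rw [hu]; exact ⟨ht0.le, hn⟩) 0 (by simp)
    refine (h1.const_add (Φ 0)).congr_of_eventuallyEq ?_
    filter_upwards [lt_mem_nhds ht0] with s hs using h s hs.le

theorem integral [CompleteSpace E] {φ : ℝ → E} (hφ : LocBdd φ) :
    IsPrimitive (fun t => ∫ s in (0 : ℝ)..t, φ s) φ :=
  of_integral hφ (by simp)

theorem continuousOn {Φ φ : ℝ → E} (h : IsPrimitive Φ φ) : ContinuousOn Φ (Ici 0) := by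
  intro x hx
  obtain ⟨K, hK, hl⟩ := h.lip (x + 1)
  have : LipschitzOnWith K.toNNReal Φ (Icc 0 (x + 1)) := by
    refine LipschitzOnWith.of_dist_le_mul fun s hs t ht => ?_
    rw [dist_eq_norm, Real.dist_eq, Real.coe_toNNReal K hK]
    exact hl s hs t ht
  refine (this.continuousOn x ⟨hx, by linarith⟩).mono_of_mem_nhdsWithin ?_
  rw [← Ici_inter_Iic]
  exact inter_mem self_mem_nhdsWithin (mem_nhdsWithin_of_mem_nhds (Iic_mem_nhds (by linarith)))

theorem locBdd_self {Φ φ : ℝ → E} (h : IsPrimitive Φ φ) : LocBdd Φ :=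
  LocBdd.of_continuousOn h.continuousOn

theorem bilin {Φ φ : ℝ → E} {Ψ ψ : ℝ → F} (B : E →L[ℝ] F →L[ℝ] G) (h : IsPrimitive Φ φ)
    (h' : IsPrimitive Ψ ψ) :
    IsPrimitive (fun t => B (Φ t) (Ψ t)) (fun t => B (Φ t) (ψ t) + B (φ t) (Ψ t)) where
  lip R := by
    obtain ⟨K, hK, hl⟩ := h.lip R
    obtain ⟨K', hK', hl'⟩ := h'.lip R
    obtain ⟨c, hc⟩ := h.locBdd_self.bdd R
    obtain ⟨c', hc'⟩ := h'.locBdd_self.bdd R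
    refine ⟨‖B‖ * max c 0 * K' + ‖B‖ * K * max c' 0, by positivity, fun s hs t ht => ?_⟩
    have : B (Φ s) (Ψ s) - B (Φ t) (Ψ t) = B (Φ s) (Ψ s - Ψ t) + B (Φ s - Φ t) (Ψ t) := by
      simp
    rw [this]
    calc _ ≤ ‖B‖ * ‖Φ s‖ * ‖Ψ s - Ψ t‖ + ‖B‖ * ‖Φ s - Φ t‖ * ‖Ψ t‖ :=
          (norm_add_le _ _).trans (add_le_add (B.le_opNorm₂ _ _) (B.le_opNorm₂ _ _))
      _ ≤ ‖B‖ * max c 0 * (K' * |s - t|) + ‖B‖ * (K * |s - t|) * max c' 0 := by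
          gcongr
          exacts [(hc s hs).trans (le_max_left _ _), hl' s hs t ht, hl s hs t ht,
            (hc' t ht).trans (le_max_left _ _)]
      _ = _ := by ring
  locBdd := (LocBdd.bilin B h.locBdd_self h'.locBdd).add (LocBdd.bilin B h.locBdd h'.locBdd_self)
  deriv := by
    filter_upwards [h.deriv, h'.deriv] with t h1 h2 ht
    exact B.hasDerivAt_of_bilinear (fun _ => h1 ht) (fun _ => h2 ht)

theorem mul {A : Type*} [NormedRing A] [NormedAlgebra ℝ A] {Φ φ Ψ ψ : ℝ → A}
    (h : IsPrimitive Φ φ) (h' : IsPrimitive Ψ ψ) :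
    IsPrimitive (fun t => Φ t * Ψ t) (fun t => Φ t * ψ t + φ t * Ψ t) :=
  bilin (ContinuousLinearMap.mul ℝ A) h h'

theorem clm_apply {Φ φ : ℝ → E →L[ℝ] F} {Ψ ψ : ℝ → E}
    (h : IsPrimitive Φ φ) (h' : IsPrimitive Ψ ψ) :
    IsPrimitive (fun t => Φ t (Ψ t)) (fun t => Φ t (ψ t) + φ t (Ψ t)) :=
  bilin (ContinuousLinearMap.id ℝ (E →L[ℝ] F)) h h'

theorem clm_comp {Φ φ : ℝ → E} (h : IsPrimitive Φ φ) (A : E →L[ℝ] F) :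
    IsPrimitive (fun t => A (Φ t)) (fun t => A (φ t)) where
  lip R := by
    obtain ⟨K, hK, hl⟩ := h.lip R
    refine ⟨‖A‖ * K, by positivity, fun s hs t ht => ?_⟩
    rw [← map_sub, mul_assoc]
    exact (A.le_opNorm _).trans (mul_le_mul_of_nonneg_left (hl s hs t ht) (norm_nonneg _))
  locBdd := h.locBdd.clm_comp A
  deriv := by
    filter_upwards [h.deriv] with t h1 ht
    exact A.hasFDerivAt.comp_hasDerivAt t (h1 ht)

theorem congr_deriv {Φ φ φ' : ℝ → E} (h : IsPrimitive Φ φ) (e : ∀ t, φ t = φ' t) :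
    IsPrimitive Φ φ' := by
  rwa [← funext e]

theorem sub {Φ φ Ψ ψ : ℝ → E} (h : IsPrimitive Φ φ) (h' : IsPrimitive Ψ ψ) :
    IsPrimitive (fun t => Φ t - Ψ t) (fun t => φ t - ψ t) where
  lip R := by
    obtain ⟨K, hK, hl⟩ := h.lip R
    obtain ⟨K', hK', hl'⟩ := h'.lip R
    refine ⟨K + K', by positivity, fun s hs t ht => ?_⟩
    rw [sub_sub_sub_comm, add_mul]
    exact (norm_sub_le _ _).trans (add_le_add (hl s hs t ht) (hl' s hs t ht))
  locBdd := h.locBdd.sub h'.locBdd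
  deriv := by
    filter_upwards [h.deriv, h'.deriv] with t h1 h2 ht using (h1 ht).sub (h2 ht)

theorem const (a : E) : IsPrimitive (fun _ => a) (fun _ => 0) where
  lip _ := ⟨0, le_rfl, by simp⟩
  locBdd := LocBdd.const 0
  deriv := ae_of_all _ fun t _ => hasDerivAt_const t a

/-- An almost everywhere vanishing derivative forces constancy only for absolutely continuous
functions; the Lipschitz bound in `IsPrimitive` serves this purpose. -/
theorem eq_of_deriv_eq_zero {Φ : ℝ → E} (h : IsPrimitive Φ fun _ => 0) {t : ℝ} (ht : 0 ≤ t) :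
    Φ t = Φ 0 := by
  obtain ⟨K, hK, hl⟩ := h.lip t
  have hu : uIcc (0 : ℝ) t = Icc 0 t := uIcc_of_le ht
  have hL : LipschitzOnWith K.toNNReal Φ (uIcc 0 t) := by
    rw [hu]
    refine LipschitzOnWith.of_dist_le_mul fun s hs t ht => ?_
    rw [dist_eq_norm, Real.dist_eq, Real.coe_toNNReal K hK]
    exact hl s hs t ht
  -- The derivative is prescribed only for positive times, so the endpoint 0 is discarded as a null
  -- set.
  have h0 : ∀ᵐ x : ℝ, x ≠ 0 := by simp [ae_iff, measure_singleton]
  obtain ⟨C, hC⟩ := hL.absolutelyContinuousOnInterval.const_of_ae_hasDerivAt_zero (by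
    filter_upwards [h.deriv, h0] with x hx hx0 hxt
    rw [hu] at hxt
    exact hx (lt_of_le_of_ne hxt.1 hx0.symm))
  rw [hC t (by simp), hC 0 (by simp)]

theorem eq_add_integral [CompleteSpace E] {Φ φ : ℝ → E} (h : IsPrimitive Φ φ) {t : ℝ}
    (ht : 0 ≤ t) : Φ t = Φ 0 + ∫ s in (0 : ℝ)..t, φ s := by
  have := ((h.sub (integral h.locBdd)).congr_deriv (φ' := fun _ => 0) (by simp)).eq_of_deriv_eq_zero
    ht
  simp only [intervalIntegral.integral_same, sub_zero] at this
  rw [← this, sub_add_cancel]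

end IsPrimitive

end Primitives

/-! ### Linear Volterra equations and their iterated series -/

section Volterra

variable {E : Type*} [NormedAddCommGroup E] [NormedSpace ℝ E] [CompleteSpace E]

/-- The iterates `a_{q+1}(t) = ∫_0^t L(s) a_q(s) ds` with `a_0 = x`. -/
noncomputable def volterra (L : ℝ → E →L[ℝ] E) (x : E) : ℕ → ℝ → E
  | 0, _ => x
  | q + 1, t => ∫ s in (0 : ℝ)..t, L s (volterra L x q s)

variable {L : ℝ → E →L[ℝ] E} {x : E}

theorem volterra_locBdd (hL : LocBdd L) (x : E) (q : ℕ) : LocBdd (volterra L x q) := by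
  induction q with
  | zero => exact LocBdd.const x
  | succ q ih => exact (IsPrimitive.integral (hL.clm_apply ih)).locBdd_self

theorem volterra_isPrimitive (hL : LocBdd L) (x : E) (q : ℕ) :
    IsPrimitive (volterra L x (q + 1)) fun s => L s (volterra L x q s) :=
  IsPrimitive.integral (hL.clm_apply (volterra_locBdd hL x q))

theorem norm_integral_le_pow_div_factorial {f : ℝ → E} {M c : ℝ} {q : ℕ} {t : ℝ} (ht : 0 ≤ t)
    (h : ∀ s ∈ Icc 0 t, ‖f s‖ ≤ c * (M * (c * s) ^ q / q.factorial)) :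
    ‖∫ s in (0 : ℝ)..t, f s‖ ≤ M * (c * t) ^ (q + 1) / (q + 1).factorial := by
  have h1 : ‖∫ s in (0 : ℝ)..t, f s‖ ≤ ∫ s in (0 : ℝ)..t, c * (M * (c * s) ^ q / q.factorial) := by
    refine intervalIntegral.norm_integral_le_of_norm_le ht ?_ ?_
    · exact ae_of_all _ fun s hs => h s ⟨hs.1.le, hs.2⟩
    · exact Continuous.intervalIntegrable (by fun_prop) _ _
  refine h1.trans (le_of_eq ?_)
  have : ∀ s : ℝ, c * (M * (c * s) ^ q / q.factorial) = (M * c ^ (q + 1) / q.factorial) * s ^ q := by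
    intro s; rw [mul_pow]; ring
  simp only [this]
  rw [intervalIntegral.integral_const_mul, integral_pow, Nat.factorial_succ]
  have := Nat.factorial_ne_zero q
  push_cast
  field_simp
  ring

theorem volterra_norm_le {R c : ℝ} (hc : ∀ s ∈ Icc 0 R, ‖L s‖ ≤ c) (x : E) (q : ℕ) {t : ℝ}
    (ht : t ∈ Icc 0 R) : ‖volterra L x q t‖ ≤ ‖x‖ * (c * t) ^ q / q.factorial := by
  induction q generalizing t with
  | zero => simp [volterra]
  | succ q ih =>
    refine norm_integral_le_pow_div_factorial ht.1 fun s hs => ?_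
    have hs' : s ∈ Icc 0 R := ⟨hs.1, hs.2.trans ht.2⟩
    refine ((L s).le_opNorm _).trans ?_
    have := (norm_nonneg _).trans (hc s hs')
    gcongr
    exacts [hc s hs', ih hs']

/-- Uniqueness for linear equations: inserting the integral equation into itself q times bounds W by
M (ct)^q / q! for every q. Most operator identities below are proved by showing that a difference
solves such an equation. -/
theorem eq_zero_of_isPrimitive (hL : LocBdd L) {W : ℝ → E} (h : IsPrimitive W fun s => L s (W s))
    (h0 : W 0 = 0) {t : ℝ} (ht : 0 ≤ t) : W t = 0 := by
  obtain ⟨c, hc⟩ := hL.bdd t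
  obtain ⟨M, hM⟩ := h.locBdd_self.bdd t
  have key : ∀ q : ℕ, ∀ s ∈ Icc 0 t, ‖W s‖ ≤ M * (c * s) ^ q / q.factorial := by
    intro q
    induction q with
    | zero => simpa using hM
    | succ q ih =>
      intro s hs
      rw [h.eq_add_integral hs.1, h0, zero_add]
      refine norm_integral_le_pow_div_factorial hs.1 fun r hr => ?_
      have hr' : r ∈ Icc 0 t := ⟨hr.1, hr.2.trans hs.2⟩
      refine ((L r).le_opNorm _).trans ?_
      have := (norm_nonneg _).trans (hc r hr')
      gcongr
      exacts [hc r hr', ih r hr']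
  have hlim : Tendsto (fun q : ℕ => M * (c * t) ^ q / q.factorial) atTop (𝓝 0) := by
    simpa [mul_div_assoc] using
      (FloorSemiring.tendsto_pow_div_factorial_atTop (c * t)).const_mul M
  have := ge_of_tendsto' hlim fun q => key q t ⟨ht, le_rfl⟩
  exact norm_le_zero_iff.1 this

/-- Weights of at most exponential growth. -/
def ExpGrowth (w : ℕ → ℝ) : Prop := ∃ M r : ℝ, 0 ≤ M ∧ 0 ≤ r ∧ ∀ q, |w q| ≤ M * r ^ q

theorem ExpGrowth.shift {w : ℕ → ℝ} (hw : ExpGrowth w) : ExpGrowth fun q => w (q + 1) := by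
  obtain ⟨M, r, hM, hr, h⟩ := hw
  exact ⟨M * r, r, by positivity, hr, fun q => (h (q + 1)).trans_eq (by ring)⟩

theorem expGrowth_pow (ε : ℝ) : ExpGrowth fun q => ε ^ q :=
  ⟨1, |ε|, zero_le_one, abs_nonneg _, fun q => by simp⟩

theorem expGrowth_deriv_pow (ε : ℝ) : ExpGrowth fun q => q * ε ^ (q - 1) := by
  refine ⟨1, 2 * (|ε| + 1), zero_le_one, by positivity, fun q => ?_⟩
  rw [abs_mul, abs_pow, Nat.abs_cast, one_mul, mul_pow]
  have h1 : (q : ℝ) ≤ 2 ^ q := by exact_mod_cast q.lt_two_pow_self.le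
  have h2 : |ε| ^ (q - 1) ≤ (|ε| + 1) ^ q :=
    (pow_le_pow_left₀ (abs_nonneg _) (by linarith) _).trans
      (pow_le_pow_right₀ (by linarith [abs_nonneg ε]) (Nat.sub_le _ _))
  gcongr

/-- The weighted sum of the Volterra iterates. -/
noncomputable def volterraSum (L : ℝ → E →L[ℝ] E) (x : E) (w : ℕ → ℝ) (t : ℝ) : E :=
  ∑' q, w q • volterra L x q t

theorem exists_volterra_bound (hL : LocBdd L) (x : E) {w : ℕ → ℝ} (hw : ExpGrowth w) (R : ℝ) :
    ∃ b : ℕ → ℝ, Summable b ∧ ∀ q, ∀ t ∈ Icc 0 R, ‖w q • volterra L x q t‖ ≤ b q := by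
  obtain ⟨c, hc⟩ := hL.bdd R
  obtain ⟨M, r, hM, hr, h⟩ := hw
  refine ⟨fun q => M * ‖x‖ * ((r * (|c| * |R|)) ^ q / q.factorial),
    (Real.summable_pow_div_factorial _).mul_left _, fun q t ht => ?_⟩
  have h1 := volterra_norm_le hc x q ht
  have hc0 : 0 ≤ c := (norm_nonneg _).trans (hc t ht)
  have h2 : (c * t) ^ q ≤ (|c| * |R|) ^ q := by
    have : t ≤ |R| := ht.2.trans (le_abs_self R)
    have := ht.1
    gcongr
    exact le_abs_self c
  calc ‖w q • volterra L x q t‖ = |w q| * ‖volterra L x q t‖ := by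
        rw [norm_smul, Real.norm_eq_abs]
    _ ≤ (M * r ^ q) * (‖x‖ * (|c| * |R|) ^ q / q.factorial) := by
        have := h q
        have h3 : ‖volterra L x q t‖ ≤ ‖x‖ * (|c| * |R|) ^ q / q.factorial := h1.trans (by gcongr)
        gcongr
    _ = _ := by dsimp only; rw [mul_pow r]; ring

theorem summable_volterra (hL : LocBdd L) (x : E) {w : ℕ → ℝ} (hw : ExpGrowth w) {t : ℝ}
    (ht : 0 ≤ t) : Summable fun q => w q • volterra L x q t := by
  obtain ⟨b, hb, h⟩ := exists_volterra_bound hL x hw t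
  exact Summable.of_norm_bounded hb fun q => h q t ⟨ht, le_rfl⟩

theorem volterra_succ_continuousOn (hL : LocBdd L) (x : E) (q : ℕ) :
    ContinuousOn (volterra L x q) (Ici 0) := by
  cases q with
  | zero => exact continuousOn_const
  | succ q => exact (volterra_isPrimitive hL x q).continuousOn

theorem volterraSum_continuousOn (hL : LocBdd L) (x : E) {w : ℕ → ℝ} (hw : ExpGrowth w) :
    ContinuousOn (volterraSum L x w) (Ici 0) := by
  intro t ht
  obtain ⟨b, hb, h⟩ := exists_volterra_bound hL x hw (t + 1)
  have : ContinuousOn (volterraSum L x w) (Icc 0 (t + 1)) :=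
    continuousOn_tsum (fun q => (((volterra_succ_continuousOn hL x q).mono
      Icc_subset_Ici_self).const_smul (w q))) hb h
  refine (this t ⟨ht, by linarith⟩).mono_of_mem_nhdsWithin ?_
  rw [← Ici_inter_Iic]
  exact inter_mem self_mem_nhdsWithin (mem_nhdsWithin_of_mem_nhds (Iic_mem_nhds (by linarith)))

/-- Dominated convergence, with the factorial bound on the iterates as majorant. Taking A = L yields
the integral equation of the series; taking A to be evaluation at K(s) yields the expansion of
`scaleGen`. -/
theorem hasSum_integral_volterra {F : Type*} [NormedAddCommGroup F] [NormedSpace ℝ F]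
    [CompleteSpace F] (hL : LocBdd L) (x : E) {w : ℕ → ℝ} (hw : ExpGrowth w) {A : ℝ → E →L[ℝ] F}
    (hA : LocBdd A) {t : ℝ} (ht : 0 ≤ t) :
    HasSum (fun q => w q • ∫ s in (0 : ℝ)..t, A s (volterra L x q s))
      (∫ s in (0 : ℝ)..t, A s (volterraSum L x w s)) := by
  obtain ⟨b, hb, h⟩ := exists_volterra_bound hL x hw t
  obtain ⟨c, hc⟩ := hA.bdd t
  have hmem : ∀ s ∈ uIoc 0 t, s ∈ Icc 0 t := fun s hs => by
    rw [uIoc_of_le ht] at hs; exact ⟨hs.1.le, hs.2⟩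
  have key := intervalIntegral.hasSum_integral_of_dominated_convergence
    (F := fun q s => A s (w q • volterra L x q s))
    (f := fun s => A s (volterraSum L x w s)) (a := 0) (b := t) (μ := volume)
    (fun q _ => c * b q)
    (fun q => ((hA.clm_apply ((volterra_locBdd hL x q).smul (w q))).intervalIntegrable le_rfl
      ht).aestronglyMeasurable_restrict_uIoc)
    (fun q => ae_of_all _ fun s hs => by
      refine ((A s).le_opNorm _).trans ?_
      have h1 := hc s (hmem s hs)
      have h2 := h q s (hmem s hs)
      have := (norm_nonneg _).trans h1
      gcongr)
    (ae_of_all _ fun s _ => hb.mul_left c) (by simp)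
    (ae_of_all _ fun s hs => (summable_volterra hL x hw (hmem s hs).1).hasSum.mapL (A s))
  simpa only [map_smul, intervalIntegral.integral_smul] using key

theorem volterraSum_zero (L : ℝ → E →L[ℝ] E) (x : E) (w : ℕ → ℝ) :
    volterraSum L x w 0 = w 0 • x := by
  rw [volterraSum, tsum_eq_single 0]
  · rfl
  · intro q hq
    obtain ⟨p, rfl⟩ := Nat.exists_eq_succ_of_ne_zero hq
    simp [volterra]

theorem volterraSum_isPrimitive (hL : LocBdd L) (x : E) {w : ℕ → ℝ} (hw : ExpGrowth w) :
    IsPrimitive (volterraSum L x w) fun s => L s (volterraSum L x (fun q => w (q + 1)) s) := by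
  refine IsPrimitive.of_integral (hL.clm_apply
    (LocBdd.of_continuousOn (volterraSum_continuousOn hL x hw.shift))) fun t ht => ?_
  rw [volterraSum_zero, ← (hasSum_integral_volterra hL x hw.shift hL ht).tsum_eq, volterraSum,
    (summable_volterra hL x hw ht).tsum_eq_zero_add]
  rfl

theorem volterraSum_pow_isPrimitive (hL : LocBdd L) (x : E) (ε : ℝ) :
    IsPrimitive (volterraSum L x fun q => ε ^ q)
      fun s => ε • L s (volterraSum L x (fun q => ε ^ q) s) := by
  refine (volterraSum_isPrimitive hL x (expGrowth_pow ε)).congr_deriv fun t => ?_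
  rw [← map_smul]
  congr 1
  simp only [volterraSum]
  rw [← tsum_const_smul'' ε]
  simp only [smul_smul, pow_succ']

/-- The equation F' = ε L F differentiated in ε. On the level of weights it is (q + 1) ε^q = ε · q
ε^(q-1) + ε^q. -/
theorem volterraSum_deriv_isPrimitive (hL : LocBdd L) (x : E) (ε : ℝ) :
    IsPrimitive (volterraSum L x fun q => q * ε ^ (q - 1))
      fun s => L s (ε • volterraSum L x (fun q => q * ε ^ (q - 1)) s +
        volterraSum L x (fun q => ε ^ q) s) := by
  have h := volterraSum_isPrimitive hL x (expGrowth_deriv_pow ε)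
  have key : ∀ t, 0 ≤ t → volterraSum L x (fun q => ((q + 1 : ℕ) : ℝ) * ε ^ (q + 1 - 1)) t =
      ε • volterraSum L x (fun q => q * ε ^ (q - 1)) t + volterraSum L x (fun q => ε ^ q) t := by
    intro t ht
    simp only [volterraSum]
    rw [← tsum_const_smul'' ε, ← Summable.tsum_add
      ((summable_volterra hL x (expGrowth_deriv_pow ε) ht).const_smul ε)
      (summable_volterra hL x (expGrowth_pow ε) ht)]
    refine tsum_congr fun q => ?_
    rw [smul_smul, ← add_smul]
    congr 1
    rcases q with _ | q
    · simp
    · simp [pow_succ]; ring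
  refine ⟨h.lip, hL.clm_apply ((h.locBdd_self.smul ε).add
    (volterraSum_pow_isPrimitive hL x ε).locBdd_self), ?_⟩
  filter_upwards [h.deriv] with t h1 ht
  have := h1 ht
  rwa [key t ht.le] at this

theorem hasDerivAt_volterraSum_pow (hL : LocBdd L) (x : E) (ε : ℝ) {t : ℝ} (ht : 0 ≤ t) :
    HasDerivAt (fun e : ℝ => volterraSum L x (fun q => e ^ q) t)
      (volterraSum L x (fun q => q * ε ^ (q - 1)) t) ε := by
  obtain ⟨b, hb, h⟩ := exists_volterra_bound hL x (expGrowth_deriv_pow (|ε| + 1)) t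
  have h1 : ∀ (q : ℕ) (y : ℝ), y ∈ Metric.ball (0 : ℝ) (|ε| + 1) →
      HasDerivAt (fun e : ℝ => e ^ q • volterra L x q t)
        ((q * y ^ (q - 1) : ℝ) • volterra L x q t) y :=
    fun q y _ => (hasDerivAt_pow q y).smul_const _
  have h2 : ∀ (q : ℕ) (y : ℝ), y ∈ Metric.ball (0 : ℝ) (|ε| + 1) →
      ‖(q * y ^ (q - 1) : ℝ) • volterra L x q t‖ ≤ b q := by
    intro q y hy
    refine le_trans ?_ (h q t ⟨ht, le_rfl⟩)
    rw [norm_smul, norm_smul]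
    have : |y| ≤ |ε| + 1 := by simpa using (Metric.mem_ball.1 hy).le
    refine mul_le_mul_of_nonneg_right ?_ (norm_nonneg _)
    simp only [Real.norm_eq_abs, abs_mul, abs_pow, Nat.abs_cast]
    exact mul_le_mul_of_nonneg_left (pow_le_pow_left₀ (abs_nonneg _)
      (this.trans (le_abs_self _)) _) (Nat.cast_nonneg _)
  have h3 : (0 : ℝ) ∈ Metric.ball (0 : ℝ) (|ε| + 1) := by
    rw [Metric.mem_ball, dist_self]; positivity
  have h4 : ε ∈ Metric.ball (0 : ℝ) (|ε| + 1) := by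
    rw [Metric.mem_ball, dist_zero_right, Real.norm_eq_abs]; linarith
  exact hasDerivAt_tsum_of_isPreconnected hb Metric.isOpen_ball
    (convex_ball (0 : ℝ) (|ε| + 1)).isPreconnected h1 h2 h3
    (summable_volterra hL x (expGrowth_pow 0) ht) h4

end Volterra

/-! ### Propagators and their dependence on the scale ε -/

section Propagators

variable {A : Type*} [NormedRing A] [NormedAlgebra ℝ A] [CompleteSpace A]

/-- `adL a b = a b - b a`. -/
noncomputable def adL : A →L[ℝ] A →L[ℝ] A :=
  ContinuousLinearMap.mul ℝ A - (ContinuousLinearMap.mul ℝ A).flip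

@[simp] theorem adL_apply (a b : A) : adL a b = a * b - b * a := rfl

/-- The solution of `v' = ε v K`, `v(0) = 1`. -/
noncomputable def rightProp (K : ℝ → A) (ε t : ℝ) : A :=
  volterraSum (fun s => (ContinuousLinearMap.mul ℝ A).flip (K s)) 1 (fun q => ε ^ q) t

/-- The solution of `u' = -ε K u`, `u(0) = 1`. -/
noncomputable def leftProp (K : ℝ → A) (ε t : ℝ) : A :=
  volterraSum (fun s => -ContinuousLinearMap.mul ℝ A (K s)) 1 (fun q => ε ^ q) t

/-- The coefficient of `ε ^ q` in the expansion of `Y ↦ v Y u`. -/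
noncomputable def conjCoeff (K : ℝ → A) (q : ℕ) (t : ℝ) : A →L[ℝ] A :=
  volterra (fun s => (ContinuousLinearMap.compL ℝ A A A).flip (adL (K s))) 1 q t

/-- The map `Y ↦ v Y u`, as a series in `ε`. -/
noncomputable def conjProp (K : ℝ → A) (ε t : ℝ) : A →L[ℝ] A :=
  volterraSum (fun s => (ContinuousLinearMap.compL ℝ A A A).flip (adL (K s))) 1
    (fun q => ε ^ q) t

/-- The generator `∫_0^T v K u` of the dependence of `v` on `ε`. -/
noncomputable def scaleGen (K : ℝ → A) (T ε : ℝ) : A :=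
  ∫ s in (0 : ℝ)..T, rightProp K ε s * K s * leftProp K ε s

variable {K : ℝ → A}

theorem locBdd_mulRight (hK : LocBdd K) :
    LocBdd fun s => (ContinuousLinearMap.mul ℝ A).flip (K s) :=
  hK.clm_comp (ContinuousLinearMap.mul ℝ A).flip

theorem locBdd_mulLeft (hK : LocBdd K) : LocBdd fun s => -ContinuousLinearMap.mul ℝ A (K s) :=
  (hK.clm_comp (ContinuousLinearMap.mul ℝ A)).neg

theorem locBdd_ad (hK : LocBdd K) : LocBdd fun s => adL (K s) := hK.clm_comp adL

theorem locBdd_mulRight_ad (hK : LocBdd K) :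
    LocBdd fun s => (ContinuousLinearMap.compL ℝ A A A).flip (adL (K s)) :=
  LocBdd.clm_comp (F := (A →L[ℝ] A) →L[ℝ] A →L[ℝ] A) (locBdd_ad hK)
    (ContinuousLinearMap.compL ℝ A A A).flip

theorem rightProp_isPrimitive (hK : LocBdd K) (ε : ℝ) :
    IsPrimitive (rightProp K ε) fun s => ε • (rightProp K ε s * K s) :=
  volterraSum_pow_isPrimitive (locBdd_mulRight hK) 1 ε

theorem leftProp_isPrimitive (hK : LocBdd K) (ε : ℝ) :
    IsPrimitive (leftProp K ε) fun s => ε • (-(K s * leftProp K ε s)) :=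
  volterraSum_pow_isPrimitive (locBdd_mulLeft hK) 1 ε

theorem conjProp_isPrimitive (hK : LocBdd K) (ε : ℝ) :
    IsPrimitive (conjProp K ε) fun s => ε • (conjProp K ε s).comp (adL (K s)) :=
  volterraSum_pow_isPrimitive (locBdd_mulRight_ad hK) 1 ε

@[simp] theorem rightProp_zero (K : ℝ → A) (ε : ℝ) : rightProp K ε 0 = 1 := by
  simp [rightProp, volterraSum_zero]

@[simp] theorem leftProp_zero (K : ℝ → A) (ε : ℝ) : leftProp K ε 0 = 1 := by
  simp [leftProp, volterraSum_zero]

@[simp] theorem conjProp_zero (K : ℝ → A) (ε : ℝ) : conjProp K ε 0 = 1 := by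
  simp [conjProp, volterraSum_zero]

theorem rightProp_mul_leftProp (hK : LocBdd K) (ε : ℝ) {t : ℝ} (ht : 0 ≤ t) :
    rightProp K ε t * leftProp K ε t = 1 := by
  have h := ((rightProp_isPrimitive hK ε).mul (leftProp_isPrimitive hK ε)).congr_deriv
    (φ' := fun _ => 0) fun t => by
      rw [mul_smul_comm, smul_mul_assoc, ← smul_add]
      simp [mul_assoc]
  simpa using h.eq_of_deriv_eq_zero ht

/-- In this order the two terms of the derivative do not cancel, but u v - 1 solves the linear
equation with generator -ε ad K and starts at 0. -/
theorem leftProp_mul_rightProp (hK : LocBdd K) (ε : ℝ) {t : ℝ} (ht : 0 ≤ t) :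
    leftProp K ε t * rightProp K ε t = 1 := by
  have h := (((leftProp_isPrimitive hK ε).mul (rightProp_isPrimitive hK ε)).sub
    (IsPrimitive.const 1)).congr_deriv
    (φ' := fun s => (-(ε • adL (K s))) (leftProp K ε s * rightProp K ε s - 1)) fun t => by
      simp only [neg_apply, smul_apply, adL_apply,
        mul_smul_comm, smul_mul_assoc, ← smul_add, ← smul_neg, sub_zero]
      congr 1
      noncomm_ring
  exact sub_eq_zero.1 (eq_zero_of_isPrimitive (((locBdd_ad hK).smul ε).neg) h (by simp) ht)

/-- Conjugation `Y ↦ a Y b` as a continuous linear map. -/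
noncomputable def sandwich : A →L[ℝ] A →L[ℝ] A →L[ℝ] A :=
  (ContinuousLinearMap.compL ℝ A A A).bilinearComp (ContinuousLinearMap.mul ℝ A)
    (ContinuousLinearMap.mul ℝ A).flip

@[simp] theorem sandwich_apply (a b y : A) : sandwich a b y = a * (y * b) := rfl

/-- Both sides solve M' = ε M ∘ ad K with M(0) = 1. This replaces conjugation by a series of nested
commutators, whose terms stay local. -/
theorem conjProp_eq (hK : LocBdd K) (ε : ℝ) {t : ℝ} (ht : 0 ≤ t) (Y : A) :
    conjProp K ε t Y = rightProp K ε t * (Y * leftProp K ε t) := by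
  have h1 := IsPrimitive.bilin sandwich (rightProp_isPrimitive hK ε) (leftProp_isPrimitive hK ε)
  have h := (h1.sub (conjProp_isPrimitive hK ε)).congr_deriv
    (φ' := fun s => (ε • (ContinuousLinearMap.compL ℝ A A A).flip (adL (K s)))
      (sandwich (rightProp K ε s) (leftProp K ε s) - conjProp K ε s)) fun t => by
      ext Y
      simp only [smul_apply, ContinuousLinearMap.flip_apply, ContinuousLinearMap.compL_apply,
        map_smul, sub_apply, add_apply, sandwich_apply, ContinuousLinearMap.comp_apply, adL_apply,
        map_sub]
      simp only [← smul_add, ← smul_sub]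
      congr 1
      noncomm_ring
  have := eq_zero_of_isPrimitive ((locBdd_mulRight_ad hK).smul ε) h (by ext; simp) ht
  have h2 := congrArg (fun f : A →L[ℝ] A => f Y) this
  simp only [sub_apply, sandwich_apply, zero_apply] at h2
  exact (sub_eq_zero.1 h2).symm

theorem scaleGen_eq (hK : LocBdd K) {T : ℝ} (hT : 0 ≤ T) (ε : ℝ) :
    scaleGen K T ε = ∫ s in (0 : ℝ)..T, conjProp K ε s (K s) := by
  refine intervalIntegral.integral_congr fun s hs => ?_
  rw [uIcc_of_le hT] at hs
  simp only [conjProp_eq hK ε hs.1, mul_assoc]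

theorem hasSum_scaleGen (hK : LocBdd K) {T : ℝ} (hT : 0 ≤ T) (ε : ℝ) :
    HasSum (fun q => ε ^ q • ∫ s in (0 : ℝ)..T, conjCoeff K q s (K s)) (scaleGen K T ε) := by
  rw [scaleGen_eq hK hT]
  exact hasSum_integral_volterra (locBdd_mulRight_ad hK) 1 (expGrowth_pow ε)
    (A := fun s => ContinuousLinearMap.apply ℝ A (K s))
    (LocBdd.clm_comp (F := (A →L[ℝ] A) →L[ℝ] A) hK (ContinuousLinearMap.apply ℝ A)) hT

/-- Duhamel's formula: V = ∂v/∂ε satisfies V' = (ε V + v) K in time, hence (V u)' = v K u, and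
integrating over the period identifies V u with the generator. -/
theorem hasDerivAt_rightProp (hK : LocBdd K) {T : ℝ} (hT : 0 ≤ T) (ε : ℝ) :
    HasDerivAt (fun e => rightProp K e T) (scaleGen K T ε * rightProp K ε T) ε := by
  have h := hasDerivAt_volterraSum_pow (locBdd_mulRight hK) 1 ε hT
  set V := volterraSum (fun s => (ContinuousLinearMap.mul ℝ A).flip (K s)) 1
    (fun q => q * ε ^ (q - 1)) with hV
  have h1 : IsPrimitive V fun s => (ε • V s + rightProp K ε s) * K s :=
    volterraSum_deriv_isPrimitive (locBdd_mulRight hK) 1 ε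
  have h2 := (h1.mul (leftProp_isPrimitive hK ε)).congr_deriv
    (φ' := fun s => rightProp K ε s * K s * leftProp K ε s) fun t => by
      simp only [mul_smul_comm, add_mul, smul_mul_assoc]
      rw [mul_neg, smul_neg]
      noncomm_ring
  have h3 := h2.eq_add_integral hT
  have h4 : V 0 = 0 := by simp [hV, volterraSum_zero]
  rw [h4, zero_mul, zero_add] at h3
  have h5 : V T = scaleGen K T ε * rightProp K ε T := by
    rw [scaleGen, ← h3, mul_assoc, leftProp_mul_rightProp hK ε hT, mul_one]
  rwa [h5] at h

theorem hasDerivAt_leftProp (hK : LocBdd K) {T : ℝ} (hT : 0 ≤ T) (ε : ℝ) :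
    HasDerivAt (fun e => leftProp K e T) (-(leftProp K ε T * scaleGen K T ε)) ε := by
  have h := hasDerivAt_volterraSum_pow (locBdd_mulLeft hK) 1 ε hT
  set V := volterraSum (fun s => -ContinuousLinearMap.mul ℝ A (K s)) 1
    (fun q => q * ε ^ (q - 1))
  have h1 : HasDerivAt (fun e => leftProp K e T * rightProp K e T)
      (V T * rightProp K ε T + leftProp K ε T * (scaleGen K T ε * rightProp K ε T)) ε :=
    h.mul (hasDerivAt_rightProp hK hT ε)
  have h2 : HasDerivAt (fun e => leftProp K e T * rightProp K e T) 0 ε := by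
    simp only [leftProp_mul_rightProp hK _ hT]
    exact hasDerivAt_const ε _
  have h3 := h1.unique h2
  have h4 : V T = -(leftProp K ε T * scaleGen K T ε) := by
    have := congrArg (· * leftProp K ε T) h3
    simp only [add_mul, mul_assoc, rightProp_mul_leftProp hK ε hT, mul_one, zero_mul] at this
    exact eq_neg_of_add_eq_zero_left this
  rwa [h4] at h

end Propagators

/-! ### The derivative of the exponential and a truncated logarithm -/

section Exponentials

variable {A : Type*} [NormedRing A] [NormedAlgebra ℝ A] [CompleteSpace A]

theorem exp_continuous_real : Continuous (NormedSpace.exp : A → A) :=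
  let _ := NormedAlgebra.restrictScalars ℚ ℝ A; NormedSpace.exp_continuous

theorem exp_mul_exp_neg (x : A) : NormedSpace.exp x * NormedSpace.exp (-x) = 1 := by
  let _ := NormedAlgebra.restrictScalars ℚ ℝ A
  rw [← NormedSpace.exp_add_of_commute (Commute.neg_right (Commute.refl x)), add_neg_cancel,
    NormedSpace.exp_zero]

theorem exp_neg_mul_exp (x : A) : NormedSpace.exp (-x) * NormedSpace.exp x = 1 := by
  simpa using exp_mul_exp_neg (-x)

/-- The function e^(-s ad x)(e^(sx) Y e^(-sx)) has zero derivative in s. -/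
theorem exp_mul_exp_neg_eq_exp_adL (x Y : A) :
    NormedSpace.exp x * (Y * NormedSpace.exp (-x)) = NormedSpace.exp (adL x) Y := by
  have h1 : ∀ s : ℝ, HasDerivAt
      (fun s : ℝ => NormedSpace.exp (s • x) * (Y * NormedSpace.exp (s • -x)))
      (adL x (NormedSpace.exp (s • x) * (Y * NormedSpace.exp (s • -x)))) s := by
    intro s
    have := (hasDerivAt_exp_smul_const' (𝕂 := ℝ) x s).mul
      ((hasDerivAt_exp_smul_const (𝕂 := ℝ) (-x) s).const_mul Y)
    convert! this using 1
    rw [adL_apply]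
    noncomm_ring
  have h2 : ∀ s : ℝ, HasDerivAt
      (fun s : ℝ => NormedSpace.exp (s • -adL x)
        (NormedSpace.exp (s • x) * (Y * NormedSpace.exp (s • -x)))) 0 s := by
    intro s
    have := (hasDerivAt_exp_smul_const (𝕂 := ℝ) (-adL x) s).clm_apply (h1 s)
    convert! this using 1
    simp
  have h3 := is_const_of_deriv_eq_zero (fun s => (h2 s).differentiableAt)
    (fun s => (h2 s).deriv) 1 0
  have h0 : NormedSpace.exp ((0 : ℝ) • -adL x) = (1 : A →L[ℝ] A) := by
    rw [show ((0 : ℝ) • -adL x : A →L[ℝ] A) = 0 from zero_smul ℝ (-adL x), NormedSpace.exp_zero]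
  rw [h0, one_smul, one_smul, one_smul, zero_smul, zero_smul, NormedSpace.exp_zero, one_mul,
    mul_one, one_apply_eq_self] at h3
  have h4 := congrArg (fun y => (NormedSpace.exp (adL x) : A →L[ℝ] A) y) h3
  simp only [← mul_apply_eq_comp, exp_mul_exp_neg, one_apply_eq_self] at h4
  exact h4

theorem integral_mul_right_of_integrable {f : ℝ → A} {a b : ℝ}
    (hf : IntervalIntegrable f volume a b) (c : A) :
    ∫ s in a..b, f s * c = (∫ s in a..b, f s) * c :=
  ((ContinuousLinearMap.mul ℝ A).flip c).intervalIntegral_comp_comm hf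

/-- `phi z = (e^z - 1) / z`. -/
noncomputable def phi (z : A) : A := ∫ s in (0 : ℝ)..1, NormedSpace.exp (s • z)

theorem continuous_exp_smul (z : A) : Continuous fun s : ℝ => NormedSpace.exp (s • z) :=
  exp_continuous_real.comp (by fun_prop)

theorem exp_sub_exp (X Y : A) : NormedSpace.exp X - NormedSpace.exp Y =
    ∫ s in (0 : ℝ)..1, NormedSpace.exp (s • X) * ((X - Y) * NormedSpace.exp ((1 - s) • Y)) := by
  have h : ∀ s : ℝ, HasDerivAt
      (fun s : ℝ => NormedSpace.exp (s • X) * NormedSpace.exp ((1 - s) • Y))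
      (NormedSpace.exp (s • X) * ((X - Y) * NormedSpace.exp ((1 - s) • Y))) s := by
    intro s
    have h1 := (hasDerivAt_exp_smul_const' (𝕂 := ℝ) Y (1 - s)).scomp s
      ((hasDerivAt_id s).const_sub 1)
    have := (hasDerivAt_exp_smul_const (𝕂 := ℝ) X s).mul h1
    convert! this using 1
    simp
    noncomm_ring
  rw [intervalIntegral.integral_eq_sub_of_hasDerivAt (fun s _ => h s)]
  · simp
  · refine Continuous.intervalIntegrable ?_ _ _
    refine (continuous_exp_smul X).mul (continuous_const.mul ?_)
    exact (continuous_exp_smul Y).comp (continuous_const.sub continuous_id)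

/-- The divided difference of the exponential. -/
noncomputable def expDiv (X Y : A) : A →L[ℝ] A :=
  ∫ s in (0 : ℝ)..1, sandwich (NormedSpace.exp (s • X)) (NormedSpace.exp ((1 - s) • Y))

theorem continuous_expDiv_integrand (Y : A) : Continuous (Function.uncurry fun (X : A) (s : ℝ) =>
    sandwich (NormedSpace.exp (s • X)) (NormedSpace.exp ((1 - s) • Y))) := by
  have h1 : Continuous fun p : A × ℝ => NormedSpace.exp (p.2 • p.1) :=
    exp_continuous_real.comp (by fun_prop)
  have h2 : Continuous fun p : A × ℝ => NormedSpace.exp ((1 - p.2) • Y) :=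
    exp_continuous_real.comp (by fun_prop)
  exact ((sandwich (A := A)).continuous.comp h1).clm_apply h2

theorem expDiv_apply (X Y Z : A) : expDiv X Y Z =
    ∫ s in (0 : ℝ)..1, NormedSpace.exp (s • X) * (Z * NormedSpace.exp ((1 - s) • Y)) := by
  rw [expDiv, ContinuousLinearMap.intervalIntegral_apply]
  · rfl
  · exact ((continuous_expDiv_integrand Y).comp
      (Continuous.prodMk_right X)).intervalIntegrable _ _

theorem expDiv_self_apply (Y Z : A) : expDiv Y Y Z = phi (adL Y) Z * NormedSpace.exp Y := by
  rw [expDiv_apply, phi, ContinuousLinearMap.intervalIntegral_apply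
    ((continuous_exp_smul _).intervalIntegrable _ _), ← integral_mul_right_of_integrable
    (((continuous_exp_smul (adL Y)).clm_apply continuous_const).intervalIntegrable _ _)]
  refine intervalIntegral.integral_congr fun s _ => ?_
  rw [← map_smul, ← exp_mul_exp_neg_eq_exp_adL, mul_assoc, mul_assoc]
  congr 2
  let _ := NormedAlgebra.restrictScalars ℚ ℝ A
  rw [← NormedSpace.exp_add_of_commute (((Commute.refl Y).smul_left s).neg_left)]
  congr 1
  module

/-- By `exp_sub_exp` the increment of the exponential is exactly `expDiv X Y (X - Y)`, so continuity
of the divided difference in X gives the derivative. -/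
theorem hasFDerivAt_exp_expDiv (Y : A) : HasFDerivAt NormedSpace.exp (expDiv Y Y) Y := by
  have hc : Continuous fun X => expDiv X Y :=
    intervalIntegral.continuous_parametric_intervalIntegral_of_continuous'
      (continuous_expDiv_integrand Y) 0 1
  rw [hasFDerivAt_iff_isLittleO]
  have h1 : (fun X => expDiv X Y - expDiv Y Y) =o[𝓝 Y] fun _ => (1 : ℝ) := by
    rw [Asymptotics.isLittleO_one_iff]
    simpa using (hc.tendsto Y).sub_const (expDiv Y Y)
  have h2 : (fun X => (expDiv X Y - expDiv Y Y) (X - Y)) =o[𝓝 Y] fun X => X - Y := by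
    have h3 : (fun X => ‖expDiv X Y - expDiv Y Y‖ * ‖X - Y‖) =o[𝓝 Y] fun X => 1 * ‖X - Y‖ :=
      h1.norm_left.mul_isBigO (Asymptotics.isBigO_refl _ _)
    refine (Asymptotics.IsBigO.trans_isLittleO (Asymptotics.isBigO_of_le _ fun X => ?_) h3).trans_isBigO
      (Asymptotics.isBigO_of_le _ fun X => by simp)
    rw [Real.norm_of_nonneg (by positivity)]
    exact ContinuousLinearMap.le_opNorm _ _
  refine h2.congr_left fun X => ?_
  rw [sub_apply, expDiv_apply X Y, ← exp_sub_exp]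

theorem hasDerivAt_exp_comp {x : ℝ → A} {x' : A} {ε : ℝ} (h : HasDerivAt x x' ε) :
    HasDerivAt (fun e => NormedSpace.exp (x e))
      (phi (adL (x ε)) x' * NormedSpace.exp (x ε)) ε := by
  rw [← expDiv_self_apply]
  exact (hasFDerivAt_exp_expDiv (x ε)).comp_hasDerivAt ε h

theorem hasDerivAt_exp_neg_comp {x : ℝ → A} {x' : A} {ε : ℝ} (h : HasDerivAt x x' ε) :
    HasDerivAt (fun e => NormedSpace.exp (-x e))
      (-(NormedSpace.exp (-x ε) * phi (adL (x ε)) x')) ε := by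
  have h0 := hasDerivAt_exp_comp h.neg
  set V := phi (adL (-x ε)) (-x') * NormedSpace.exp (-x ε)
  have h1 := h0.mul (hasDerivAt_exp_comp h)
  have h2 : HasDerivAt (fun e => NormedSpace.exp (-x e) * NormedSpace.exp (x e)) 0 ε := by
    simp only [exp_neg_mul_exp]
    exact hasDerivAt_const ε _
  have h3 := h1.unique h2
  have h4 : V = -(NormedSpace.exp (-x ε) * phi (adL (x ε)) x') := by
    have := congrArg (· * NormedSpace.exp (-x ε)) h3
    simp only [add_mul, mul_assoc, exp_mul_exp_neg, mul_one, zero_mul] at this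
    exact eq_neg_of_add_eq_zero_left this
  rw [← h4]
  exact h0

/-- The truncation of the power series of `log (1 + W) / W`. -/
noncomputable def logDiv (N : ℕ) (W : A) : A :=
  ∑ k ∈ Finset.range N, ((-1 : ℝ) ^ k / (k + 1)) • W ^ k

/-- An exact form of (W/z) · (log(1 + W)/W) = 1 for W = e^z - 1, with remainder and without dividing
by z. With W(s) = e^(sz) - 1 and Φ(s) = ∫_0^s e^(rz) dr one has Φ z = W, so Φ W^k has derivative (k
+ 1)(1 + W) W^k. The factor k + 1 cancels the denominator in the logarithm and leaves a geometric
sum. -/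
theorem phi_mul_logDiv (N : ℕ) (z : A) : phi z * logDiv N (NormedSpace.exp z - 1) =
    1 - ∫ s in (0 : ℝ)..1, (-(NormedSpace.exp (s • z) - 1)) ^ N := by
  set W : ℝ → A := fun s => NormedSpace.exp (s • z) - 1 with hW
  set Φ : ℝ → A := fun s => ∫ r in (0 : ℝ)..s, NormedSpace.exp (r • z) with hΦ
  have hWc : Continuous W := (continuous_exp_smul z).sub continuous_const
  have hΦd : ∀ s, HasDerivAt Φ (1 + W s) s := fun s => by
    simpa [hW] using intervalIntegral.integral_hasDerivAt_right
      ((continuous_exp_smul z).intervalIntegrable 0 s)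
      ((continuous_exp_smul z).stronglyMeasurableAtFilter _ _) (continuous_exp_smul z).continuousAt
  have hWd : ∀ s, HasDerivAt W (z * (1 + W s)) s := fun s => by
    simpa [hW] using (hasDerivAt_exp_smul_const' (𝕂 := ℝ) z s).sub_const 1
  have hΦz : ∀ s, Φ s * z = W s := fun s => by
    have h1 : ∀ r ∈ uIcc 0 s, HasDerivAt W (NormedSpace.exp (r • z) * z) r := fun r _ =>
      (hasDerivAt_exp_smul_const (𝕂 := ℝ) z r).sub_const 1
    have h2 := intervalIntegral.integral_eq_sub_of_hasDerivAt h1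
      (((continuous_exp_smul z).mul continuous_const).intervalIntegrable _ _)
    rw [integral_mul_right_of_integrable ((continuous_exp_smul z).intervalIntegrable _ _)] at h2
    rw [hΦ, h2]
    simp [hW]
  have hzW : ∀ s, Commute z (W s) := fun s => by
    let _ := NormedAlgebra.restrictScalars ℚ ℝ A
    exact (Commute.exp_right ((Commute.refl z).smul_right s)).sub_right (Commute.one_right _)
  have hWk : ∀ k s, HasDerivAt (fun s => W s ^ k) (k • (z * (1 + W s) * W s ^ (k - 1))) s := by
    intro k s
    induction k with
    | zero => simpa using hasDerivAt_const s (1 : A)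
    | succ k ih =>
      have h0 : (fun s => W s ^ (k + 1)) = fun s => W s ^ k * W s := by simp only [pow_succ]
      rw [h0]
      convert! ih.fun_mul (hWd s) using 1
      have hc : Commute (W s ^ k) (z * (1 + W s)) :=
        ((hzW s).symm.pow_left k).mul_right
          ((Commute.one_right _).add_right ((Commute.refl (W s)).pow_left k))
      rw [hc.eq, add_tsub_cancel_right, succ_nsmul]
      congr 1
      rcases k with _ | k
      · simp
      · rw [add_tsub_cancel_right, smul_mul_assoc, mul_assoc _ (W s ^ k), ← pow_succ]
  have hterm : ∀ (k : ℕ) (s : ℝ), HasDerivAt (fun s => Φ s * W s ^ k)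
      ((k + 1 : ℝ) • ((1 + W s) * W s ^ k)) s := by
    intro k s
    have := (hΦd s).fun_mul (hWk k s)
    convert! this using 1
    rcases k with _ | k
    · simp
    · rw [add_tsub_cancel_right, mul_smul_comm, ← mul_assoc, ← mul_assoc, hΦz, add_smul, one_smul,
        add_comm, ← Nat.cast_smul_eq_nsmul ℝ]
      congr 2
      rw [pow_succ' (W s), ← mul_assoc]
      congr 1
      exact ((Commute.one_left _).add_left (Commute.refl _)).eq
  have hsum : ∀ s, HasDerivAt (fun s => Φ s * logDiv N (W s)) (1 - (-W s) ^ N) s := by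
    intro s
    have h1 : HasDerivAt (fun s => ∑ k ∈ Finset.range N, ((-1 : ℝ) ^ k / (k + 1)) • (Φ s * W s ^ k))
        (∑ k ∈ Finset.range N, ((-1 : ℝ) ^ k / (k + 1)) • ((k + 1 : ℝ) • ((1 + W s) * W s ^ k))) s :=
      HasDerivAt.fun_sum fun k _ => (hterm k s).fun_const_smul _
    convert! h1 using 1
    · ext s
      simp only [logDiv, Finset.mul_sum, mul_smul_comm]
    · rw [← mul_neg_geom_sum, Finset.mul_sum, sub_neg_eq_add]
      refine Finset.sum_congr rfl fun k _ => ?_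
      rw [smul_smul, div_mul_cancel₀ _ (by positivity), ← mul_smul_comm]
      congr 1
      rcases k.even_or_odd with h | h <;> simp [h.neg_pow]
  have h1 := intervalIntegral.integral_eq_sub_of_hasDerivAt (fun s _ => hsum s)
    ((continuous_const.sub (hWc.neg.pow N)).intervalIntegrable 0 1)
  rw [intervalIntegral.integral_sub (f := fun _ => (1 : A)) (g := fun s => (-W s) ^ N)
    (continuous_const.intervalIntegrable _ _) ((hWc.neg.pow N).intervalIntegrable _ _)] at h1
  simp only [hΦ, intervalIntegral.integral_same, zero_mul, sub_zero,
    intervalIntegral.integral_const, one_smul] at h1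
  rw [h1]
  simp [phi, hW]

end Exponentials

/-! ### Nested integrals with a parameter y and their generating function -/

section Nested

variable {A : Type*} [NormedRing A] [NormedAlgebra ℝ A] [CompleteSpace A]

/-- The nested commutators `[K(s), -y ∫_0^s g + (1 - y) ∫_s^T g]`. -/
noncomputable def nestIter (K : ℝ → A) (T y : ℝ) : ℕ → ℝ → A
  | 0, s => K s
  | p + 1, s => adL (K s) ((1 - y) • (∫ r in (0 : ℝ)..T, nestIter K T y p r) -
      ∫ r in (0 : ℝ)..s, nestIter K T y p r)

variable {K : ℝ → A} {T : ℝ}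

theorem nestIter_locBdd (hK : LocBdd K) (T y : ℝ) (p : ℕ) : LocBdd (nestIter K T y p) := by
  induction p with
  | zero => exact hK
  | succ p ih =>
    exact (locBdd_ad hK).clm_apply ((LocBdd.const _).sub (IsPrimitive.integral ih).locBdd_self)

theorem nestIter_bound (hK : LocBdd K) (hT : 0 ≤ T) (p : ℕ) :
    ∃ M, ∀ y ∈ Icc (0 : ℝ) 1, ∀ s ∈ Icc 0 T, ‖nestIter K T y p s‖ ≤ M := by
  induction p with
  | zero =>
    obtain ⟨M, hM⟩ := hK.bdd T
    exact ⟨M, fun y _ s hs => hM s hs⟩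
  | succ p ih =>
    obtain ⟨M, hM⟩ := ih
    obtain ⟨c, hc⟩ := (locBdd_ad hK).bdd T
    have hM0 : 0 ≤ M := (norm_nonneg _).trans (hM 0 (by simp) 0 ⟨le_rfl, hT⟩)
    refine ⟨c * (M * T + M * T), fun y hy s hs => ((adL (K s)).le_opNorm _).trans ?_⟩
    have hint : ∀ s ∈ Icc 0 T, ‖∫ r in (0 : ℝ)..s, nestIter K T y p r‖ ≤ M * T := by
      intro s hs
      refine (intervalIntegral.norm_integral_le_of_norm_le_const (C := M) fun r hr => ?_).trans ?_
      · rw [uIoc_of_le hs.1] at hr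
        exact hM y hy r ⟨hr.1.le, hr.2.trans hs.2⟩
      · rw [sub_zero, abs_of_nonneg hs.1]
        gcongr
        exact hs.2
    have h1 : ‖(1 - y) • ∫ r in (0 : ℝ)..T, nestIter K T y p r‖ ≤ M * T := by
      rw [norm_smul, Real.norm_of_nonneg (by linarith [hy.2])]
      calc _ ≤ 1 * (M * T) := by
            gcongr
            · linarith [hy.1]
            · exact hint T ⟨hT, le_rfl⟩
        _ = _ := one_mul _
    have hc0 := (norm_nonneg _).trans (hc s hs)
    exact mul_le_mul (hc s hs) ((norm_sub_le _ _).trans (add_le_add h1 (hint s hs)))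
      (norm_nonneg _) hc0

/-- The truncated generating function of the nested integrals. -/
noncomputable def nestSum (K : ℝ → A) (T : ℝ) (N : ℕ) (ε y : ℝ) : A :=
  ∑ p ∈ Finset.range N, ε ^ (p + 1) • ∫ s in (0 : ℝ)..T, nestIter K T y p s

/-- Summing the recursion of the nested commutators gives the linear equation P' = ε K + ε [K, (1 -
y) Q - P] for the integrated generating function P with P(T) = Q, up to a term of order ε^(N+1).
Conjugating by the propagator removes the commutator, and the boundary values (1 - y) Q at time 0
and -y Q at time T produce Q + y (Ad - 1) Q. -/
theorem nestSum_equation (hK : LocBdd K) (hT : 0 ≤ T) (N : ℕ) (ε y : ℝ) :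
    nestSum K T N ε y + y • (conjProp K ε T - 1) (nestSum K T N ε y) =
      ε • scaleGen K T ε -
        ε ^ (N + 1) • ∫ s in (0 : ℝ)..T, conjProp K ε s (nestIter K T y N s) := by
  set Q := nestSum K T N ε y with hQ
  set P : ℝ → A := fun s => ∑ p ∈ Finset.range N,
    ε ^ (p + 1) • ∫ r in (0 : ℝ)..s, nestIter K T y p r with hP
  set g : ℝ → A := fun s => ∑ p ∈ Finset.range N, ε ^ (p + 1) • nestIter K T y p s with hg
  have hPg : IsPrimitive P g := by
    rw [hP, hg]
    clear hP hg hQ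
    clear P g Q
    induction N with
    | zero => simpa using IsPrimitive.const (0 : A)
    | succ N ih =>
      have h1 := ih.sub ((IsPrimitive.integral (nestIter_locBdd hK T y N)).clm_comp
        (-(ε ^ (N + 1)) • ContinuousLinearMap.id ℝ A))
      simpa [Finset.sum_range_succ] using h1
  have hgeq : ∀ s, g s = ε • K s + ε • adL (K s) ((1 - y) • Q - P s) -
      ε ^ (N + 1) • nestIter K T y N s := by
    intro s
    have h1 : adL (K s) ((1 - y) • Q - P s) =
        ∑ p ∈ Finset.range N, ε ^ (p + 1) • nestIter K T y (p + 1) s := by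
      rw [hQ, nestSum, hP, Finset.smul_sum, ← Finset.sum_sub_distrib, map_sum]
      refine Finset.sum_congr rfl fun p _ => ?_
      rw [smul_comm, ← smul_sub, map_smul]
      rfl
    rw [h1, Finset.smul_sum, eq_sub_iff_add_eq, ← Finset.sum_range_succ, Finset.sum_range_succ',
      add_comm]
    simp only [smul_smul, ← pow_succ', zero_add, pow_one]
    rfl
  -- In the derivative of `conjProp K ε s` applied to (1 - y) Q - P(s), the commutator coming from
  -- the propagator cancels the one contained in g.
  have h1 := (conjProp_isPrimitive hK ε).clm_apply
    ((IsPrimitive.const ((1 - y) • Q)).sub hPg)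
  have h2 := h1.congr_deriv (φ' := fun s => (-ε) • conjProp K ε s (K s) +
    ε ^ (N + 1) • conjProp K ε s (nestIter K T y N s)) fun s => by
      rw [hgeq]
      simp only [smul_apply, ContinuousLinearMap.comp_apply, map_sub, map_smul, map_add, zero_sub,
        map_neg, neg_smul]
      module
  have h3 := h2.eq_add_integral hT
  have hl1 : LocBdd fun s => conjProp K ε s (K s) :=
    (conjProp_isPrimitive hK ε).locBdd_self.clm_apply hK
  have hl2 : LocBdd fun s => conjProp K ε s (nestIter K T y N s) :=
    (conjProp_isPrimitive hK ε).locBdd_self.clm_apply (nestIter_locBdd hK T y N)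
  rw [intervalIntegral.integral_add ((hl1.smul _).intervalIntegrable le_rfl hT)
    ((hl2.smul _).intervalIntegrable le_rfl hT), intervalIntegral.integral_smul,
    intervalIntegral.integral_smul, ← scaleGen_eq hK hT, conjProp_zero] at h3
  have hPT : P T = Q := rfl
  have hP0 : P 0 = 0 := by simp [hP]
  rw [hPT, hP0, sub_zero, one_apply_eq_self, show (1 - y) • Q - Q = (-y) • Q by module,
    map_smul] at h3
  rw [sub_apply, one_apply_eq_self, smul_sub]
  have h4 : y • conjProp K ε T Q = -((-y) • conjProp K ε T Q) := by module
  rw [h4, h3]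
  module

theorem volterraSum_uniform_bound {E : Type*} [NormedAddCommGroup E] [NormedSpace ℝ E]
    [CompleteSpace E] {L : ℝ → E →L[ℝ] E} (hL : LocBdd L) (x : E) (R : ℝ) :
    ∃ M, ∀ ε ∈ Icc (0 : ℝ) 1, ∀ s ∈ Icc 0 R, ‖volterraSum L x (fun q => ε ^ q) s‖ ≤ M := by
  obtain ⟨b, hb, h⟩ := exists_volterra_bound hL x (expGrowth_pow 1) R
  refine ⟨∑' q, b q, fun ε hε s hs => ?_⟩
  have h1 : ∀ q, ‖ε ^ q • volterra L x q s‖ ≤ b q := fun q => by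
    refine le_trans ?_ (h q s hs)
    rw [norm_smul, norm_smul]
    refine mul_le_mul_of_nonneg_right ?_ (norm_nonneg _)
    rw [one_pow, norm_one, norm_pow, Real.norm_of_nonneg hε.1]
    exact pow_le_one₀ hε.1 hε.2
  exact tsum_of_norm_bounded hb.hasSum h1

theorem norm_pow_apply_le {E : Type*} [NormedAddCommGroup E] [NormedSpace ℝ E] (W : E →L[ℝ] E)
    (k : ℕ) (x : E) : ‖(W ^ k) x‖ ≤ ‖W‖ ^ k * ‖x‖ := by
  induction k with
  | zero => simp
  | succ k ih =>
    rw [pow_succ', mul_apply_eq_comp, pow_succ', mul_assoc]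
    exact (W.le_opNorm _).trans (by gcongr)

/-- A finite Neumann expansion of (1 + y W)⁻¹ with exact remainder, so that no smallness of W is
needed here. -/
theorem eq_sum_neg_pow_of_add_smul {E : Type*} [NormedAddCommGroup E] [NormedSpace ℝ E]
    (W : E →L[ℝ] E) (y : ℝ) {Q b : E} (h : Q + y • W Q = b) (N : ℕ) :
    Q = ∑ k ∈ Finset.range N, (-y) ^ k • (W ^ k) b + (-y) ^ N • (W ^ N) Q := by
  induction N with
  | zero => simp
  | succ N ih =>
    rw [Finset.sum_range_succ, add_assoc]
    conv_lhs => rw [ih]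
    congr 1
    rw [← h, pow_succ W, mul_apply_eq_comp, map_add, map_smul, smul_add, smul_smul, pow_succ]
    module

end Nested

/-! ### Orders of vanishing as ε tends to 0 from the right -/

section Asymptotic

theorem isBigO_clm_apply {E F : Type*} [NormedAddCommGroup E] [NormedSpace ℝ E]
    [NormedAddCommGroup F] [NormedSpace ℝ F] {l : Filter ℝ} {f : ℝ → E →L[ℝ] F} {x : ℝ → E}
    {a b : ℝ → ℝ} (hf : f =O[l] a) (hx : x =O[l] b) :
    (fun e => f e (x e)) =O[l] fun e => a e * b e := by
  have h1 : (fun e => ‖f e‖ * ‖x e‖) =O[l] fun e => a e * b e := hf.norm_left.mul hx.norm_left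
  refine (isBigO_of_le _ fun e => ?_).trans h1
  rw [Real.norm_of_nonneg (by positivity)]
  exact (f e).le_opNorm _

theorem isBigO_pow_of_le {l : Filter ℝ} (hl : l ≤ 𝓝 0) {m n : ℕ} (h : m ≤ n) :
    (fun e : ℝ => e ^ n) =O[l] fun e => e ^ m :=
  (IsBigO.of_bound 1 (by
    have : ∀ᶠ e : ℝ in 𝓝 0, |e| < 1 := by
      filter_upwards [Metric.ball_mem_nhds (0 : ℝ) one_pos] with e he
      simpa using he
    filter_upwards [this] with e he
    rw [one_mul, norm_pow, norm_pow]
    exact pow_le_pow_of_le_one (norm_nonneg _) he.le h)).mono hl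

variable {A : Type*} [NormedRing A] [NormedAlgebra ℝ A] [CompleteSpace A]

theorem pow_sub_pow_isBigO {l : Filter ℝ} {U V : ℝ → A} {a : ℝ → ℝ}
    (hU : U =O[l] fun _ => (1 : ℝ)) (hV : V =O[l] fun _ => (1 : ℝ))
    (h : (fun e => U e - V e) =O[l] a) (k : ℕ) : (fun e => U e ^ k - V e ^ k) =O[l] a := by
  induction k with
  | zero => simpa using isBigO_zero a l
  | succ k ih =>
    have hUk : (fun e => U e ^ k) =O[l] fun _ => (1 : ℝ) := by
      simpa using hU.pow k
    have h1 : (fun e => U e ^ k * (U e - V e)) =O[l] a := by simpa using hUk.mul h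
    have h2 : (fun e => (U e ^ k - V e ^ k) * V e) =O[l] a := by simpa using ih.mul hV
    refine (h1.add h2).congr_left fun e => ?_
    noncomm_ring

theorem logDiv_sub_isBigO {l : Filter ℝ} {U V : ℝ → A} {a : ℝ → ℝ}
    (hU : U =O[l] fun _ => (1 : ℝ)) (hV : V =O[l] fun _ => (1 : ℝ))
    (h : (fun e => U e - V e) =O[l] a) (N : ℕ) :
    (fun e => logDiv N (U e) - logDiv N (V e)) =O[l] a := by
  simp only [logDiv, ← Finset.sum_sub_distrib, ← smul_sub]
  exact IsBigO.fun_sum fun k _ => (pow_sub_pow_isBigO hU hV h k).const_smul_left ((-1 : ℝ) ^ k / (k + 1))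

theorem exp_smul_sub_one_bound : ∃ C δ : ℝ, 0 < δ ∧ 0 ≤ C ∧ ∀ z : A, ‖z‖ < δ →
    ∀ s ∈ Icc (0 : ℝ) 1, ‖NormedSpace.exp (s • z) - 1‖ ≤ C * ‖z‖ := by
  have h := (hasFDerivAt_exp_expDiv (0 : A)).isBigO_sub
  simp only [NormedSpace.exp_zero, sub_zero] at h
  obtain ⟨C, hC, hb⟩ := h.exists_nonneg
  obtain ⟨δ, hδ, hball⟩ := Metric.eventually_nhds_iff.1 hb.bound
  refine ⟨C, δ, hδ, hC, fun z hz s hs => ?_⟩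
  have h1 : ‖s • z‖ ≤ ‖z‖ := by
    rw [norm_smul, Real.norm_of_nonneg hs.1]
    exact mul_le_of_le_one_left (norm_nonneg _) hs.2
  refine (hball (y := s • z) (by rw [dist_zero_right]; exact h1.trans_lt hz)).trans ?_
  gcongr

theorem exists_exp_smul_bound {l : Filter ℝ} (hl : l ≤ 𝓝[>] 0) {z : ℝ → A}
    (hz : z =O[l] fun e => e) :
    ∃ C : ℝ, 0 ≤ C ∧ ∀ᶠ e in l, ∀ s ∈ Icc (0 : ℝ) 1,
      ‖NormedSpace.exp (s • z e) - 1‖ ≤ C * e := by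
  obtain ⟨C, δ, hδ, hC, h⟩ := exp_smul_sub_one_bound (A := A)
  obtain ⟨c, hc, hcz⟩ := hz.exists_nonneg
  have hz0 : Tendsto z l (𝓝 0) :=
    hz.trans_tendsto (tendsto_id'.2 (hl.trans nhdsWithin_le_nhds))
  refine ⟨C * c, by positivity, ?_⟩
  filter_upwards [hcz.bound, hz0 (Metric.ball_mem_nhds 0 hδ), hl self_mem_nhdsWithin]
    with e h1 h2 h3 s hs
  have h3' : (0 : ℝ) < e := h3
  refine (h (z e) (by simpa using h2) s hs).trans ?_
  rw [Real.norm_of_nonneg h3'.le] at h1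
  rw [mul_assoc]
  gcongr

theorem phi_isBigO_one {l : Filter ℝ} (hl : l ≤ 𝓝[>] 0) {z : ℝ → A} (hz : z =O[l] fun e => e) :
    (fun e => phi (z e)) =O[l] fun _ => (1 : ℝ) := by
  obtain ⟨C, hC, h⟩ := exists_exp_smul_bound hl hz
  have h1 : ∀ᶠ e : ℝ in l, e < 1 :=
    hl.trans nhdsWithin_le_nhds (Iio_mem_nhds one_pos)
  refine IsBigO.of_bound (C + ‖(1 : A)‖) ?_
  filter_upwards [h, h1] with e he he1
  rw [norm_one (α := ℝ), mul_one]
  refine (intervalIntegral.norm_integral_le_of_norm_le_const (C := C + ‖(1 : A)‖)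
    fun s hs => ?_).trans (by simp)
  rw [uIoc_of_le zero_le_one] at hs
  have h2 := he s ⟨hs.1.le, hs.2⟩
  have h3 : C * e ≤ C := mul_le_of_le_one_right hC he1.le
  calc ‖NormedSpace.exp (s • z e)‖ = ‖(NormedSpace.exp (s • z e) - 1) + 1‖ := by
        rw [sub_add_cancel]
    _ ≤ _ := (norm_add_le _ _).trans (add_le_add (h2.trans h3) le_rfl)

theorem phi_mul_logDiv_sub_one_isBigO {l : Filter ℝ} (hl : l ≤ 𝓝[>] 0) {z : ℝ → A}
    (hz : z =O[l] fun e => e) {N : ℕ} (hN : 0 < N) :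
    (fun e => phi (z e) * logDiv N (NormedSpace.exp (z e) - 1) - 1) =O[l] fun e => e ^ N := by
  obtain ⟨C, hC, h⟩ := exists_exp_smul_bound hl hz
  refine IsBigO.of_bound (C ^ N) ?_
  filter_upwards [h, hl self_mem_nhdsWithin] with e he h0
  have h0' : (0 : ℝ) < e := h0
  rw [phi_mul_logDiv, sub_sub_cancel_left, norm_neg, norm_pow, Real.norm_of_nonneg h0'.le, ← mul_pow]
  refine (intervalIntegral.norm_integral_le_of_norm_le_const (C := (C * e) ^ N)
    fun s hs => ?_).trans (by simp)
  rw [uIoc_of_le zero_le_one] at hs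
  refine (norm_pow_le' _ hN).trans ?_
  rw [norm_neg]
  exact pow_le_pow_left₀ (norm_nonneg _) (he s ⟨hs.1.le, hs.2⟩) N

/-- Integration of a bound on the derivative near the origin. -/
theorem sub_isBigO_of_deriv_isBigO {E : Type*} [NormedAddCommGroup E] [NormedSpace ℝ E]
    {f f' : ℝ → E} (hf : ∀ e, HasDerivAt f (f' e) e) {m : ℕ}
    (h : f' =O[𝓝[>] 0] fun e => e ^ m) : (fun e => f e - f 0) =O[𝓝[>] 0] fun e => e ^ (m + 1) := by
  obtain ⟨C, hC, hb⟩ := h.exists_nonneg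
  obtain ⟨δ, hδ, hsub⟩ := mem_nhdsGT_iff_exists_Ioo_subset.1 hb.bound
  refine IsBigO.of_bound C ?_
  filter_upwards [Ioo_mem_nhdsGT hδ] with e he
  -- The bound on f' holds only for positive arguments, so the mean value inequality is used on [η,
  -- e] and η tends to 0 afterwards.
  have h1 : ∀ η ∈ Ioo 0 e, ‖f e - f η‖ ≤ C * e ^ (m + 1) := by
    intro η hη
    have h2 : ∀ x ∈ Icc η e, ‖f' x‖ ≤ C * e ^ m := fun x hx => by
      have h3 : x ∈ Ioo 0 δ := ⟨hη.1.trans_le hx.1, hx.2.trans_lt he.2⟩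
      refine (hsub h3).trans ?_
      rw [norm_pow, Real.norm_of_nonneg h3.1.le]
      have := h3.1.le
      have := hx.2
      gcongr
    have h4 := (convex_Icc η e).norm_image_sub_le_of_norm_hasDerivWithin_le
      (fun x _ => (hf x).hasDerivWithinAt) h2 (left_mem_Icc.2 hη.2.le) (right_mem_Icc.2 hη.2.le)
    refine h4.trans ?_
    rw [Real.norm_of_nonneg (by linarith [hη.2]), pow_succ, mul_assoc]
    have := he.1.le
    gcongr
    linarith [hη.1]
  have h5 : Tendsto (fun η => ‖f e - f η‖) (𝓝[>] 0) (𝓝 ‖f e - f 0‖) :=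
    ((hf 0).continuousAt.tendsto.mono_left nhdsWithin_le_nhds).const_sub _ |>.norm
  rw [norm_pow, Real.norm_of_nonneg he.1.le]
  refine le_of_tendsto h5 ?_
  filter_upwards [Ioo_mem_nhdsGT he.1] with η hη using h1 η hη

end Asymptotic

/-! ### The Magnus exponent solves the generator equation to order N -/

section Magnus

variable {A : Type*} [NormedRing A] [NormedAlgebra ℝ A] [CompleteSpace A]

/-- The polynomial `∑_{p < N} ε^(p+1) x_p`. -/
noncomputable def expoPoly (x : ℕ → A) (N : ℕ) (ε : ℝ) : A :=
  ∑ p ∈ Finset.range N, ε ^ (p + 1) • x p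

/-- The derivative of `expoPoly`. -/
noncomputable def expoPolyDeriv (x : ℕ → A) (N : ℕ) (ε : ℝ) : A :=
  ∑ p ∈ Finset.range N, ((p + 1 : ℝ) * ε ^ p) • x p

theorem hasDerivAt_expoPoly (x : ℕ → A) (N : ℕ) (ε : ℝ) :
    HasDerivAt (expoPoly x N) (expoPolyDeriv x N ε) ε := by
  refine HasDerivAt.fun_sum fun p _ => ?_
  simpa using (hasDerivAt_pow (p + 1) ε).smul_const (x p)

theorem expoPoly_zero (x : ℕ → A) (N : ℕ) : expoPoly x N 0 = 0 := by
  simp [expoPoly]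

theorem smul_expoPolyDeriv (x : ℕ → A) (N : ℕ) (ε : ℝ) :
    ε • expoPolyDeriv x N ε = ∑ p ∈ Finset.range N, ε ^ (p + 1) • ((p + 1 : ℝ) • x p) := by
  rw [expoPolyDeriv, Finset.smul_sum]
  refine Finset.sum_congr rfl fun p _ => ?_
  rw [smul_smul, smul_smul]
  congr 1
  ring

variable {K : ℝ → A} {T : ℝ}

theorem exists_scaleGen_bound (hK : LocBdd K) (hT : 0 ≤ T) :
    ∃ M, ∀ ε ∈ Icc (0 : ℝ) 1, ‖scaleGen K T ε‖ ≤ M := by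
  obtain ⟨M, hM⟩ := volterraSum_uniform_bound (locBdd_mulRight_ad hK) 1 T
  obtain ⟨c, hc⟩ := hK.bdd T
  refine ⟨M * c * T, fun ε hε => ?_⟩
  rw [scaleGen_eq hK hT]
  refine (intervalIntegral.norm_integral_le_of_norm_le_const (C := M * c) fun s hs => ?_).trans_eq
    (by rw [sub_zero, abs_of_nonneg hT])
  rw [uIoc_of_le hT] at hs
  have hs' : s ∈ Icc 0 T := ⟨hs.1.le, hs.2⟩
  have h1 := hM ε hε s hs'
  exact ((conjProp K ε s).le_opNorm _).trans (mul_le_mul h1 (hc s hs') (norm_nonneg _)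
    ((norm_nonneg _).trans h1))

theorem conjProp_sub_one_isBigO (hK : LocBdd K) (hT : 0 ≤ T) :
    (fun e => conjProp K e T - 1) =O[𝓝[>] 0] fun e => e := by
  have h := (hasDerivAt_volterraSum_pow (locBdd_mulRight_ad hK) 1 0 hT).isBigO_sub
  have h0 : conjProp K 0 T = 1 := by
    rw [conjProp, volterraSum, tsum_eq_single 0 (by intro q hq; simp [hq])]
    simp [volterra]
  simp only [sub_zero] at h
  refine (h.mono nhdsWithin_le_nhds).congr_left fun e => ?_
  change conjProp K e T - conjProp K 0 T = _
  rw [h0]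

/-- Neumann inversion of `nestSum_equation`. Both remainders are O(ε^(N+1)): one carries this power
explicitly, the other is W^N Q with W and Q of order ε. Uniformity in y allows the average over y.
-/
theorem nestSum_sub_isBigO_uniform (hK : LocBdd K) (hT : 0 ≤ T) (N : ℕ) :
    ∃ C, ∀ᶠ e in 𝓝[>] (0 : ℝ), ∀ y ∈ Icc (0 : ℝ) 1,
      ‖nestSum K T N e y - ∑ k ∈ Finset.range N, (-y) ^ k •
        ((conjProp K e T - 1) ^ k) (e • scaleGen K T e)‖ ≤ C * e ^ (N + 1) := by
  obtain ⟨M, hM⟩ := volterraSum_uniform_bound (locBdd_mulRight_ad hK) 1 T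
  obtain ⟨M₁, hM₁⟩ := nestIter_bound hK hT N
  obtain ⟨c, hc, hcW⟩ := (conjProp_sub_one_isBigO hK hT).exists_nonneg
  have hMQ : ∃ M₂, 0 ≤ M₂ ∧ ∀ e ∈ Icc (0 : ℝ) 1, ∀ y ∈ Icc (0 : ℝ) 1,
      ‖nestSum K T N e y‖ ≤ M₂ * e := by
    choose b hb using fun p => nestIter_bound hK hT p
    have hb0 : ∀ p, 0 ≤ b p := fun p =>
      (norm_nonneg _).trans (hb p 0 (by simp) 0 ⟨le_rfl, hT⟩)
    refine ⟨∑ p ∈ Finset.range N, b p * T,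
      Finset.sum_nonneg fun p _ => mul_nonneg (hb0 p) hT, fun e he y hy => ?_⟩
    rw [Finset.sum_mul]
    refine norm_sum_le_of_le _ fun p _ => ?_
    rw [norm_smul, norm_pow, Real.norm_of_nonneg he.1, mul_comm]
    refine mul_le_mul ?_ ?_ (pow_nonneg he.1 _) (mul_nonneg (hb0 p) hT)
    · refine (intervalIntegral.norm_integral_le_of_norm_le_const (C := b p)
        fun s hs => ?_).trans_eq (by rw [sub_zero, abs_of_nonneg hT])
      rw [uIoc_of_le hT] at hs
      exact hb p y hy s ⟨hs.1.le, hs.2⟩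
    · exact pow_le_of_le_one he.1 he.2 (by simp)
  obtain ⟨M₂, hM₂0, hM₂⟩ := hMQ
  have hM0 : 0 ≤ M := (norm_nonneg _).trans (hM 0 (by simp) 0 ⟨le_rfl, hT⟩)
  have hM₁0 : 0 ≤ M₁ := (norm_nonneg _).trans (hM₁ 0 (by simp) 0 ⟨le_rfl, hT⟩)
  refine ⟨∑ k ∈ Finset.range N, c ^ k * (M * M₁ * T) + c ^ N * M₂, ?_⟩
  have h1 : ∀ᶠ e : ℝ in 𝓝[>] 0, e < 1 := nhdsWithin_le_nhds (Iio_mem_nhds one_pos)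
  filter_upwards [hcW.bound, h1, self_mem_nhdsWithin] with e he he1 he0 y hy
  have he0' : (0 : ℝ) < e := he0
  have heI : e ∈ Icc (0 : ℝ) 1 := ⟨he0'.le, he1.le⟩
  rw [Real.norm_of_nonneg he0'.le] at he
  set W := conjProp K e T - 1
  set Q := nestSum K T N e y
  set r := ∫ s in (0 : ℝ)..T, conjProp K e s (nestIter K T y N s)
  have hr : ‖r‖ ≤ M * M₁ * T := by
    refine (intervalIntegral.norm_integral_le_of_norm_le_const (C := M * M₁)
      fun s hs => ?_).trans_eq (by rw [sub_zero, abs_of_nonneg hT])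
    rw [uIoc_of_le hT] at hs
    have hs' : s ∈ Icc 0 T := ⟨hs.1.le, hs.2⟩
    exact ((conjProp K e s).le_opNorm _).trans (mul_le_mul (hM e heI s hs') (hM₁ y hy s hs')
      (norm_nonneg _) hM0)
  have hE := eq_sum_neg_pow_of_add_smul W y (nestSum_equation hK hT N e y) N
  have hWc : ‖W‖ ≤ c := he.trans (mul_le_of_le_one_right hc he1.le)
  have hy1 : ∀ k : ℕ, ‖(-y) ^ k‖ ≤ 1 := fun k => by
    rw [norm_pow, norm_neg, Real.norm_of_nonneg hy.1]
    exact pow_le_one₀ hy.1 hy.2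
  have hdiff : Q - ∑ k ∈ Finset.range N, (-y) ^ k • (W ^ k) (e • scaleGen K T e) =
      -∑ k ∈ Finset.range N, (-y) ^ k • (W ^ k) (e ^ (N + 1) • r) + (-y) ^ N • (W ^ N) Q := by
    have : ∑ k ∈ Finset.range N, (-y) ^ k • (W ^ k) (e • scaleGen K T e - e ^ (N + 1) • r) =
        ∑ k ∈ Finset.range N, (-y) ^ k • (W ^ k) (e • scaleGen K T e) -
          ∑ k ∈ Finset.range N, (-y) ^ k • (W ^ k) (e ^ (N + 1) • r) := by
      simp only [map_sub, smul_sub, Finset.sum_sub_distrib]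
    rw [this] at hE
    rw [sub_eq_iff_eq_add]
    refine hE.trans ?_
    abel
  rw [hdiff]
  refine (norm_add_le _ _).trans ?_
  rw [norm_neg, add_mul, Finset.sum_mul]
  refine add_le_add (norm_sum_le_of_le _ fun k _ => ?_) ?_
  · rw [map_smul, norm_smul, norm_smul, norm_pow e, Real.norm_of_nonneg he0'.le]
    have h2 : ‖(W ^ k) r‖ ≤ c ^ k * (M * M₁ * T) :=
      (norm_pow_apply_le W k r).trans (mul_le_mul (pow_le_pow_left₀ (norm_nonneg _) hWc k) hr
        (norm_nonneg _) (pow_nonneg hc k))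
    calc _ ≤ 1 * (e ^ (N + 1) * (c ^ k * (M * M₁ * T))) := by
          gcongr
          exact hy1 k
      _ = _ := by ring
  · rw [norm_smul]
    have h2 : ‖(W ^ N) Q‖ ≤ (c * e) ^ N * (M₂ * e) :=
      (norm_pow_apply_le W N Q).trans (mul_le_mul (pow_le_pow_left₀ (norm_nonneg _) he N)
        (hM₂ e heI y hy) (norm_nonneg _) (by positivity))
    calc _ ≤ 1 * ((c * e) ^ N * (M₂ * e)) := by
          gcongr
          exact hy1 N
      _ = _ := by rw [mul_pow]; ring

theorem integral_neg_pow (k : ℕ) : ∫ y in (0 : ℝ)..1, (-y) ^ k = (-1 : ℝ) ^ k / (k + 1) := by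
  rw [show (fun y : ℝ => (-y) ^ k) = fun y => (-1) ^ k * y ^ k from funext fun y => neg_pow y k,
    intervalIntegral.integral_const_mul, integral_pow]
  simp [div_eq_mul_inv]

/-- Averaging (-y)^k over [0, 1] gives (-1)^k / (k + 1), the coefficients of log(1 + W)/W. The
factor p + 1 in front of x_p is the one produced by ε d/dε. -/
theorem smul_deriv_sub_logDiv_isBigO (hK : LocBdd K) (hT : 0 ≤ T) {x : ℕ → A} {N : ℕ}
    (hc : ∀ p < N, Continuous fun y => ∫ s in (0 : ℝ)..T, nestIter K T y p s)
    (hx : ∀ p < N, ((p : ℝ) + 1) • x p =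
      ∫ y in (0 : ℝ)..1, ∫ s in (0 : ℝ)..T, nestIter K T y p s) :
    (fun e => e • expoPolyDeriv x N e -
      logDiv N (conjProp K e T - 1) (e • scaleGen K T e)) =O[𝓝[>] 0] fun e => e ^ (N + 1) := by
  obtain ⟨C, hC⟩ := nestSum_sub_isBigO_uniform hK hT N
  refine IsBigO.of_bound C ?_
  filter_upwards [hC, self_mem_nhdsWithin] with e he he0
  have he0' : (0 : ℝ) < e := he0
  have h1 : e • expoPolyDeriv x N e = ∫ y in (0 : ℝ)..1, nestSum K T N e y := by
    simp only [nestSum]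
    rw [smul_expoPolyDeriv, intervalIntegral.integral_finsetSum]
    · refine Finset.sum_congr rfl fun p hp => ?_
      rw [intervalIntegral.integral_smul, hx p (Finset.mem_range.1 hp)]
    · intro p hp
      exact ((hc p (Finset.mem_range.1 hp)).const_smul _).intervalIntegrable _ _
  have h2 : logDiv N (conjProp K e T - 1) (e • scaleGen K T e) =
      ∫ y in (0 : ℝ)..1, ∑ k ∈ Finset.range N, (-y) ^ k •
        ((conjProp K e T - 1) ^ k) (e • scaleGen K T e) := by
    rw [intervalIntegral.integral_finsetSum]
    · rw [logDiv, sum_apply]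
      refine Finset.sum_congr rfl fun k _ => ?_
      rw [intervalIntegral.integral_smul_const, integral_neg_pow, smul_apply]
    · intro k _
      exact Continuous.intervalIntegrable (by fun_prop) _ _
  rw [h1, h2, ← intervalIntegral.integral_sub]
  · refine (intervalIntegral.norm_integral_le_of_norm_le_const fun y hy => ?_).trans_eq
      (b := C * e ^ (N + 1) * |1 - 0|) rfl |>.trans_eq ?_
    · rw [uIoc_of_le zero_le_one] at hy
      exact he y ⟨hy.1.le, hy.2⟩
    · rw [norm_pow, Real.norm_of_nonneg he0'.le]
      simp
  · refine Continuous.intervalIntegrable ?_ _ _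
    exact continuous_finsetSum _ fun p hp => (hc p (Finset.mem_range.1 hp)).const_smul _
  · exact Continuous.intervalIntegrable (by fun_prop) _ _

theorem scaleGen_isBigO_one (hK : LocBdd K) (hT : 0 ≤ T) :
    (fun e => scaleGen K T e) =O[𝓝[>] 0] fun _ => (1 : ℝ) := by
  obtain ⟨M, hM⟩ := exists_scaleGen_bound hK hT
  refine IsBigO.of_bound M ?_
  have h1 : ∀ᶠ e : ℝ in 𝓝[>] 0, e < 1 := nhdsWithin_le_nhds (Iio_mem_nhds one_pos)
  filter_upwards [h1, self_mem_nhdsWithin] with e he he0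
  simpa using hM e ⟨le_of_lt he0, he.le⟩

theorem isBigO_one_of_continuousAt {E : Type*} [NormedAddCommGroup E] {f : ℝ → E}
    (hf : ContinuousAt f 0) : f =O[𝓝[>] 0] fun _ => (1 : ℝ) :=
  (hf.isBigO_one ℝ).mono nhdsWithin_le_nhds

/-- The generators of the dependence on `ε` agree to the order to which the exponential is
constructed. -/
theorem phi_sub_scaleGen_isBigO (hK : LocBdd K) (hT : 0 ≤ T) {x : ℕ → A} {N : ℕ} (hN : 0 < N)
    (hc : ∀ p < N, Continuous fun y => ∫ s in (0 : ℝ)..T, nestIter K T y p s)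
    (hx : ∀ p < N, ((p : ℝ) + 1) • x p =
      ∫ y in (0 : ℝ)..1, ∫ s in (0 : ℝ)..T, nestIter K T y p s) :
    (fun e => phi (adL (expoPoly x N e)) (expoPolyDeriv x N e) - scaleGen K T e)
      =O[𝓝[>] 0] fun e => e ^ N := by
  set X := expoPoly x N
  set X' := expoPolyDeriv x N
  set v : ℝ → A := fun e => rightProp K e T
  set u : ℝ → A := fun e => leftProp K e T
  set w : ℝ → A := fun e => NormedSpace.exp (X e)
  set w' : ℝ → A := fun e => NormedSpace.exp (-X e)
  have hl : 𝓝[>] (0 : ℝ) ≤ 𝓝 0 := nhdsWithin_le_nhds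
  have hX : X =O[𝓝[>] 0] fun e => e := by
    have := ((hasDerivAt_expoPoly x N 0).isBigO_sub).mono hl
    simpa [expoPoly_zero, X] using this
  have hz : (fun e => adL (X e)) =O[𝓝[>] 0] fun e => e :=
    (adL.isBigO_comp X _).trans hX
  have hv1 : v =O[𝓝[>] 0] fun _ => (1 : ℝ) :=
    isBigO_one_of_continuousAt (hasDerivAt_rightProp hK hT 0).continuousAt
  have hu1 : u =O[𝓝[>] 0] fun _ => (1 : ℝ) :=
    isBigO_one_of_continuousAt (hasDerivAt_leftProp hK hT 0).continuousAt
  have hw1 : w =O[𝓝[>] 0] fun _ => (1 : ℝ) :=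
    isBigO_one_of_continuousAt (hasDerivAt_exp_comp (hasDerivAt_expoPoly x N 0)).continuousAt
  have hw'1 : w' =O[𝓝[>] 0] fun _ => (1 : ℝ) :=
    isBigO_one_of_continuousAt (hasDerivAt_exp_neg_comp (hasDerivAt_expoPoly x N 0)).continuousAt
  have hβ := scaleGen_isBigO_one hK hT
  have hW := conjProp_sub_one_isBigO hK hT
  have hid1 : (fun e : ℝ => e) =O[𝓝[>] 0] fun _ => (1 : ℝ) := by
    simpa using isBigO_pow_of_le hl (Nat.zero_le 1)
  have hphi := phi_isBigO_one (A := A →L[ℝ] A) le_rfl hz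
  have hlog := phi_mul_logDiv_sub_one_isBigO (A := A →L[ℝ] A) le_rfl hz hN
  have hWX1 : (fun e => NormedSpace.exp (adL (X e)) - 1 : ℝ → A →L[ℝ] A)
      =O[𝓝[>] 0] fun _ => (1 : ℝ) := by
    obtain ⟨C, hC, h⟩ := exists_exp_smul_bound (A := A →L[ℝ] A) le_rfl hz
    refine IsBigO.trans (g := fun e : ℝ => e) (IsBigO.of_bound C ?_) hid1
    filter_upwards [h, self_mem_nhdsWithin] with e he he0
    have := he 1 (by simp)
    rw [one_smul] at this
    rwa [Real.norm_of_nonneg (le_of_lt he0)]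
  -- If v and e^X agree to order m, so do Ad_v and e^(ad X), and hence their truncated logarithms.
  -- Applied to ε β = O(ε) this gains one power, which survives as order m after division by ε.
  have hstep : ∀ m ≤ N, (fun e => v e - w e) =O[𝓝[>] 0] (fun e => e ^ m) →
      (fun e => phi (adL (X e)) (X' e) - scaleGen K T e) =O[𝓝[>] 0] fun e => e ^ m := by
    intro m hm h
    have h1 : (fun e => u e - w' e) =O[𝓝[>] 0] fun e => e ^ m := by
      have : (fun e => w' e * (v e - w e) * u e) =O[𝓝[>] 0] fun e => e ^ m := by
        simpa using (hw'1.mul h).mul hu1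
      refine (this.neg_left).congr_left fun e => ?_
      simp only [v, u, w, w', mul_sub, sub_mul, mul_assoc, rightProp_mul_leftProp hK e hT, mul_one]
      rw [← mul_assoc, exp_neg_mul_exp]
      noncomm_ring
    have h2 : (fun e => (conjProp K e T - 1) - (NormedSpace.exp (adL (X e)) - 1))
        =O[𝓝[>] 0] fun e => e ^ m := by
      have h3 : (fun e => sandwich (v e - w e) (u e) + sandwich (w e) (u e - w' e))
          =O[𝓝[>] 0] fun e => e ^ m := by
        refine IsBigO.add ?_ ?_
        · simpa using isBigO_clm_apply ((sandwich.isBigO_comp _ _).trans h) hu1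
        · simpa using isBigO_clm_apply ((sandwich.isBigO_comp _ _).trans hw1) h1
      refine h3.congr_left fun e => ?_
      ext Y
      simp only [add_apply, sub_apply, sandwich_apply, conjProp_eq hK e hT,
        ← exp_mul_exp_neg_eq_exp_adL, v, u, w, w']
      noncomm_ring
    have h4 := logDiv_sub_isBigO (A := A →L[ℝ] A) (hW.trans hid1) hWX1 h2 N
    have h5 : (fun e => e • scaleGen K T e) =O[𝓝[>] 0] fun e => e := by
      simpa using (isBigO_refl (fun e : ℝ => e) _).smul hβ
    -- Three errors make up ε (φ(ad X) X' - β): that of `smul_deriv_sub_logDiv_isBigO`, the exchange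
    -- of Ad_v for e^(ad X) in the logarithm, and the defect of φ · logDiv = 1.
    have h6 : (fun e => phi (adL (X e)) (e • X' e -
        logDiv N (conjProp K e T - 1) (e • scaleGen K T e))) =O[𝓝[>] 0] fun e => e ^ (m + 1) := by
      have := isBigO_clm_apply hphi (smul_deriv_sub_logDiv_isBigO hK hT hc hx)
      simp only [one_mul] at this
      exact this.trans (isBigO_pow_of_le hl (Nat.succ_le_succ hm))
    have h7 : (fun e => phi (adL (X e)) ((logDiv N (conjProp K e T - 1) -
        logDiv N (NormedSpace.exp (adL (X e)) - 1)) (e • scaleGen K T e)))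
        =O[𝓝[>] 0] fun e => e ^ (m + 1) := by
      simpa [pow_succ] using isBigO_clm_apply hphi (isBigO_clm_apply h4 h5)
    have h8 : (fun e => (phi (adL (X e)) * logDiv N (NormedSpace.exp (adL (X e)) - 1) - 1)
        (e • scaleGen K T e)) =O[𝓝[>] 0] fun e => e ^ (m + 1) := by
      have := isBigO_clm_apply hlog h5
      simp only [← pow_succ] at this
      exact this.trans (isBigO_pow_of_le hl (Nat.succ_le_succ hm))
    have h9 : (fun e => e • (phi (adL (X e)) (X' e) - scaleGen K T e))
        =O[𝓝[>] 0] fun e => e ^ (m + 1) := by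
      refine ((h6.add h7).add h8).congr_left fun e => ?_
      simp only [sub_apply, map_sub, mul_apply_eq_comp, one_apply_eq_self, map_smul, smul_sub]
      abel
    have h10 : (fun e : ℝ => e⁻¹ • (e • (phi (adL (X e)) (X' e) - scaleGen K T e)))
        =O[𝓝[>] 0] fun e => e⁻¹ • e ^ (m + 1) := (isBigO_refl _ _).smul h9
    refine h10.congr' ?_ ?_
    · filter_upwards [self_mem_nhdsWithin] with e he
      rw [smul_smul, inv_mul_cancel₀ (ne_of_gt he), one_smul]
    · filter_upwards [self_mem_nhdsWithin] with e he
      rw [smul_eq_mul, pow_succ', ← mul_assoc, inv_mul_cancel₀ (ne_of_gt he), one_mul]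
  -- Conversely, generators that agree to order m give solutions that agree to order m + 1, by
  -- integrating the derivative of e^(-X) v.
  have hint : ∀ m, (fun e => phi (adL (X e)) (X' e) - scaleGen K T e)
      =O[𝓝[>] 0] (fun e => e ^ m) → (fun e => v e - w e) =O[𝓝[>] 0] fun e => e ^ (m + 1) := by
    intro m h
    have hd : ∀ e, HasDerivAt (fun e => w' e * v e)
        (-(w' e * (phi (adL (X e)) (X' e) - scaleGen K T e) * v e)) e := fun e => by
      convert! (hasDerivAt_exp_neg_comp (hasDerivAt_expoPoly x N e)).fun_mul
        (hasDerivAt_rightProp hK hT e) using 1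
      simp only [v, w', X, X']
      noncomm_ring
    have h1 : (fun e => -(w' e * (phi (adL (X e)) (X' e) - scaleGen K T e) * v e))
        =O[𝓝[>] 0] fun e => e ^ m := by
      simpa using ((hw'1.mul h).mul hv1).neg_left
    have h2 := sub_isBigO_of_deriv_isBigO hd h1
    have h0 : w' 0 * v 0 = 1 := by
      have : v 0 = 1 := by
        simp only [v, rightProp]
        rw [volterraSum, tsum_eq_single 0 (by intro q hq; simp [hq])]
        simp [volterra]
      rw [this]
      simp [w', X, expoPoly_zero]
    have h3 : (fun e => w e * (w' e * v e - w' 0 * v 0)) =O[𝓝[>] 0] fun e => e ^ (m + 1) := by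
      simpa using hw1.mul h2
    refine h3.congr_left fun e => ?_
    rw [h0, mul_sub, ← mul_assoc, exp_mul_exp_neg, one_mul, mul_one]
  have hall : ∀ m ≤ N, (fun e => v e - w e) =O[𝓝[>] 0] fun e => e ^ m := by
    intro m
    induction m with
    | zero => intro _; simpa using hv1.sub hw1
    | succ m ih => intro hm; exact hint m (hstep m (by omega) (ih (by omega)))
  exact hstep N le_rfl (hall N le_rfl)

end Magnus

/-! ### Ordered integrals as integrals over simplices and cubes -/

section Cubes

variable {E : Type*} [NormedAddCommGroup E] [NormedSpace ℝ E]

/-- Bounded strongly measurable functions. -/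
structure BddMeas {α : Type*} [MeasurableSpace α] (f : α → E) : Prop where
  meas : StronglyMeasurable f
  bdd : ∃ c : ℝ, ∀ t, ‖f t‖ ≤ c

theorem BddMeas.comp_measurable {α β : Type*} [MeasurableSpace α] [MeasurableSpace β] {f : β → E}
    (hf : BddMeas f) {g : α → β} (hg : Measurable g) : BddMeas fun t => f (g t) :=
  ⟨hf.meas.comp_measurable hg, hf.bdd.imp fun _ h t => h (g t)⟩

theorem BddMeas.locBdd {f : ℝ → E} (hf : BddMeas f) : LocBdd f :=
  ⟨hf.meas.aestronglyMeasurable, fun _ => hf.bdd.imp fun _ h t _ => h t⟩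

theorem BddMeas.bilin {F G α : Type*} [NormedAddCommGroup F] [NormedSpace ℝ F]
    [NormedAddCommGroup G] [NormedSpace ℝ G] [MeasurableSpace α] (B : E →L[ℝ] F →L[ℝ] G)
    {f : α → E} {g : α → F} (hf : BddMeas f) (hg : BddMeas g) :
    BddMeas fun t => B (f t) (g t) := by
  obtain ⟨c, hc⟩ := hf.bdd
  obtain ⟨c', hc'⟩ := hg.bdd
  refine ⟨B.continuous₂.comp_stronglyMeasurable (hf.meas.prodMk hg.meas), ‖B‖ * c * c', fun t => ?_⟩
  have := (norm_nonneg _).trans (hc t)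
  exact (B.le_opNorm₂ _ _).trans (by gcongr; exacts [hc t, hc' t])

theorem BddMeas.smul {α : Type*} [MeasurableSpace α] {f : α → ℝ} {g : α → E} (hf : BddMeas f)
    (hg : BddMeas g) : BddMeas fun t => f t • g t :=
  hf.bilin (ContinuousLinearMap.lsmul ℝ ℝ) hg

/-- The open cube `(0, T)^q`. -/
def cube (q : ℕ) (T : ℝ) : Set (Fin q → ℝ) := {t | ∀ i, t i ∈ Ioo 0 T}

/-- The open simplex `0 < t_1 < ⋯ < t_q < T`. -/
def simplex (q : ℕ) (T : ℝ) : Set (Fin q → ℝ) := {t | StrictMono t ∧ t ∈ cube q T}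

theorem measurableSet_cube (q : ℕ) (T : ℝ) : MeasurableSet (cube q T) := by
  simp only [cube, ofPred_forall]
  exact MeasurableSet.iInter fun i => measurableSet_Ioo.preimage (measurable_pi_apply i)

theorem measurableSet_simplex (q : ℕ) (T : ℝ) : MeasurableSet (simplex q T) := by
  have h : {t : Fin q → ℝ | StrictMono t} = ⋂ i, ⋂ j, ⋂ _ : i < j, {t | t i < t j} := by
    ext t
    simp [StrictMono]
  have h' : MeasurableSet {t : Fin q → ℝ | StrictMono t} := by
    rw [h]
    exact MeasurableSet.iInter fun i => MeasurableSet.iInter fun j => MeasurableSet.iInter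
      fun _ => measurableSet_lt (measurable_pi_apply i) (measurable_pi_apply j)
  exact h'.inter (measurableSet_cube q T)

theorem volume_cube_lt_top (q : ℕ) (T : ℝ) : volume (cube q T) < ⊤ := by
  have : cube q T = Set.pi univ fun _ => Ioo 0 T := by ext; simp [cube]
  rw [this, volume_pi_pi]
  simp

theorem BddMeas.integrable_indicator {q : ℕ} {T : ℝ} {f : (Fin q → ℝ) → E} (hf : BddMeas f)
    {S : Set (Fin q → ℝ)} (hS : MeasurableSet S) (hST : S ⊆ cube q T) :
    Integrable (S.indicator f) := by
  obtain ⟨c, hc⟩ := hf.bdd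
  rw [integrable_indicator_iff hS]
  exact IntegrableOn.of_bound ((measure_mono hST).trans_lt (volume_cube_lt_top q T))
    hf.meas.aestronglyMeasurable c (ae_of_all _ hc)

theorem measurable_snoc (q : ℕ) :
    Measurable fun p : (Fin q → ℝ) × ℝ => (Fin.snoc p.1 p.2 : Fin (q + 1) → ℝ) := by
  refine measurable_pi_iff.2 fun i => ?_
  refine Fin.lastCases ?_ (fun j => ?_) i
  · simpa using measurable_snd
  · simp only [Fin.snoc_castSucc]
    exact (measurable_pi_apply j).comp measurable_fst

theorem BddMeas.snoc {q : ℕ} {f : (Fin (q + 1) → ℝ) → E} (hf : BddMeas f) (r : ℝ) :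
    BddMeas fun t : Fin q → ℝ => f (Fin.snoc t r : Fin (q + 1) → ℝ) :=
  hf.comp_measurable ((measurable_snoc q).comp (measurable_id.prodMk measurable_const))

theorem integral_snoc {q : ℕ} {f : (Fin (q + 1) → ℝ) → E} (hf : Integrable f) :
    ∫ t, f t = ∫ r, ∫ t : Fin q → ℝ, f (Fin.snoc t r : Fin (q + 1) → ℝ) := by
  set e := (MeasurableEquiv.piFinSuccAbove (fun _ : Fin (q + 1) => ℝ) (Fin.last q)).symm
  have hem : MeasurePreserving e :=
    (volume_preserving_piFinSuccAbove (fun _ : Fin (q + 1) => ℝ) (Fin.last q)).symm _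
  have he : ∀ p : ℝ × (Fin q → ℝ), e p = (Fin.snoc p.2 p.1 : Fin (q + 1) → ℝ) := fun p =>
    Fin.insertNth_last' p.1 p.2
  have h1 : Integrable (fun p => f (e p)) (volume : Measure (ℝ × (Fin q → ℝ))) :=
    (hem.integrable_comp_emb e.measurableEmbedding).2 hf
  rw [← hem.integral_comp e.measurableEmbedding, Measure.volume_eq_prod,
    integral_prod _ (by rwa [Measure.volume_eq_prod] at h1)]
  simp only [he]

theorem snoc_mem_cube {q : ℕ} {T r : ℝ} {t : Fin q → ℝ} :
    (Fin.snoc t r : Fin (q + 1) → ℝ) ∈ cube (q + 1) T ↔ r ∈ Ioo 0 T ∧ t ∈ cube q T := by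
  simp only [cube, mem_ofPred_eq, Fin.forall_fin_succ', Fin.snoc_castSucc, Fin.snoc_last]
  exact and_comm

theorem snoc_mem_simplex {q : ℕ} {T r : ℝ} {t : Fin q → ℝ} :
    (Fin.snoc t r : Fin (q + 1) → ℝ) ∈ simplex (q + 1) T ↔ r ∈ Ioo 0 T ∧ t ∈ simplex q r := by
  rw [simplex, mem_ofPred_eq, snoc_mem_cube, simplex, mem_ofPred_eq]
  constructor
  · rintro ⟨hm, hr, ht⟩
    refine ⟨hr, fun i j hij => ?_, fun i => ⟨(ht i).1, ?_⟩⟩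
    · simpa using hm (Fin.castSucc_lt_castSucc_iff.2 hij)
    · simpa using hm (Fin.castSucc_lt_last i)
  · rintro ⟨hr, hm, ht⟩
    refine ⟨fun i j => ?_, hr, fun i => ⟨(ht i).1, (ht i).2.trans hr.2⟩⟩
    refine Fin.lastCases (fun h => absurd h (not_lt.2 (Fin.le_last _))) (fun i => ?_) i
    refine Fin.lastCases (fun h => ?_) (fun j h => ?_) j
    · simpa using (ht i).2
    · simpa using hm (Fin.castSucc_lt_castSucc_iff.1 h)

theorem integral_cube_succ {q : ℕ} {T : ℝ} (hT : 0 ≤ T) {f : (Fin (q + 1) → ℝ) → E}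
    (hf : BddMeas f) :
    ∫ t in cube (q + 1) T, f t =
      ∫ r in (0 : ℝ)..T, ∫ t in cube q T, f (Fin.snoc t r : Fin (q + 1) → ℝ) := by
  rw [← integral_indicator (measurableSet_cube _ _),
    integral_snoc (hf.integrable_indicator (measurableSet_cube _ _) subset_rfl),
    intervalIntegral.integral_of_le hT, integral_Ioc_eq_integral_Ioo,
    ← integral_indicator measurableSet_Ioo]
  congr 1 with r
  by_cases hr : r ∈ Ioo 0 T
  · rw [indicator_of_mem hr, ← integral_indicator (measurableSet_cube _ _)]
    congr 1 with t
    by_cases ht : t ∈ cube q T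
    · rw [indicator_of_mem ht, indicator_of_mem (snoc_mem_cube.2 ⟨hr, ht⟩)]
    · rw [indicator_of_notMem ht, indicator_of_notMem fun h => ht (snoc_mem_cube.1 h).2]
  · rw [indicator_of_notMem hr]
    refine integral_eq_zero_of_ae (ae_of_all _ fun t => ?_)
    exact indicator_of_notMem (fun h => hr (snoc_mem_cube.1 h).1) _

theorem integral_simplex_succ {q : ℕ} {T : ℝ} (hT : 0 ≤ T) {f : (Fin (q + 1) → ℝ) → E}
    (hf : BddMeas f) :
    ∫ t in simplex (q + 1) T, f t =
      ∫ r in (0 : ℝ)..T, ∫ t in simplex q r, f (Fin.snoc t r : Fin (q + 1) → ℝ) := by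
  rw [← integral_indicator (measurableSet_simplex _ _),
    integral_snoc (hf.integrable_indicator (measurableSet_simplex _ _) fun _ h => h.2),
    intervalIntegral.integral_of_le hT, integral_Ioc_eq_integral_Ioo,
    ← integral_indicator measurableSet_Ioo]
  congr 1 with r
  by_cases hr : r ∈ Ioo 0 T
  · rw [indicator_of_mem hr, ← integral_indicator (measurableSet_simplex _ _)]
    congr 1 with t
    by_cases ht : t ∈ simplex q r
    · rw [indicator_of_mem ht, indicator_of_mem (snoc_mem_simplex.2 ⟨hr, ht⟩)]
    · rw [indicator_of_notMem ht, indicator_of_notMem fun h => ht (snoc_mem_simplex.1 h).2]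
  · rw [indicator_of_notMem hr]
    refine integral_eq_zero_of_ae (ae_of_all _ fun t => ?_)
    exact indicator_of_notMem (fun h => hr (snoc_mem_simplex.1 h).1) _

theorem integral_fin_zero (f : (Fin 0 → ℝ) → E) [CompleteSpace E] :
    ∫ t, f t = f Fin.elim0 := by
  rw [volume_pi, Measure.pi_of_empty _ Fin.elim0, integral_dirac]

theorem orderedIntegral_eq {n : Type*} [Fintype n] [DecidableEq n] (q : ℕ) {T : ℝ} (hT : 0 ≤ T)
    {f : (Fin q → ℝ) → Matrix n n ℂ} (hf : BddMeas f) :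
    orderedIntegral q T f = ∫ t in simplex q T, f t := by
  induction q generalizing T with
  | zero =>
    have : simplex 0 T = univ := by
      ext t
      simp [simplex, cube, Subsingleton.strictMono]
    rw [this, Measure.restrict_univ, integral_fin_zero]
    rfl
  | succ q ih =>
    rw [integral_simplex_succ hT hf, orderedIntegral]
    refine intervalIntegral.integral_congr fun r hr => ?_
    rw [uIcc_of_le hT] at hr
    exact ih hr.1 (hf.snoc r)

/-- The number of ascents of a tuple. -/
noncomputable def tupleAscents {p : ℕ} (t : Fin (p + 1) → ℝ) : ℕ :=
  (Finset.univ.filter fun i : Fin p => t i.castSucc < t i.succ).card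

theorem measurable_tupleAscents (p : ℕ) : Measurable (tupleAscents : (Fin (p + 1) → ℝ) → ℕ) := by
  have : (tupleAscents : (Fin (p + 1) → ℝ) → ℕ) =
      fun t => ∑ i : Fin p, if t i.castSucc < t i.succ then 1 else 0 := by
    ext t
    simp [tupleAscents]
  rw [this]
  exact Finset.measurable_sum _ fun i _ => Measurable.ite
    (measurableSet_lt (measurable_pi_apply _) (measurable_pi_apply _)) measurable_const
    measurable_const

theorem tupleAscents_le {p : ℕ} (t : Fin (p + 1) → ℝ) : tupleAscents t ≤ p := by
  unfold tupleAscents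
  exact (Finset.card_filter_le _ _).trans (by simp)

theorem tupleAscents_snoc {p : ℕ} (t : Fin (p + 1) → ℝ) (s : ℝ) :
    tupleAscents (Fin.snoc t s : Fin (p + 2) → ℝ) =
      tupleAscents t + if t (Fin.last p) < s then 1 else 0 := by
  have h := Fin.sum_univ_castSucc fun i : Fin (p + 1) =>
    if (Fin.snoc t s : Fin (p + 2) → ℝ) i.castSucc < (Fin.snoc t s : Fin (p + 2) → ℝ) i.succ
      then 1 else 0
  have h' : ∀ i : Fin p, (Fin.snoc t s : Fin (p + 2) → ℝ) i.castSucc.succ = t i.succ := fun i => by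
    rw [Fin.succ_castSucc, Fin.snoc_castSucc]
  simp only [h', Fin.snoc_castSucc, Fin.succ_last, Fin.snoc_last] at h
  simp only [tupleAscents, Finset.card_filter, Fin.snoc_castSucc]
  exact h

theorem tupleAscents_comp {p : ℕ} {t : Fin (p + 1) → ℝ} (ht : StrictMono t)
    (σ : Equiv.Perm (Fin (p + 1))) : tupleAscents (t ∘ σ) = ascents σ := by
  simp only [tupleAscents, ascents, Function.comp, ht.lt_iff_lt]

theorem bddMeas_weight (p : ℕ) (C : ℕ → ℝ) :
    BddMeas fun t : Fin (p + 1) → ℝ => C (tupleAscents t) where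
  meas := ((measurable_of_countable C).comp (measurable_tupleAscents p)).stronglyMeasurable
  bdd := ⟨∑ j ∈ Finset.range (p + 1), ‖C j‖, fun t =>
    Finset.single_le_sum (f := fun j => ‖C j‖) (fun _ _ => norm_nonneg _)
      (Finset.mem_range.2 (Nat.lt_succ_of_le (tupleAscents_le t)))⟩

theorem ae_injective (q : ℕ) : ∀ᵐ t : Fin q → ℝ, Function.Injective t := by
  have h : ∀ i j : Fin q, i ≠ j → ∀ᵐ t : Fin q → ℝ, t i ≠ t j := by
    intro i j hij
    let S : Submodule ℝ (Fin q → ℝ) :=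
      LinearMap.ker (LinearMap.proj (R := ℝ) (φ := fun _ : Fin q => ℝ) i - LinearMap.proj j)
    have hS : S ≠ ⊤ := by
      intro h
      have h1 : (Pi.single i 1 : Fin q → ℝ) ∈ S := h ▸ Submodule.mem_top
      simp [S, hij] at h1
    have h2 := Measure.addHaar_submodule (volume : Measure (Fin q → ℝ)) S hS
    rw [ae_iff]
    refine measure_mono_null (fun t ht => ?_) h2
    simp only [ne_eq, not_not, mem_ofPred_eq] at ht
    simp [S, ht]
  have h' : ∀ᵐ t : Fin q → ℝ, ∀ i j : Fin q, i ≠ j → t i ≠ t j := by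
    rw [ae_all_iff]; intro i
    rw [ae_all_iff]; intro j
    by_cases hij : i = j
    · simp [hij]
    · filter_upwards [h i j hij] with t ht _ using ht
  filter_upwards [h'] with t ht i j hij
  by_contra hne
  exact ht i j hne hij

theorem integral_comp_perm {q : ℕ} (σ : Equiv.Perm (Fin q)) (f : (Fin q → ℝ) → E) :
    ∫ t, f (t ∘ σ) = ∫ t, f t := by
  have hem := volume_measurePreserving_piCongrLeft (fun _ : Fin q => ℝ) σ
  rw [← hem.integral_comp (MeasurableEquiv.measurableEmbedding _)]
  congr 1 with t
  congr 1
  ext i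
  rw [MeasurableEquiv.coe_piCongrLeft]
  exact Equiv.piCongrLeft_apply_apply (fun _ : Fin q => ℝ) σ t i

/-- Almost every point of the cube has distinct coordinates, hence lies in exactly one permuted copy
of the simplex, namely the one found by sorting. On that copy the ascents of the tuple are the
ascents of the permutation, so the sum over permutations becomes one integral with a weight read off
from the point. -/
theorem sum_integral_simplex_perm {p : ℕ} {T : ℝ} (C : ℕ → ℝ) {f : (Fin (p + 1) → ℝ) → E}
    (hf : BddMeas f) :
    ∑ σ : Equiv.Perm (Fin (p + 1)), C (ascents σ) • ∫ t in simplex (p + 1) T, f (t ∘ σ) =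
      ∫ t in cube (p + 1) T, C (tupleAscents t) • f t := by
  have h1 : ∀ σ : Equiv.Perm (Fin (p + 1)), C (ascents σ) • ∫ t in simplex (p + 1) T, f (t ∘ σ) =
      ∫ t, ((fun t : Fin (p + 1) → ℝ => t ∘ ⇑σ⁻¹) ⁻¹' simplex (p + 1) T).indicator
        (fun t => C (tupleAscents t) • f t) t := by
    intro σ
    rw [← integral_smul, ← integral_indicator (measurableSet_simplex _ _),
      ← integral_comp_perm σ (((fun t : Fin (p + 1) → ℝ => t ∘ ⇑σ⁻¹) ⁻¹' simplex (p + 1) T).indicator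
        fun t => C (tupleAscents t) • f t)]
    congr 1 with t
    have h2 : (t ∘ σ) ∘ ⇑σ⁻¹ = t := by ext i; simp
    by_cases ht : t ∈ simplex (p + 1) T
    · rw [indicator_of_mem ht, indicator_of_mem (by rwa [mem_preimage, h2]),
        tupleAscents_comp ht.1]
    · rw [indicator_of_notMem ht, indicator_of_notMem (by rwa [mem_preimage, h2])]
  have hmeas : ∀ σ : Equiv.Perm (Fin (p + 1)),
      MeasurableSet ((fun t : Fin (p + 1) → ℝ => t ∘ ⇑σ⁻¹) ⁻¹' simplex (p + 1) T) := fun σ =>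
    (measurableSet_simplex _ _).preimage (measurable_pi_iff.2 fun i => measurable_pi_apply _)
  have hsub : ∀ σ : Equiv.Perm (Fin (p + 1)),
      (fun t : Fin (p + 1) → ℝ => t ∘ ⇑σ⁻¹) ⁻¹' simplex (p + 1) T ⊆ cube (p + 1) T := by
    intro σ t ht i
    simpa using ht.2 (σ i)
  simp only [h1]
  rw [← integral_finsetSum _ fun σ _ =>
    ((bddMeas_weight p C).smul hf).integrable_indicator (hmeas σ) (hsub σ),
    ← integral_indicator (measurableSet_cube _ _)]
  refine integral_congr_ae ?_
  filter_upwards [ae_injective (p + 1)] with t ht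
  by_cases htc : t ∈ cube (p + 1) T
  · have hsort : StrictMono (t ∘ Tuple.sort t) :=
      (Tuple.monotone_sort t).strictMono_of_injective (ht.comp (Equiv.injective _))
    rw [indicator_of_mem htc, Finset.sum_eq_single (Tuple.sort t)⁻¹]
    · refine indicator_of_mem ?_ _
      rw [mem_preimage, inv_inv]
      exact ⟨hsort, fun i => htc _⟩
    · intro σ _ hσ
      refine indicator_of_notMem (fun h => hσ ?_) _
      have h2 : t ∘ ⇑σ⁻¹ = t ∘ Tuple.sort t := Tuple.comp_sort_eq_comp_iff_monotone.2 h.1.monotone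
      have h3 : σ⁻¹ = Tuple.sort t := by
        ext i
        exact congrArg _ (ht (congrFun h2 i))
      rw [← h3, inv_inv]
    · intro h
      exact absurd (Finset.mem_univ _) h
  · rw [indicator_of_notMem htc]
    exact Finset.sum_eq_zero fun σ _ => indicator_of_notMem (fun h => htc (hsub σ h)) _

end Cubes

/-! ### The Floquet-Magnus terms as averaged nested integrals -/

section NestedMagnus

variable {n : Type*} [Fintype n] [DecidableEq n]

theorem lie_eq_adL (a b : Matrix n n ℂ) : ⁅a, b⁆ = adL a b := rfl

theorem multiCommutator_snoc (K : ℝ → Matrix n n ℂ) (p : ℕ) (t : Fin (p + 1) → ℝ) (s : ℝ) :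
    (multiCommutator (p + 1) fun i => K ((Fin.snoc t s : Fin (p + 2) → ℝ) i)) =
      adL (K s) (multiCommutator p fun i => K (t i)) := by
  simp only [multiCommutator, Fin.snoc_last, Fin.snoc_castSucc, lie_eq_adL]

theorem bddMeas_multiCommutator {K : ℝ → Matrix n n ℂ} (hK : BddMeas K) (p : ℕ) :
    BddMeas fun t : Fin (p + 1) → ℝ => multiCommutator p fun i => K (t i) := by
  induction p with
  | zero => exact hK.comp_measurable (measurable_pi_apply 0)
  | succ p ih =>
    exact (hK.comp_measurable (measurable_pi_apply (Fin.last (p + 1)))).bilin adL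
      (ih.comp_measurable (g := fun (t : Fin (p + 2) → ℝ) i => t i.castSucc)
        (measurable_pi_iff.2 fun i => measurable_pi_apply i.castSucc))

/-- The weights `(-y)^j (1 - y)^(p - j)`. -/
noncomputable def ascentWeight (y : ℝ) (p j : ℕ) : ℝ := (-y) ^ j * (1 - y) ^ (p - j)

theorem ascentWeight_snoc (y : ℝ) {p : ℕ} (t : Fin (p + 1) → ℝ) (s : ℝ) :
    ascentWeight y (p + 1) (tupleAscents (Fin.snoc t s : Fin (p + 2) → ℝ)) =
      ((1 - y) - if t (Fin.last p) < s then 1 else 0) * ascentWeight y p (tupleAscents t) := by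
  have h := tupleAscents_le t
  rw [tupleAscents_snoc]
  split_ifs
  · rw [ascentWeight, ascentWeight, show p + 1 - (tupleAscents t + 1) = p - tupleAscents t by lia]
    ring
  · rw [ascentWeight, ascentWeight, show p + 1 - (tupleAscents t + 0) = p - tupleAscents t + 1 by lia]
    ring

/-- The inner time r enters the recursion with the factor (1 - y) - 1_{r < s}, which is -y at an
ascent and 1 - y otherwise. Unfolding the recursion therefore weights the multi-commutator by (-y)^j
(1 - y)^(p-j), where j counts the ascents. -/
theorem nestIter_eq_integral_cube {K : ℝ → Matrix n n ℂ} (hK : BddMeas K) {T : ℝ} (y : ℝ) (p : ℕ)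
    {s : ℝ} (hs : s ∈ Icc 0 T) :
    nestIter K T y p s = ∫ t in cube p T,
      ascentWeight y p (tupleAscents (Fin.snoc t s : Fin (p + 1) → ℝ)) •
        multiCommutator p fun i => K ((Fin.snoc t s : Fin (p + 1) → ℝ) i) := by
  have hT : 0 ≤ T := hs.1.trans hs.2
  induction p generalizing s with
  | zero =>
    have h1 : cube 0 T = univ := by ext t; simp [cube]
    rw [h1, Measure.restrict_univ, integral_fin_zero]
    simp [nestIter, ascentWeight, tupleAscents, multiCommutator, Fin.snoc]
  | succ p ih =>
    set F : (Fin (p + 1) → ℝ) → Matrix n n ℂ := fun t =>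
      ascentWeight y p (tupleAscents t) • multiCommutator p fun i => K (t i) with hF
    have hFb : BddMeas F := (bddMeas_weight p _).smul (bddMeas_multiCommutator hK p)
    have hg := nestIter_locBdd hK.locBdd T y p
    have hc : BddMeas fun r : ℝ => ((1 - y) - if r < s then 1 else 0 : ℝ) := by
      refine ⟨Measurable.stronglyMeasurable (measurable_const.sub (Measurable.ite measurableSet_Iio
        measurable_const measurable_const)), ‖1 - y‖ + 1, fun r => (norm_sub_le _ _).trans ?_⟩
      gcongr
      split_ifs <;> simp
    have h1 : ∀ t : Fin (p + 1) → ℝ,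
        (ascentWeight y (p + 1) (tupleAscents (Fin.snoc t s : Fin (p + 2) → ℝ)) •
          multiCommutator (p + 1) fun i => K ((Fin.snoc t s : Fin (p + 2) → ℝ) i)) =
        ((1 - y) - if t (Fin.last p) < s then 1 else 0 : ℝ) • adL (K s) (F t) := by
      intro t
      rw [multiCommutator_snoc, ascentWeight_snoc, hF, map_smul, smul_smul]
    have hFi : BddMeas fun t : Fin (p + 1) → ℝ =>
        ((1 - y) - if t (Fin.last p) < s then 1 else 0 : ℝ) • adL (K s) (F t) :=
      (hc.comp_measurable (measurable_pi_apply (Fin.last p))).smul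
        (BddMeas.bilin adL ⟨stronglyMeasurable_const, ‖K s‖, fun _ => le_rfl⟩ hFb)
    simp only [h1]
    rw [integral_cube_succ hT hFi]
    have h2 : ∀ r ∈ Icc 0 T, (∫ t in cube p T,
        ((1 - y) - if (Fin.snoc t r : Fin (p + 1) → ℝ) (Fin.last p) < s then 1 else 0 : ℝ) •
          adL (K s) (F (Fin.snoc t r : Fin (p + 1) → ℝ))) =
        adL (K s) (((1 - y) - if r < s then 1 else 0 : ℝ) • nestIter K T y p r) := by
      intro r hr
      rw [ih hr]
      simp only [Fin.snoc_last]
      rw [integral_smul, map_smul, ContinuousLinearMap.integral_comp_comm]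
      refine (integrable_indicator_iff (measurableSet_cube _ _)).1 ?_
      exact (hFb.snoc r).integrable_indicator (measurableSet_cube _ _) subset_rfl
    rw [intervalIntegral.integral_congr (g := fun r =>
      adL (K s) (((1 - y) - if r < s then 1 else 0 : ℝ) • nestIter K T y p r))
      fun r hr => h2 r (by rwa [uIcc_of_le hT] at hr)]
    have hI : LocBdd fun r => (if r < s then 1 else 0 : ℝ) • nestIter K T y p r := by
      have : BddMeas fun r : ℝ => (if r < s then 1 else 0 : ℝ) :=
        ⟨Measurable.stronglyMeasurable (Measurable.ite measurableSet_Iio measurable_const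
          measurable_const), 1, fun r => by split_ifs <;> simp⟩
      exact LocBdd.bilin (ContinuousLinearMap.lsmul ℝ ℝ) this.locBdd hg
    simp only [sub_smul (1 - y)]
    rw [ContinuousLinearMap.intervalIntegral_comp_comm _
      (((hg.smul (1 - y)).sub hI).intervalIntegrable le_rfl hT),
      intervalIntegral.integral_sub ((hg.smul (1 - y)).intervalIntegrable le_rfl hT)
        (hI.intervalIntegrable le_rfl hT), intervalIntegral.integral_smul]
    have h3 : ∫ r in (0 : ℝ)..T, (if r < s then 1 else 0 : ℝ) • nestIter K T y p r =
        ∫ r in (0 : ℝ)..s, nestIter K T y p r := by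
      rw [intervalIntegral.integral_of_le hT, intervalIntegral.integral_of_le hs.1,
        integral_Ioc_eq_integral_Ioo, integral_Ioc_eq_integral_Ioo,
        ← integral_indicator measurableSet_Ioo, ← integral_indicator measurableSet_Ioo]
      congr 1 with r
      by_cases hr : r < s
      · by_cases h0 : 0 < r
        · rw [indicator_of_mem (show r ∈ Ioo 0 T from ⟨h0, hr.trans_le hs.2⟩),
            indicator_of_mem (show r ∈ Ioo 0 s from ⟨h0, hr⟩), if_pos hr, one_smul]
        · rw [indicator_of_notMem fun h => h0 h.1, indicator_of_notMem fun h => h0 h.1]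
      · rw [indicator_of_notMem (s := Ioo 0 s) fun h => hr h.2]
        simp only [indicator, if_neg hr, zero_smul, ite_self]
    rw [h3]
    rfl

theorem integral_nestIter {K : ℝ → Matrix n n ℂ} (hK : BddMeas K) {T : ℝ} (hT : 0 ≤ T) (y : ℝ)
    (p : ℕ) :
    ∫ s in (0 : ℝ)..T, nestIter K T y p s = ∑ σ : Equiv.Perm (Fin (p + 1)),
      ascentWeight y p (ascents σ) •
        orderedIntegral (p + 1) T fun t => multiCommutator p fun i => K (t (σ i)) := by
  have hM := bddMeas_multiCommutator hK p
  have h1 := sum_integral_simplex_perm (T := T) (ascentWeight y p) hM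
  rw [integral_cube_succ hT ((bddMeas_weight p _).smul hM)] at h1
  rw [intervalIntegral.integral_congr fun s hs =>
    nestIter_eq_integral_cube hK y p (by rwa [uIcc_of_le hT] at hs), ← h1]
  refine Finset.sum_congr rfl fun σ _ => ?_
  rw [orderedIntegral_eq (p + 1) hT (f := fun t => multiCommutator p fun i => K (t (σ i)))]
  · rfl
  · exact hM.comp_measurable (g := fun t : Fin (p + 1) → ℝ => t ∘ σ)
      (measurable_pi_iff.2 fun i => measurable_pi_apply _)

/-- A signed Beta integral. With p = j + i, integration by parts lowers j and raises i by one, so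
the induction on j must hold for all i. -/
theorem integral_ascentWeight {p j : ℕ} (hj : j ≤ p) :
    ∫ y in (0 : ℝ)..1, ascentWeight y p j =
      (-1) ^ j * (j.factorial * (p - j).factorial / (p + 1).factorial) := by
  obtain ⟨i, rfl⟩ := Nat.exists_eq_add_of_le hj
  rw [Nat.add_sub_cancel_left]
  simp only [ascentWeight, Nat.add_sub_cancel_left]
  induction j generalizing i with
  | zero =>
    have h := intervalIntegral.integral_comp_sub_left (a := 0) (b := 1) (fun y : ℝ => y ^ i) 1
    simp only [sub_self, sub_zero] at h
    simp only [pow_zero, one_mul, h, integral_pow, zero_add, Nat.factorial]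
    have : (i.factorial : ℝ) ≠ 0 := by positivity
    push_cast
    field_simp
    simp
  | succ j ih =>
    have h1 : ∀ y ∈ uIcc (0 : ℝ) 1, HasDerivAt (fun y : ℝ => (-y) ^ (j + 1))
        (-((j + 1 : ℝ) * (-y) ^ j)) y := fun y _ => by
      simpa using ((hasDerivAt_id' y).fun_neg.fun_pow (j + 1))
    have h2 : ∀ y ∈ uIcc (0 : ℝ) 1, HasDerivAt (fun y : ℝ => -((1 - y) ^ (i + 1) / (i + 1)))
        ((1 - y) ^ i) y := fun y _ => by
      have := ((((hasDerivAt_id' y).const_sub 1).fun_pow (i + 1)).div_const ((i : ℝ) + 1)).fun_neg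
      refine this.congr_deriv ?_
      have : (i : ℝ) + 1 ≠ 0 := by positivity
      rw [Nat.add_sub_cancel]
      push_cast
      field_simp
    have h := intervalIntegral.integral_mul_deriv_eq_deriv_mul h1 h2
      (Continuous.intervalIntegrable (by fun_prop) _ _)
      (Continuous.intervalIntegrable (by fun_prop) _ _)
    rw [h]
    have h3 : ∀ y : ℝ, -((j + 1 : ℝ) * (-y) ^ j) * -((1 - y) ^ (i + 1) / (i + 1)) =
        ((j + 1 : ℝ) / (i + 1)) * ((-y) ^ j * (1 - y) ^ (i + 1)) := fun y => by ring
    simp only [h3, intervalIntegral.integral_const_mul]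
    rw [ih (i + 1) (by lia)]
    simp [Nat.factorial_succ, show j + (i + 1) = j + i + 1 by ring, show j + 1 + i = j + i + 1 by ring]
    field_simp
    ring

theorem continuous_integral_nestIter {K : ℝ → Matrix n n ℂ} (hK : BddMeas K) {T : ℝ} (hT : 0 ≤ T)
    (p : ℕ) : Continuous fun y => ∫ s in (0 : ℝ)..T, nestIter K T y p s := by
  simp only [integral_nestIter hK hT, ascentWeight]
  fun_prop

theorem multiCommutator_smul (c : ℂ) (p : ℕ) (M : Fin (p + 1) → Matrix n n ℂ) :
    (multiCommutator p fun i => c • M i) = c ^ (p + 1) • multiCommutator p M := by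
  induction p with
  | zero => simp [multiCommutator]
  | succ p ih =>
    simp only [multiCommutator, ih]
    simp only [Ring.lie_def, smul_mul_assoc, mul_smul_comm, smul_sub, smul_smul,
      pow_succ' c (p + 1), mul_comm (c ^ (p + 1)) c]

theorem orderedIntegral_smul (c : ℂ) (q : ℕ) (T : ℝ) (f : (Fin q → ℝ) → Matrix n n ℂ) :
    (orderedIntegral q T fun t => c • f t) = c • orderedIntegral q T f := by
  induction q generalizing T with
  | zero => rfl
  | succ q ih => simp only [orderedIntegral, ih, intervalIntegral.integral_smul]

/-- The coefficients of the exponent `i T H_F`. -/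
noncomputable def magnusCoeff (H : ℝ → Matrix n n ℂ) (T : ℝ) (p : ℕ) : Matrix n n ℂ :=
  (Complex.I * T) • ((T : ℂ) ^ p) • magnusTerm H T p

/-- The link between the permutation formula and the recursion: after integration over y, the Beta
integral supplies the factorials in the formula for Ω_p. -/
theorem magnusCoeff_eq {H : ℝ → Matrix n n ℂ} (hH : BddMeas H) {T : ℝ} (hT : 0 < T) (p : ℕ) :
    ((p : ℝ) + 1) • magnusCoeff H T p = ∫ y in (0 : ℝ)..1, ∫ s in (0 : ℝ)..T,
      nestIter (fun s => Complex.I • H s) T y p s := by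
  have hK : BddMeas fun s => Complex.I • H s :=
    ⟨hH.meas.fun_const_smul _, hH.bdd.imp fun c h t => by simpa [norm_smul] using h t⟩
  simp only [integral_nestIter hK hT.le]
  rw [intervalIntegral.integral_finsetSum fun σ _ =>
    Continuous.intervalIntegrable (by unfold ascentWeight; fun_prop) _ _]
  simp only [intervalIntegral.integral_smul_const]
  have h1 : ∀ σ : Equiv.Perm (Fin (p + 1)), ascents σ ≤ p := fun σ => by
    unfold ascents
    exact (Finset.card_filter_le _ _).trans (by simp)
  simp only [integral_ascentWeight (h1 _), multiCommutator_smul, orderedIntegral_smul]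
  rw [magnusCoeff, magnusTerm, Finset.smul_sum, Finset.smul_sum, Finset.smul_sum, Finset.smul_sum]
  refine Finset.sum_congr rfl fun σ _ => ?_
  rw [← Complex.coe_smul, ← Complex.coe_smul]
  simp only [smul_smul]
  congr 1
  obtain ⟨i, hi⟩ := Nat.exists_eq_add_of_le (h1 σ)
  have hT' : (T : ℂ) ≠ 0 := by exact_mod_cast hT.ne'
  have hp : (p : ℂ) + 1 ≠ 0 := by exact_mod_cast Nat.succ_ne_zero p
  have hf : (p.factorial : ℂ) ≠ 0 := by exact_mod_cast p.factorial_ne_zero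
  have hI : Complex.I ^ p ≠ 0 := pow_ne_zero _ Complex.I_ne_zero
  -- Since (-1)^p = i^(2p), the sign (-1)^(p-θ) together with i^(1-p) in the definition equals
  -- (-1)^θ i^(p+1), which is what the p + 1 factors iH produce.
  have hs : (-1 : ℂ) ^ (p - ascents σ) * (-1 : ℂ) ^ ascents σ = Complex.I ^ p * Complex.I ^ p := by
    rw [← pow_add, Nat.sub_add_cancel (h1 σ), ← mul_pow, Complex.I_mul_I]
  have hs' : ((-1 : ℂ) ^ ascents σ) * ((-1 : ℂ) ^ ascents σ) = 1 := by
    rw [← mul_pow]; simp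
  have hs2 : (-1 : ℂ) ^ (p - ascents σ) = Complex.I ^ p * Complex.I ^ p * (-1 : ℂ) ^ ascents σ := by
    rw [← hs, mul_assoc, hs', mul_one]
  rw [hs2]
  push_cast [Nat.factorial_succ]
  field_simp
  ring

/-- The generator of the truncated Floquet-Magnus expansion agrees with the exact one to the order
of truncation. -/
theorem phi_magnus_sub_scaleGen_isBigO {H : ℝ → Matrix n n ℂ} (hH : BddMeas H) {T : ℝ} (hT : 0 < T)
    {N : ℕ} (hN : 0 < N) :
    (fun e => phi (adL (expoPoly (magnusCoeff H T) N e)) (expoPolyDeriv (magnusCoeff H T) N e) -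
      scaleGen (fun s => Complex.I • H s) T e) =O[𝓝[>] 0] fun e : ℝ => e ^ N := by
  have hK : BddMeas fun s => Complex.I • H s :=
    ⟨hH.meas.fun_const_smul _, hH.bdd.imp fun c h t => by simpa [norm_smul] using h t⟩
  exact phi_sub_scaleGen_isBigO hK.locBdd hT.le hN
    (fun p _ => continuous_integral_nestIter hK hT.le p) fun p _ => magnusCoeff_eq hH hT p

theorem truncatedStep_eq (H : ℝ → Matrix n n ℂ) (T : ℝ) (q : ℕ) :
    truncatedStep H T q = NormedSpace.exp (-expoPoly (magnusCoeff H T) (q + 1) 1) := by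
  simp [truncatedStep, truncatedFloquet, expoPoly, magnusCoeff, Finset.smul_sum, neg_smul]

end NestedMagnus

/-! ### Unitarity and periodicity -/

section Unitarity

variable {n : Type*} [Fintype n] [DecidableEq n]

theorem intervalIntegral_conjTranspose (f : ℝ → Matrix n n ℂ) (a b : ℝ) :
    (∫ s in a..b, f s)ᴴ = ∫ s in a..b, (f s)ᴴ := by
  simp only [intervalIntegral, Matrix.conjTranspose_sub]
  congr 1 <;> exact ((starL' ℝ : Matrix n n ℂ ≃L[ℝ] Matrix n n ℂ).integral_comp_comm f).symm

theorem volterra_mulLeft_eq_dysonTerm (H : ℝ → Matrix n n ℂ) (q : ℕ) (t : ℝ) :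
    volterra (fun s => -ContinuousLinearMap.mul ℝ (Matrix n n ℂ) (Complex.I • H s)) 1 q t =
      dysonTerm H q t := by
  induction q generalizing t with
  | zero => rfl
  | succ q ih =>
    rw [volterra, dysonTerm, ← intervalIntegral.integral_smul]
    congr 1 with s
    rw [ih]
    simp

theorem propagator_eq_leftProp (H : ℝ → Matrix n n ℂ) (t : ℝ) :
    propagator H t = leftProp (fun s => Complex.I • H s) 1 t := by
  simp only [propagator, leftProp, volterraSum, one_pow, one_smul, volterra_mulLeft_eq_dysonTerm]

variable {K : ℝ → Matrix n n ℂ}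

/-- For anti-Hermitian K the adjoint of u solves the equation of v, and solutions are unique. -/
theorem conjTranspose_leftProp (hK : LocBdd K) (hs : ∀ t, (K t)ᴴ = -K t) (ε : ℝ) {t : ℝ}
    (ht : 0 ≤ t) : (leftProp K ε t)ᴴ = rightProp K ε t := by
  have h1 := (leftProp_isPrimitive hK ε).clm_comp
    ((starL' ℝ : Matrix n n ℂ ≃L[ℝ] Matrix n n ℂ) : Matrix n n ℂ →L[ℝ] Matrix n n ℂ)
  have h2 := (h1.sub (rightProp_isPrimitive hK ε)).congr_deriv
    (φ' := fun s => (ε • (ContinuousLinearMap.mul ℝ (Matrix n n ℂ)).flip (K s))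
      ((leftProp K ε s)ᴴ - rightProp K ε s)) fun s => by
      change star (ε • (-(K s * leftProp K ε s))) - _ = _
      simp [Matrix.star_eq_conjTranspose, hs, smul_sub]
  have h3 := eq_zero_of_isPrimitive ((locBdd_mulRight hK).smul ε) h2 (by simp) ht
  exact sub_eq_zero.1 h3

theorem leftProp_mem_unitary (hK : LocBdd K) (hs : ∀ t, (K t)ᴴ = -K t) (ε : ℝ) {t : ℝ}
    (ht : 0 ≤ t) : leftProp K ε t ∈ unitary (Matrix n n ℂ) := by
  rw [Unitary.mem_iff, Matrix.star_eq_conjTranspose, conjTranspose_leftProp hK hs ε ht]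
  exact ⟨rightProp_mul_leftProp hK ε ht, leftProp_mul_rightProp hK ε ht⟩

theorem rightProp_mem_unitary (hK : LocBdd K) (hs : ∀ t, (K t)ᴴ = -K t) (ε : ℝ) {t : ℝ}
    (ht : 0 ≤ t) : rightProp K ε t ∈ unitary (Matrix n n ℂ) := by
  rw [← conjTranspose_leftProp hK hs ε ht]
  exact Unitary.star_mem (leftProp_mem_unitary hK hs ε ht)

theorem leftProp_add_period (hK : BddMeas K) {T : ℝ} (hT : 0 ≤ T) (hp : ∀ t, K (t + T) = K t)
    (ε : ℝ) {t : ℝ} (ht : 0 ≤ t) :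
    leftProp K ε (t + T) = leftProp K ε t * leftProp K ε T := by
  have hu := leftProp_isPrimitive hK.locBdd ε
  have hc : ContinuousOn (fun s => leftProp K ε (s + T)) (Ici 0) :=
    hu.continuousOn.comp (by fun_prop) fun s hs => add_nonneg (mem_Ici.1 hs) hT
  have h1 : IsPrimitive (fun s => leftProp K ε (s + T))
      fun s => ε • (-(K s * leftProp K ε (s + T))) := by
    refine IsPrimitive.of_integral
      ((hK.locBdd.mul (LocBdd.of_continuousOn hc)).neg.smul ε) fun t ht => ?_
    have e1 := hu.eq_add_integral (add_nonneg ht hT)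
    have e2 := hu.eq_add_integral hT
    have e3 := intervalIntegral.integral_comp_add_right (a := 0) (b := t)
      (fun s => ε • (-(K s * leftProp K ε s))) T
    simp only [hp] at e3
    rw [zero_add, e3, e2, zero_add, e1, add_assoc,
      intervalIntegral.integral_add_adjacent_intervals]
    · exact hu.locBdd.intervalIntegrable le_rfl hT
    · exact hu.locBdd.intervalIntegrable hT (add_nonneg ht hT)
  have h2 := (h1.sub (hu.mul (IsPrimitive.const (leftProp K ε T)))).congr_deriv
    (φ' := fun s => (ε • -ContinuousLinearMap.mul ℝ (Matrix n n ℂ) (K s))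
      (leftProp K ε (s + T) - leftProp K ε s * leftProp K ε T)) fun s => by
      simp [mul_sub, smul_sub, mul_assoc]
      abel
  have h3 := eq_zero_of_isPrimitive ((locBdd_mulLeft hK.locBdd).smul ε) h2 (by simp) ht
  exact sub_eq_zero.1 h3

theorem leftProp_nat_mul_period (hK : BddMeas K) {T : ℝ} (hT : 0 ≤ T) (hp : ∀ t, K (t + T) = K t)
    (ε : ℝ) (m : ℕ) : leftProp K ε (m * T) = leftProp K ε T ^ m := by
  induction m with
  | zero => simp
  | succ m ih =>
    rw [Nat.cast_succ, add_one_mul, leftProp_add_period hK hT hp ε (by positivity), ih, pow_succ]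

/-- Anti-Hermitian matrices form a real Lie algebra. Through the recursion this makes the truncated
Floquet Hamiltonian Hermitian without inspecting the sum over permutations. -/
theorem conjTranspose_nestIter (hs : ∀ t, (K t)ᴴ = -K t) (T y : ℝ) (p : ℕ) (s : ℝ) :
    (nestIter K T y p s)ᴴ = -nestIter K T y p s := by
  induction p generalizing s with
  | zero => exact hs s
  | succ p ih =>
    have h : ((1 - y) • (∫ r in (0 : ℝ)..T, nestIter K T y p r) -
        ∫ r in (0 : ℝ)..s, nestIter K T y p r)ᴴ = -((1 - y) • (∫ r in (0 : ℝ)..T,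
          nestIter K T y p r) - ∫ r in (0 : ℝ)..s, nestIter K T y p r) := by
      simp only [Matrix.conjTranspose_sub, Matrix.conjTranspose_smul,
        intervalIntegral_conjTranspose, ih, intervalIntegral.integral_neg, star_trivial, smul_neg]
      abel
    rw [nestIter, adL_apply, Matrix.conjTranspose_sub, Matrix.conjTranspose_mul,
      Matrix.conjTranspose_mul, h, hs, neg_mul_neg, neg_mul_neg, neg_sub]

theorem conjTranspose_magnusCoeff {H : ℝ → Matrix n n ℂ} (hH : BddMeas H)
    (hs : ∀ t, (H t).IsHermitian) {T : ℝ} (hT : 0 < T) (p : ℕ) :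
    (magnusCoeff H T p)ᴴ = -magnusCoeff H T p := by
  have hK : ∀ t, (Complex.I • H t)ᴴ = -(Complex.I • H t) := fun t => by
    rw [Matrix.conjTranspose_smul, (hs t).eq]
    simp
  have h := magnusCoeff_eq hH hT p
  have h' : (((p : ℝ) + 1) • magnusCoeff H T p)ᴴ = -(((p : ℝ) + 1) • magnusCoeff H T p) := by
    rw [h]
    simp only [intervalIntegral_conjTranspose, conjTranspose_nestIter hK,
      intervalIntegral.integral_neg]
  rw [Matrix.conjTranspose_smul, star_trivial, ← smul_neg] at h'
  exact smul_right_injective _ (by positivity : (p : ℝ) + 1 ≠ 0) h'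

theorem conjTranspose_expoPoly {x : ℕ → Matrix n n ℂ} (hx : ∀ p, (x p)ᴴ = -x p) (N : ℕ) (ε : ℝ) :
    (expoPoly x N ε)ᴴ = -expoPoly x N ε := by
  simp [expoPoly, Matrix.conjTranspose_sum, Matrix.conjTranspose_smul, hx]

theorem exp_mem_unitary {X : Matrix n n ℂ} (hX : Xᴴ = -X) :
    NormedSpace.exp X ∈ unitary (Matrix n n ℂ) := by
  rw [Unitary.mem_iff, Matrix.star_eq_conjTranspose, ← Matrix.exp_conjTranspose, hX]
  exact ⟨exp_neg_mul_exp X, exp_mul_exp_neg X⟩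

end Unitarity

/-! ### Operators supported on a region -/

section Support

variable {Λ : Type*} [Fintype Λ] [DecidableEq Λ] {d : ℕ} {X Y : Finset Λ} {A B : Op Λ d}

theorem SupportedOn.add (hA : SupportedOn X A) (hB : SupportedOn X B) : SupportedOn X (A + B) := by
  obtain ⟨A', rfl⟩ := hA
  obtain ⟨B', rfl⟩ := hB
  exact ⟨A' + B', by rw [Matrix.add_kronecker]; rfl⟩

theorem SupportedOn.smul (hA : SupportedOn X A) (c : ℂ) : SupportedOn X (c • A) := by
  obtain ⟨A', rfl⟩ := hA
  exact ⟨c • A', by rw [Matrix.smul_kronecker]; rfl⟩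

theorem SupportedOn.zero : SupportedOn X (0 : Op Λ d) :=
  ⟨0, by rw [Matrix.zero_kronecker]; rfl⟩

/-- The operators supported on a region, as a subspace. -/
def supportSubmodule (d : ℕ) (X : Finset Λ) : Submodule ℂ (Op Λ d) where
  carrier := {A | SupportedOn X A}
  add_mem' := SupportedOn.add
  zero_mem' := SupportedOn.zero
  smul_mem' c _ h := h.smul c

theorem mem_supportSubmodule : A ∈ supportSubmodule d X ↔ SupportedOn X A := Iff.rfl

theorem SupportedOn.sub (hA : SupportedOn X A) (hB : SupportedOn X B) : SupportedOn X (A - B) :=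
  (supportSubmodule d X).sub_mem hA hB

theorem SupportedOn.mul (hA : SupportedOn X A) (hB : SupportedOn X B) : SupportedOn X (A * B) := by
  obtain ⟨A', rfl⟩ := hA
  obtain ⟨B', rfl⟩ := hB
  refine ⟨A' * B', ?_⟩
  rw [Matrix.submatrix_mul_equiv, ← Matrix.mul_kronecker_mul, one_mul]

theorem SupportedOn.eq_zero (hA : SupportedOn X A) {a b : Λ → Fin d} {i : Λ} (hi : i ∉ X)
    (h : a i ≠ b i) : A a b = 0 := by
  obtain ⟨A', rfl⟩ := hA
  have h1 : (splitting X a).2 ≠ (splitting X b).2 := fun e => h (congrFun e ⟨i, hi⟩)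
  simp [Matrix.kroneckerMap_apply, Matrix.one_apply_ne h1]

theorem SupportedOn.congr (hA : SupportedOn X A) {a b a' b' : Λ → Fin d}
    (ha : ∀ i ∈ X, a i = a' i) (hb : ∀ i ∈ X, b i = b' i) (h : ∀ i ∉ X, a i = b i)
    (h' : ∀ i ∉ X, a' i = b' i) : A a b = A a' b' := by
  obtain ⟨A', rfl⟩ := hA
  have e1 : (splitting X a).2 = (splitting X b).2 := funext fun i => h i i.2
  have e2 : (splitting X a').2 = (splitting X b').2 := funext fun i => h' i i.2
  have e3 : (splitting X a).1 = (splitting X a').1 := funext fun i => ha i i.2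
  have e4 : (splitting X b).1 = (splitting X b').1 := funext fun i => hb i i.2
  simp only [Matrix.submatrix_apply, Matrix.kroneckerMap_apply, e3, e4]
  rw [e1, e2, Matrix.one_apply_eq, Matrix.one_apply_eq]

/-- The converse of `SupportedOn.eq_zero` and `SupportedOn.congr`; it permits support statements to
be checked on matrix entries. The tensor factor is read off with the spins outside of X frozen in a
reference configuration. -/
theorem SupportedOn.of_entries (h0 : ∀ a b : Λ → Fin d, ∀ i ∉ X, a i ≠ b i → A a b = 0)
    (h1 : ∀ a b a' b' : Λ → Fin d, (∀ i ∈ X, a i = a' i) → (∀ i ∈ X, b i = b' i) →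
      (∀ i ∉ X, a i = b i) → (∀ i ∉ X, a' i = b' i) → A a b = A a' b') : SupportedOn X A := by
  rcases isEmpty_or_nonempty (Λ → Fin d) with he | ⟨⟨c⟩⟩
  · exact ⟨0, Matrix.ext fun a => (he.false a).elim⟩
  refine ⟨Matrix.of fun α β => A ((splitting X).symm (α, (splitting X c).2))
    ((splitting X).symm (β, (splitting X c).2)), Matrix.ext fun a b => ?_⟩
  rw [Matrix.submatrix_apply, Matrix.kroneckerMap_apply]
  by_cases hab : ∀ i ∉ X, a i = b i
  · have e1 : (splitting X a).2 = (splitting X b).2 := funext fun i => hab i i.2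
    rw [e1, Matrix.one_apply_eq, mul_one, Matrix.of_apply]
    refine h1 _ _ _ _ ?_ ?_ hab ?_ <;> intro i hi <;>
      simp [splitting, Equiv.piEquivPiSubtypeProd, hi]
  · push Not at hab
    obtain ⟨i, hi, hne⟩ := hab
    have e1 : (splitting X a).2 ≠ (splitting X b).2 := fun e => hne (congrFun e ⟨i, hi⟩)
    rw [Matrix.one_apply_ne e1, mul_zero, h0 a b i hi hne]

theorem SupportedOn.mono (hA : SupportedOn X A) (hXY : X ⊆ Y) : SupportedOn Y A := by
  refine .of_entries (fun a b i hi h => hA.eq_zero (fun h' => hi (hXY h')) h) ?_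
  intro a b a' b' ha hb h h'
  by_cases hab : ∀ i ∉ X, a i = b i
  · refine hA.congr (fun i hi => ha i (hXY hi)) (fun i hi => hb i (hXY hi)) hab fun i hi => ?_
    by_cases hi' : i ∈ Y
    · rw [← ha i hi', ← hb i hi', hab i hi]
    · exact h' i hi'
  · push Not at hab
    obtain ⟨i, hi, hne⟩ := hab
    have hi' : i ∈ Y := by
      by_contra hi'
      exact hne (h i hi')
    rw [hA.eq_zero hi hne, hA.eq_zero hi (by rwa [← ha i hi', ← hb i hi'])]

/-- For disjoint regions only one intermediate configuration contributes to the product: A has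
already moved the spins in X and B has not yet moved those in Y. -/
theorem SupportedOn.mul_apply_disjoint (hA : SupportedOn X A) (hB : SupportedOn Y B)
    (hXY : Disjoint X Y) (a b : Λ → Fin d) :
    (A * B) a b = A a (fun i => if i ∈ X then b i else a i) *
      B (fun i => if i ∈ X then b i else a i) b := by
  rw [Matrix.mul_apply]
  refine Finset.sum_eq_single _ (fun c _ hc => ?_) (by simp)
  obtain ⟨i, hi⟩ := Function.ne_iff.1 hc
  by_cases hX : i ∈ X
  · rw [if_pos hX] at hi
    rw [hB.eq_zero (Finset.disjoint_left.1 hXY hX) hi, mul_zero]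
  · rw [if_neg hX] at hi
    rw [hA.eq_zero hX (Ne.symm hi), zero_mul]

theorem SupportedOn.commute (hA : SupportedOn X A) (hB : SupportedOn Y B) (hXY : Disjoint X Y) :
    A * B = B * A := by
  ext a b
  rw [hA.mul_apply_disjoint hB hXY, hB.mul_apply_disjoint hA hXY.symm]
  have hY : ∀ i ∈ Y, i ∉ X := fun i hi hi' => Finset.disjoint_left.1 hXY hi' hi
  by_cases hab : ∀ i, i ∉ X → i ∉ Y → a i = b i
  · rw [mul_comm]
    congr 1
    · refine hB.congr ?_ ?_ ?_ ?_ <;> intro i hi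
      · simp [hY i hi]
      · simp [hi]
      · by_cases hX : i ∈ X <;> simp [hX]
        exact hab i hX hi
      · simp [hi]
    · refine hA.congr ?_ ?_ ?_ ?_ <;> intro i hi
      · have : i ∉ Y := fun h => hY i h hi
        simp [this]
      · simp [hi]
      · simp [hi]
      · by_cases hX : i ∈ Y <;> simp [hX]
        exact hab i hi hX
  · push Not at hab
    obtain ⟨i, hX, hY', hne⟩ := hab
    have e1 : B (fun i => if i ∈ X then b i else a i) b = 0 :=
      hB.eq_zero (i := i) hY' (by rwa [if_neg hX])
    have e2 : A (fun i => if i ∈ Y then b i else a i) b = 0 :=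
      hA.eq_zero (i := i) hX (by rwa [if_neg hY'])
    simp only [e1, e2, mul_zero]

theorem SupportedOn.adL (hA : SupportedOn X A) (hB : SupportedOn Y B) :
    SupportedOn (X ∪ Y) (adL A B) :=
  have hA' := hA.mono Finset.subset_union_left
  have hB' := hB.mono Finset.subset_union_right
  (hA'.mul hB').sub (hB'.mul hA')

theorem SupportedOn.adL_eq_zero (hA : SupportedOn X A) (hB : SupportedOn Y B)
    (hXY : Disjoint X Y) : Floquet.adL A B = 0 := by
  rw [adL_apply, hA.commute hB hXY, sub_self]

theorem norm_adL_le (A B : Op Λ d) : ‖adL A B‖ ≤ 2 * ‖A‖ * ‖B‖ := by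
  rw [adL_apply]
  refine (norm_sub_le _ _).trans ?_
  have h1 := norm_mul_le A B
  have h2 := norm_mul_le B A
  linarith

end Support

/-! ### Sums of few-body terms with bounded strength per site -/

section Locality

variable {Λ : Type*} [Fintype Λ] [DecidableEq Λ] {d : ℕ}

/-- `A` is a sum of local terms on at most `p k` sites, of strength `a` per site. -/
def Loc (k p : ℕ) (a : ℝ) (A : Op Λ d) : Prop :=
  0 ≤ a ∧ ∃ Φ : Finset Λ → Op Λ d, (∀ X, SupportedOn X (Φ X)) ∧
    (∀ X, Φ X ≠ 0 → X.Nonempty ∧ X.card ≤ p * k) ∧ A = ∑ X, Φ X ∧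
    ∀ i, ∑ X with i ∈ X, ‖Φ X‖ ≤ a

variable {k p r : ℕ} {a b : ℝ} {A B : Op Λ d}

namespace Loc

theorem zero (k p : ℕ) (ha : 0 ≤ a) : Loc k p a (0 : Op Λ d) :=
  ⟨ha, 0, fun _ => SupportedOn.zero, by simp, by simp, fun _ => by simpa⟩

theorem mono (hA : Loc k p a A) (hab : a ≤ b) : Loc k p b A := by
  obtain ⟨ha, Φ, h1, h2, h3, h4⟩ := hA
  exact ⟨ha.trans hab, Φ, h1, h2, h3, fun i => (h4 i).trans hab⟩

theorem add (hA : Loc k p a A) (hB : Loc k p b B) : Loc k p (a + b) (A + B) := by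
  obtain ⟨ha, Φ, h1, h2, h3, h4⟩ := hA
  obtain ⟨hb, Ψ, g1, g2, g3, g4⟩ := hB
  refine ⟨add_nonneg ha hb, Φ + Ψ, fun X => (h1 X).add (g1 X), fun X hX => ?_,
    by simp [h3, g3, Finset.sum_add_distrib], fun i => ?_⟩
  · by_cases h : Φ X = 0
    · exact g2 X (by simpa [h] using hX)
    · exact h2 X h
  · calc _ ≤ ∑ X with i ∈ X, (‖Φ X‖ + ‖Ψ X‖) := Finset.sum_le_sum fun X _ => norm_add_le _ _
      _ ≤ _ := by rw [Finset.sum_add_distrib]; exact add_le_add (h4 i) (g4 i)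

theorem csmul (hA : Loc k p a A) (c : ℂ) : Loc k p (‖c‖ * a) (c • A) := by
  obtain ⟨ha, Φ, h1, h2, h3, h4⟩ := hA
  refine ⟨by positivity, c • Φ, fun X => (h1 X).smul c, fun X hX => h2 X fun h => hX ?_,
    by simp [h3, Finset.smul_sum], fun i => ?_⟩
  · simp [h]
  · simp only [Pi.smul_apply, norm_smul, ← Finset.mul_sum]
    exact mul_le_mul_of_nonneg_left (h4 i) (norm_nonneg _)

theorem smul (hA : Loc k p a A) (c : ℝ) : Loc k p (|c| * a) (c • A) := by
  simpa [Complex.coe_smul] using hA.csmul (c : ℂ)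

theorem sum {ι : Type*} (s : Finset ι) {f : ι → Op Λ d} {g : ι → ℝ}
    (h : ∀ i ∈ s, Loc k p (g i) (f i)) : Loc k p (∑ i ∈ s, g i) (∑ i ∈ s, f i) := by
  classical
  induction s using Finset.induction_on with
  | empty => simpa using zero k p le_rfl
  | insert j s hj ih =>
    rw [Finset.sum_insert hj, Finset.sum_insert hj]
    exact (h j (Finset.mem_insert_self _ _)).add (ih fun i hi => h i (Finset.mem_insert_of_mem hi))

end Loc

theorem sum_norm_meeting_le {Ψ : Finset Λ → Op Λ d} (h : ∀ i, ∑ X with i ∈ X, ‖Ψ X‖ ≤ b)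
    (X : Finset Λ) : ∑ Y with ¬Disjoint X Y, ‖Ψ Y‖ ≤ X.card * b := by
  calc ∑ Y with ¬Disjoint X Y, ‖Ψ Y‖
      ≤ ∑ Y, ∑ i ∈ X, if i ∈ Y then ‖Ψ Y‖ else 0 := by
        rw [Finset.sum_filter]
        refine Finset.sum_le_sum fun Y _ => ?_
        have h0 : ∀ i ∈ X, 0 ≤ if i ∈ Y then ‖Ψ Y‖ else 0 := fun i _ => by
          split_ifs
          exacts [norm_nonneg _, le_rfl]
        by_cases hY : Disjoint X Y
        · simpa [hY] using Finset.sum_nonneg h0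
        · obtain ⟨i, hi, hi'⟩ := Finset.not_disjoint_iff.1 hY
          rw [if_pos hY]
          simpa [hi'] using Finset.single_le_sum h0 hi
    _ = ∑ i ∈ X, ∑ Y with i ∈ Y, ‖Ψ Y‖ := by
        rw [Finset.sum_comm]
        simp only [Finset.sum_filter]
    _ ≤ ∑ _i ∈ X, b := Finset.sum_le_sum fun i _ => h i
    _ = _ := by simp

namespace Loc

/-- Only the terms that meet X fail to commute with O. This estimate is what makes the final bound
independent of the volume. -/
theorem norm_adL_le (hA : Loc k p a A) {X : Finset Λ} {O : Op Λ d} (hO : SupportedOn X O) :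
    ‖adL A O‖ ≤ 2 * a * X.card * ‖O‖ := by
  obtain ⟨ha, Φ, h1, h2, rfl, h4⟩ := hA
  rw [map_sum, _root_.sum_apply]
  have h5 : ∑ Y, adL (Φ Y) O = ∑ Y with ¬Disjoint X Y, adL (Φ Y) O := by
    rw [Finset.sum_filter]
    refine Finset.sum_congr rfl fun Y _ => ?_
    by_cases h : Disjoint X Y
    · simp [h, (h1 Y).adL_eq_zero hO h.symm, -adL_apply]
    · simp [h]
  rw [h5]
  calc _ ≤ ∑ Y with ¬Disjoint X Y, 2 * ‖Φ Y‖ * ‖O‖ :=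
        norm_sum_le_of_le _ fun Y _ => Floquet.norm_adL_le _ _
    _ = 2 * (∑ Y with ¬Disjoint X Y, ‖Φ Y‖) * ‖O‖ := by rw [← Finset.sum_mul, ← Finset.mul_sum]
    _ ≤ 2 * (X.card * a) * ‖O‖ := by gcongr; exact sum_norm_meeting_le h4 X
    _ = _ := by ring

/-- A bound growing with the volume, used only for boundedness and summability, never in a final
constant. -/
theorem norm_le (hA : Loc k p a A) : ‖A‖ ≤ Fintype.card Λ * a := by
  obtain ⟨ha, Φ, h1, h2, rfl, h4⟩ := hA
  refine (norm_sum_le _ _).trans (le_trans ?_ (sum_norm_meeting_le h4 Finset.univ))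
  rw [Finset.sum_filter]
  refine Finset.sum_le_sum fun X _ => ?_
  by_cases h : Φ X = 0
  · simp [h]
  · obtain ⟨i, hi⟩ := (h2 X h).1
    rw [if_pos (Finset.not_disjoint_iff.2 ⟨i, Finset.mem_univ i, hi⟩)]

/-- Only overlapping pairs contribute, and they are grouped by their union. If the union contains i,
then i lies in the first or in the second set. In the first case the terms of B meeting a set of at
most pk sites weigh at most pkb, in the second the roles are exchanged; together this gives 2k(p +
r)ab. -/
theorem adL (hA : Loc k p a A) (hB : Loc k r b B) :
    Loc k (p + r) (2 * k * (p + r) * a * b) (adL A B) := by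
  obtain ⟨ha, Φ, h1, h2, rfl, h4⟩ := hA
  obtain ⟨hb, Ψ, g1, g2, rfl, g4⟩ := hB
  set P : Finset Λ → Finset (Finset Λ × Finset Λ) := fun Z =>
    Finset.univ.filter fun q : Finset Λ × Finset Λ => q.1 ∪ q.2 = Z ∧ ¬Disjoint q.1 q.2
  have hz : ∀ X Y : Finset Λ, Disjoint X Y → Floquet.adL (Φ X) (Ψ Y) = 0 := fun X Y h =>
    (h1 X).adL_eq_zero (g1 Y) h
  refine ⟨by positivity, fun Z => ∑ q ∈ P Z, Floquet.adL (Φ q.1) (Ψ q.2), fun Z => ?_,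
    fun Z hZ => ?_, ?_, fun i => ?_⟩
  · refine (supportSubmodule d Z).sum_mem fun q hq => ?_
    rw [mem_supportSubmodule, ← (Finset.mem_filter.1 hq).2.1]
    exact (h1 q.1).adL (g1 q.2)
  · obtain ⟨q, hq, hne⟩ := Finset.exists_ne_zero_of_sum_ne_zero hZ
    have hq' := (Finset.mem_filter.1 hq).2
    have e1 : Φ q.1 ≠ 0 := fun h => hne (by simp [h])
    have e2 : Ψ q.2 ≠ 0 := fun h => hne (by simp [h])
    rw [← hq'.1]
    refine ⟨(h2 _ e1).1.mono Finset.subset_union_left, (Finset.card_union_le _ _).trans ?_⟩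
    rw [add_mul]
    exact add_le_add (h2 _ e1).2 (g2 _ e2).2
  · simp only [map_sum, _root_.sum_apply]
    rw [Finset.sum_comm, ← Finset.sum_product', Finset.univ_product_univ]
    simp only [P, Finset.sum_filter, Finset.sum_comm (s := Finset.univ (α := Finset Λ))]
    refine Finset.sum_congr rfl fun q _ => ?_
    rw [Finset.sum_eq_single (q.1 ∪ q.2)]
    · by_cases h : Disjoint q.1 q.2
      · simp [h, hz _ _ h]
      · simp [h]
    · intro Z _ hZ
      rw [if_neg fun h => hZ h.1.symm]
    · simp
  · have key : ∀ X Y : Finset Λ, ‖Floquet.adL (Φ X) (Ψ Y)‖ ≤ 2 * (‖Φ X‖ * ‖Ψ Y‖) := fun X Y =>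
      (Floquet.norm_adL_le _ _).trans_eq (mul_assoc _ _ _)
    have e1 : ∑ X with i ∈ X, ∑ Y with ¬Disjoint X Y, 2 * (‖Φ X‖ * ‖Ψ Y‖) ≤ 2 * (k * p) * a * b := by
      calc _ ≤ ∑ X with i ∈ X, 2 * (‖Φ X‖ * ((p * k : ℕ) * b)) := by
            refine Finset.sum_le_sum fun X _ => ?_
            simp only [← Finset.mul_sum]
            by_cases h : Φ X = 0
            · simp [h]
            · have := (sum_norm_meeting_le g4 X).trans
                (mul_le_mul_of_nonneg_right (Nat.cast_le.2 (h2 X h).2) hb)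
              gcongr
        _ = 2 * (∑ X with i ∈ X, ‖Φ X‖) * (k * p * b) := by
            rw [Finset.mul_sum, Finset.sum_mul]
            refine Finset.sum_congr rfl fun X _ => ?_
            push_cast
            ring
        _ ≤ 2 * a * (k * p * b) := by gcongr; exact h4 i
        _ = _ := by ring
    have e2 : ∑ Y with i ∈ Y, ∑ X with ¬Disjoint Y X, 2 * (‖Φ X‖ * ‖Ψ Y‖) ≤ 2 * (k * r) * a * b := by
      calc _ ≤ ∑ Y with i ∈ Y, 2 * (‖Ψ Y‖ * ((r * k : ℕ) * a)) := by
            refine Finset.sum_le_sum fun Y _ => ?_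
            simp only [mul_comm _ ‖Ψ Y‖, ← Finset.mul_sum]
            by_cases h : Ψ Y = 0
            · simp [h]
            · have := (sum_norm_meeting_le h4 Y).trans
                (mul_le_mul_of_nonneg_right (Nat.cast_le.2 (g2 Y h).2) ha)
              gcongr
        _ = 2 * (∑ X with i ∈ X, ‖Ψ X‖) * (k * r * a) := by
            rw [Finset.mul_sum, Finset.sum_mul]
            refine Finset.sum_congr rfl fun X _ => ?_
            push_cast
            ring
        _ ≤ 2 * b * (k * r * a) := by gcongr; exact g4 i
        _ = _ := by ring
    set Q : Finset (Finset Λ × Finset Λ) := Finset.univ.filter fun q : Finset Λ × Finset Λ =>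
      (i ∈ q.1 ∪ q.2) ∧ ¬Disjoint q.1 q.2
    calc _ ≤ ∑ Z with i ∈ Z, ∑ q ∈ P Z, 2 * (‖Φ q.1‖ * ‖Ψ q.2‖) :=
          Finset.sum_le_sum fun Z _ => norm_sum_le_of_le _ fun q _ => key _ _
      _ = ∑ q ∈ Q, 2 * (‖Φ q.1‖ * ‖Ψ q.2‖) := by
          rw [← Finset.sum_fiberwise_of_maps_to (s := Q) (t := Finset.univ.filter fun Z => i ∈ Z)
            (g := fun q => q.1 ∪ q.2) fun q hq => by simpa [Q] using (Finset.mem_filter.1 hq).2.1]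
          refine Finset.sum_congr rfl fun Z hZ => Finset.sum_congr ?_ fun _ _ => rfl
          ext q
          have hZ' := (Finset.mem_filter.1 hZ).2
          simp only [P, Q, Finset.mem_filter, Finset.mem_univ, true_and]
          constructor
          · rintro ⟨rfl, h⟩
            exact ⟨⟨hZ', h⟩, rfl⟩
          · rintro ⟨⟨_, h⟩, rfl⟩
            exact ⟨rfl, h⟩
      _ ≤ ∑ q : Finset Λ × Finset Λ,
          ((if i ∈ q.1 then if ¬Disjoint q.1 q.2 then 2 * (‖Φ q.1‖ * ‖Ψ q.2‖) else 0 else 0) +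
          (if i ∈ q.2 then if ¬Disjoint q.2 q.1 then 2 * (‖Φ q.1‖ * ‖Ψ q.2‖) else 0 else 0)) := by
          rw [Finset.sum_filter]
          refine Finset.sum_le_sum fun q _ => ?_
          have h0 : 0 ≤ 2 * (‖Φ q.1‖ * ‖Ψ q.2‖) := by positivity
          have hd : Disjoint q.2 q.1 ↔ Disjoint q.1 q.2 := disjoint_comm
          simp only [hd, Finset.mem_union]
          split_ifs <;> first | linarith | tauto
      _ = (∑ X with i ∈ X, ∑ Y with ¬Disjoint X Y, 2 * (‖Φ X‖ * ‖Ψ Y‖)) +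
          ∑ Y with i ∈ Y, ∑ X with ¬Disjoint Y X, 2 * (‖Φ X‖ * ‖Ψ Y‖) := by
          rw [Finset.sum_add_distrib]
          congr 1
          · rw [Fintype.sum_prod_type, Finset.sum_filter]
            refine Finset.sum_congr rfl fun X _ => ?_
            split_ifs with h
            · simp [Finset.sum_filter]
            · simp
          · rw [Fintype.sum_prod_type_right, Finset.sum_filter]
            refine Finset.sum_congr rfl fun X _ => ?_
            split_ifs with h
            · simp [Finset.sum_filter]
            · simp
      _ ≤ 2 * (k * p) * a * b + 2 * (k * r) * a * b := add_le_add e1 e2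
      _ = _ := by ring

end Loc

end Locality

/-! ### Locality of integrals and series, and of the Magnus coefficients -/

section Cone

variable {Λ : Type*} [Fintype Λ] [DecidableEq Λ] {d : ℕ} {k p r : ℕ}

/-- The families of local terms of a given strength. -/
def locFamilies (Λ : Type*) [Fintype Λ] [DecidableEq Λ] (d k p : ℕ) :
    Set ((Finset Λ → Op Λ d) × ℝ) :=
  {q | 0 ≤ q.2 ∧ (∀ X, SupportedOn X (q.1 X)) ∧
    (∀ X, ¬(X.Nonempty ∧ X.card ≤ p * k) → q.1 X = 0) ∧ ∀ i, ∑ X with i ∈ X, ‖q.1 X‖ ≤ q.2}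

theorem isClosed_locFamilies (d k p : ℕ) : IsClosed (locFamilies Λ d k p) := by
  have h1 : ∀ X : Finset Λ, IsClosed {q : (Finset Λ → Op Λ d) × ℝ | SupportedOn X (q.1 X)} :=
    fun X => (supportSubmodule d X).closed_of_finiteDimensional.preimage
      (f := fun q : (Finset Λ → Op Λ d) × ℝ => q.1 X) (by fun_prop)
  have h2 : locFamilies Λ d k p = {q | 0 ≤ q.2} ∩ ((⋂ X, {q | SupportedOn X (q.1 X)}) ∩
      ((⋂ X, ⋂ _ : ¬(X.Nonempty ∧ X.card ≤ p * k), {q | q.1 X = 0}) ∩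
        ⋂ i, {q | ∑ X with i ∈ X, ‖q.1 X‖ ≤ q.2})) := by
    ext q
    simp only [locFamilies, mem_inter_iff, mem_iInter]
    rfl
  rw [h2]
  refine (isClosed_le continuous_const continuous_snd).inter ((isClosed_iInter h1).inter
    ((isClosed_iInter fun X => isClosed_iInter fun _ => ?_).inter (isClosed_iInter fun i => ?_)))
  · exact isClosed_eq (by fun_prop) continuous_const
  · exact isClosed_le (by fun_prop) continuous_snd

theorem loc_iff {a : ℝ} {A : Op Λ d} :
    Loc k p a A ↔ ∃ q ∈ locFamilies Λ d k p, (∑ X, q.1 X, q.2) = (A, a) := by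
  constructor
  · rintro ⟨ha, Φ, h1, h2, h3, h4⟩
    exact ⟨(Φ, a), ⟨ha, h1, fun X h => by_contra fun h' => h (h2 X h'), h4⟩, by simp [h3]⟩
  · rintro ⟨⟨Φ, b⟩, ⟨ha, h1, h2, h4⟩, h⟩
    obtain ⟨rfl, rfl⟩ := Prod.mk.inj h
    exact ⟨ha, Φ, h1, fun X h => by_contra fun h' => h (h2 X h'), rfl, h4⟩

/-- The pairs of a local operator and its strength. -/
def locCone (Λ : Type*) [Fintype Λ] [DecidableEq Λ] (d k p : ℕ) : Set (Op Λ d × ℝ) :=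
  {q | Loc k p q.2 q.1}

/-- Families of local terms of bounded strength form a compact set, so near any point the cone is
contained in a compact image. Closedness and convexity give locality of limits and integrals without
a measurable choice of decompositions. -/
theorem isClosed_locCone (d k p : ℕ) : IsClosed (locCone Λ d k p) := by
  refine isClosed_of_closure_subset fun x hx => ?_
  set S := locFamilies Λ d k p ∩ Metric.closedBall 0 (x.2 + 1)
  have hS : IsCompact S := (isCompact_closedBall _ _).inter_left (isClosed_locFamilies d k p)
  set f : (Finset Λ → Op Λ d) × ℝ → Op Λ d × ℝ := fun q => (∑ X, q.1 X, q.2)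
  have hf : Continuous f := by fun_prop
  have hU : IsOpen {y : Op Λ d × ℝ | y.2 < x.2 + 1} := isOpen_lt continuous_snd continuous_const
  have hx' : x ∈ closure ({y : Op Λ d × ℝ | y.2 < x.2 + 1} ∩ locCone Λ d k p) :=
    hU.inter_closure ⟨lt_add_one x.2, hx⟩
  have hsub : {y : Op Λ d × ℝ | y.2 < x.2 + 1} ∩ locCone Λ d k p ⊆ f '' S := by
    rintro y ⟨hy1, hy2⟩
    obtain ⟨q, hq, hqy⟩ := loc_iff.1 hy2
    refine ⟨q, ⟨hq, ?_⟩, hqy⟩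
    have e2 : q.2 = y.2 := congrArg Prod.snd hqy
    have hlt : q.2 < x.2 + 1 := e2 ▸ hy1
    rw [mem_closedBall_zero_iff, Prod.norm_def, max_le_iff]
    constructor
    · refine (pi_norm_le_iff_of_nonneg (hq.1.trans hlt.le)).2 fun X => ?_
      by_cases h : X.Nonempty ∧ X.card ≤ p * k
      · obtain ⟨i, hi⟩ := h.1
        refine le_trans ?_ ((hq.2.2.2 i).trans hlt.le)
        exact Finset.single_le_sum (f := fun X => ‖q.1 X‖) (fun _ _ => norm_nonneg _)
          (by simpa using hi)
      · rw [hq.2.2.1 X h, norm_zero]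
        exact hq.1.trans hlt.le
    · rw [Real.norm_of_nonneg hq.1]
      exact hlt.le
  obtain ⟨q, hq, hqx⟩ := (closure_minimal hsub (hS.image hf).isClosed) hx'
  exact loc_iff.2 ⟨q, hq.1, hqx⟩

theorem convex_locCone (d k p : ℕ) : Convex ℝ (locCone Λ d k p) := by
  intro x hx y hy a b ha hb _
  have h1 := Loc.add (Loc.smul hx a) (Loc.smul hy b)
  rw [abs_of_nonneg ha, abs_of_nonneg hb] at h1
  exact h1

namespace Loc

theorem integral {f : ℝ → Op Λ d} {g : ℝ → ℝ} {u t : ℝ} (hut : u ≤ t) (hg : Continuous g)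
    (h : ∀ s ∈ Icc u t, Loc k p (g s) (f s)) : Loc k p (∫ s in u..t, g s) (∫ s in u..t, f s) := by
  have hpos : 0 ≤ ∫ s in u..t, g s := intervalIntegral.integral_nonneg hut fun s hs => (h s hs).1
  by_cases hf : IntervalIntegrable f volume u t
  -- A non-integrable function has integral zero by convention, and zero is local with any
  -- nonnegative strength.
  swap
  · rw [intervalIntegral.integral_undef hf]
    exact zero k p hpos
  rcases hut.eq_or_lt with rfl | hlt
  · simpa using zero (Λ := Λ) (d := d) k p le_rfl
  have hfi := (intervalIntegrable_iff_integrableOn_Ioc_of_le hut).1 hf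
  have hgi := (intervalIntegrable_iff_integrableOn_Ioc_of_le hut).1 (hg.intervalIntegrable (μ := volume) u t)
  -- The average of a function with values in a closed convex set stays in the set; operator and
  -- strength are averaged jointly.
  have hav := (convex_locCone d k p).set_average_mem (f := fun s => (f s, g s)) (μ := volume)
    (t := Ioc u t) (isClosed_locCone d k p) (by simpa using hlt) (by simp)
    ((ae_restrict_iff' measurableSet_Ioc).2 (ae_of_all _ fun s hs => h s ⟨hs.1.le, hs.2⟩))
    (hfi.prodMk hgi)
  rw [setAverage_eq, integral_pair hfi hgi] at hav
  have h2 := Loc.smul hav (t - u)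
  have h3 : volume.real (Ioc u t) = t - u := by simp [hut]
  have h4 : t - u ≠ 0 := (sub_pos.2 hlt).ne'
  simp only [h3, Prod.smul_mk, smul_smul, mul_inv_cancel₀ h4, one_smul, smul_eq_mul] at h2
  rw [abs_of_pos (sub_pos.2 hlt), mul_inv_cancel_left₀ h4] at h2
  rwa [intervalIntegral.integral_of_le hut, intervalIntegral.integral_of_le hut]

theorem hasSum {f : ℕ → Op Λ d} {g : ℕ → ℝ} {A : Op Λ d} {a : ℝ} (hf : HasSum f A)
    (hg : HasSum g a) (h : ∀ m, Loc k p (g m) (f m)) : Loc k p a A := by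
  have h1 : Tendsto (fun s : Finset ℕ => ((∑ m ∈ s, f m), ∑ m ∈ s, g m)) atTop (𝓝 (A, a)) :=
    Tendsto.prodMk_nhds hf hg
  exact (isClosed_locCone d k p).mem_of_tendsto h1
    (Eventually.of_forall fun s => Loc.sum s fun m _ => h m)

end Loc

variable {K : ℝ → Op Λ d} {J T : ℝ}

/-- Each step adds an integral of length at most T and a commutator of total degree p + 2, hence the
factor (p + 2) · 2kJT. Estimating the recursion avoids summing absolute values over all
permutations, which would cost a further factorial. -/
theorem loc_nestIter (hK : LocBdd K) (hJ : ∀ s, Loc k 1 J (K s)) (hT : 0 ≤ T) {y : ℝ}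
    (hy : y ∈ Icc (0 : ℝ) 1) (p : ℕ) {s : ℝ} (hs : s ∈ Icc 0 T) :
    Loc k (p + 1) (J * (2 * k * J * T) ^ p * (p + 1).factorial) (nestIter K T y p s) := by
  have hJ0 : 0 ≤ J := (hJ 0).1
  induction p generalizing s with
  | zero => simpa [nestIter] using hJ s
  | succ p ih =>
    set b := J * (2 * k * J * T) ^ p * (p + 1).factorial
    have hb : 0 ≤ b := by positivity
    have hg := nestIter_locBdd hK T y p
    -- Splitting at s leaves weights 1 - y and -y on disjoint intervals, which yields T b instead of
    -- 2 T b.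
    have h1 : (1 - y) • (∫ r in (0 : ℝ)..T, nestIter K T y p r) -
        ∫ r in (0 : ℝ)..s, nestIter K T y p r =
        (1 - y) • (∫ r in s..T, nestIter K T y p r) + (-y) • ∫ r in (0 : ℝ)..s, nestIter K T y p r := by
      rw [← intervalIntegral.integral_add_adjacent_intervals
        (hg.intervalIntegrable le_rfl hs.1) (hg.intervalIntegrable hs.1 hT)]
      module
    have h2 : Loc k (p + 1) ((T - s) * b) (∫ r in s..T, nestIter K T y p r) := by
      simpa using Loc.integral hs.2 continuous_const fun r hr => ih ⟨hs.1.trans hr.1, hr.2⟩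
    have h3 : Loc k (p + 1) (s * b) (∫ r in (0 : ℝ)..s, nestIter K T y p r) := by
      simpa using Loc.integral hs.1 continuous_const fun r hr => ih ⟨hr.1, hr.2.trans hs.2⟩
    have h4 := (h2.smul (1 - y)).add (h3.smul (-y))
    rw [abs_neg, abs_of_nonneg hy.1, abs_of_nonneg (sub_nonneg.2 hy.2), ← h1] at h4
    have h5 : (1 - y) * ((T - s) * b) + y * (s * b) ≤ T * b := by
      have e1 : 0 ≤ (1 - y) * s := mul_nonneg (sub_nonneg.2 hy.2) hs.1
      have e2 : 0 ≤ y * (T - s) := mul_nonneg hy.1 (sub_nonneg.2 hs.2)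
      nlinarith [mul_nonneg e1 hb, mul_nonneg e2 hb]
    have h6 := (hJ s).adL (h4.mono h5)
    rw [add_comm 1 (p + 1)] at h6
    refine h6.mono (le_of_eq ?_)
    simp only [b, Nat.factorial_succ (p + 1)]
    push_cast
    ring

/-- The q commutators contribute (r + 1) ⋯ (r + q) and the time ordering contributes 1/q!, so only a
binomial coefficient remains and there is no factorial growth. -/
theorem loc_conjCoeff (hK : LocBdd K) (hJ : ∀ s, Loc k 1 J (K s)) (q : ℕ) {t : ℝ} (ht : 0 ≤ t)
    {Y : Op Λ d} {b : ℝ} (hY : Loc k r b Y) :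
    Loc k (r + q) (b * (2 * k * J * t) ^ q * ((r + q).factorial / (r.factorial * q.factorial)))
      (conjCoeff K q t Y) := by
  induction q generalizing r b Y t with
  | zero =>
    have : (r.factorial : ℝ) ≠ 0 := by positivity
    simpa [conjCoeff, volterra, this] using hY
  | succ q ih =>
    have h1 : conjCoeff K (q + 1) t Y = ∫ s in (0 : ℝ)..t, conjCoeff K q s (adL (K s) Y) := by
      have hL := (locBdd_mulRight_ad hK).clm_apply (volterra_locBdd (locBdd_mulRight_ad hK) 1 q)
      rw [conjCoeff, volterra, ContinuousLinearMap.intervalIntegral_apply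
        (hL.intervalIntegrable le_rfl ht)]
      rfl
    rw [h1]
    have h2 : ∀ s ∈ Icc 0 t, Loc k (r + (q + 1)) (2 * k * (1 + r : ℕ) * J * b *
        (2 * k * J * s) ^ q * ((1 + r + q).factorial / ((1 + r).factorial * q.factorial)))
        (conjCoeff K q s (adL (K s) Y)) := by
      intro s hs
      rw [show r + (q + 1) = 1 + r + q by ring]
      have := ih hs.1 ((hJ s).adL hY)
      simpa using this
    have h3 := Loc.integral ht (by fun_prop) h2
    refine h3.mono (le_of_eq ?_)
    have e1 : ∀ s : ℝ, 2 * k * (1 + r : ℕ) * J * b *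
        (2 * k * J * s) ^ q * ((1 + r + q).factorial / ((1 + r).factorial * q.factorial)) =
        (2 * k * (1 + r : ℕ) * J * b * (2 * k * J) ^ q *
          ((1 + r + q).factorial / ((1 + r).factorial * q.factorial))) * s ^ q := fun s => by
      rw [mul_pow _ s]; ring
    simp only [e1, intervalIntegral.integral_const_mul, integral_pow]
    rw [show r + (q + 1) = 1 + r + q by ring, Nat.add_comm 1 r, Nat.factorial_succ r,
      Nat.factorial_succ q]
    push_cast
    have : (r.factorial : ℝ) ≠ 0 := by positivity
    have : (q.factorial : ℝ) ≠ 0 := by positivity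
    field_simp
    ring

theorem loc_integral_conjCoeff (hK : LocBdd K) (hJ : ∀ s, Loc k 1 J (K s)) (hT : 0 ≤ T) (q : ℕ) :
    Loc k (q + 1) (J * T * (2 * k * J * T) ^ q) (∫ s in (0 : ℝ)..T, conjCoeff K q s (K s)) := by
  have h := Loc.integral hT (by fun_prop) fun s (hs : s ∈ Icc 0 T) => loc_conjCoeff hK hJ q hs.1 (hJ s)
  rw [add_comm 1 q] at h
  refine h.mono (le_of_eq ?_)
  have e1 : ∀ s : ℝ, J * (2 * k * J * s) ^ q *
      ((q + 1).factorial / ((Nat.factorial 1) * q.factorial)) =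
      (J * (2 * k * J) ^ q * (q + 1)) * s ^ q := fun s => by
    have : (q.factorial : ℝ) ≠ 0 := by positivity
    rw [mul_pow _ s, Nat.factorial_succ]
    push_cast
    field_simp
    simp
  simp only [e1, intervalIntegral.integral_const_mul, integral_pow]
  field_simp
  ring

theorem loc_magnusCoeff {H : ℝ → Op Λ d} (hH : BddMeas H) (hJ : ∀ s, Loc k 1 J (H s)) (hT : 0 < T)
    (p : ℕ) : Loc k (p + 1) (J * T * (2 * k * J * T) ^ p * p.factorial) (magnusCoeff H T p) := by
  have hK : BddMeas fun s => Complex.I • H s :=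
    ⟨hH.meas.fun_const_smul _, hH.bdd.imp fun c h t => by simpa [norm_smul] using h t⟩
  have hJ' : ∀ s, Loc k 1 J (Complex.I • H s) := fun s => by simpa using (hJ s).csmul Complex.I
  have h1 := Loc.integral (zero_le_one (α := ℝ)) continuous_const fun y hy =>
    Loc.integral hT.le continuous_const fun s hs =>
      loc_nestIter (T := T) hK.locBdd hJ' hT.le hy p hs
  rw [← magnusCoeff_eq hH hT p] at h1
  have h2 := h1.smul ((p : ℝ) + 1)⁻¹
  have hp : (p : ℝ) + 1 ≠ 0 := by positivity
  rw [smul_smul, inv_mul_cancel₀ hp, one_smul] at h2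
  refine h2.mono (le_of_eq ?_)
  rw [abs_of_pos (by positivity), Nat.factorial_succ]
  simp
  field_simp

end Cone

/-! ### Power series in ad X and coefficient comparison -/

section Series

variable {A : Type*} [NormedRing A] [NormedAlgebra ℝ A] [CompleteSpace A]

theorem hasSum_exp (z : A) :
    HasSum (fun m : ℕ => ((m.factorial : ℝ)⁻¹) • z ^ m) (NormedSpace.exp z) :=
  NormedSpace.exp_series_hasSum_exp' (𝕂 := ℝ) z

theorem hasSum_phi (z : A) :
    HasSum (fun m : ℕ => (((m + 1).factorial : ℝ)⁻¹) • z ^ m) (phi z) := by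
  have h := intervalIntegral.hasSum_integral_of_dominated_convergence (μ := volume) (a := 0) (b := 1)
    (F := fun (m : ℕ) (s : ℝ) => ((m.factorial : ℝ)⁻¹) • (s • z) ^ m)
    (f := fun s : ℝ => NormedSpace.exp (s • z))
    (fun m _ => (max 1 ‖(1 : A)‖) * (‖z‖ ^ m / m.factorial))
    (fun m => Continuous.aestronglyMeasurable (by fun_prop)) ?_ ?_ ?_ ?_
  · have e : ∀ m : ℕ, ∫ s in (0 : ℝ)..1, ((m.factorial : ℝ)⁻¹) • (s • z) ^ m =
        (((m + 1).factorial : ℝ)⁻¹) • z ^ m := fun m => by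
      simp only [smul_pow, smul_smul, intervalIntegral.integral_smul_const,
        intervalIntegral.integral_const_mul, integral_pow]
      congr 1
      rw [Nat.factorial_succ]
      push_cast
      field_simp
      simp
    simp only [e] at h
    exact h
  · refine fun m => ae_of_all _ fun s hs => ?_
    rw [uIoc_of_le zero_le_one] at hs
    rw [norm_smul, smul_pow, norm_smul, norm_inv, RCLike.norm_natCast, Real.norm_of_nonneg
      (pow_nonneg hs.1.le m)]
    have h1 : s ^ m ≤ 1 := pow_le_one₀ hs.1.le hs.2
    have h2 : ‖z ^ m‖ ≤ max 1 ‖(1 : A)‖ * ‖z‖ ^ m := by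
      rcases Nat.eq_zero_or_pos m with rfl | hm
      · simp
      · exact (norm_pow_le' z hm).trans (le_mul_of_one_le_left (by positivity) (le_max_left _ _))
    calc _ ≤ (m.factorial : ℝ)⁻¹ * (1 * (max 1 ‖(1 : A)‖ * ‖z‖ ^ m)) := by gcongr
      _ = _ := by ring
  · exact ae_of_all _ fun s _ => (Real.summable_pow_div_factorial _).mul_left _
  · exact intervalIntegrable_const
  · exact ae_of_all _ fun s _ => hasSum_exp (s • z)

/-- Substitute s ↦ 1 - s. In the frame of the exponential the defect then involves one series in ad
X per term. -/
theorem exp_neg_mul_phi (z : A) : NormedSpace.exp (-z) * phi z = phi (-z) := by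
  let _ := NormedAlgebra.restrictScalars ℚ ℝ A
  have h1 : NormedSpace.exp (-z) * phi z =
      ∫ s in (0 : ℝ)..1, NormedSpace.exp (-z) * NormedSpace.exp (s • z) :=
    (((ContinuousLinearMap.mul ℝ A) (NormedSpace.exp (-z))).intervalIntegral_comp_comm
      ((continuous_exp_smul z).intervalIntegrable _ _)).symm
  have h2 := intervalIntegral.integral_comp_sub_left (a := 0) (b := 1)
    (fun s : ℝ => NormedSpace.exp (s • -z)) 1
  rw [sub_self, sub_zero] at h2
  rw [h1, phi, ← h2]
  refine intervalIntegral.integral_congr fun s _ => ?_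
  rw [← NormedSpace.exp_add_of_commute ((Commute.refl z).neg_left.smul_right s)]
  congr 1
  module

/-- The coefficients of the commutator of two series. -/
noncomputable def adSeq (h S : ℕ → A) (j : ℕ) : A := ∑ q ∈ Finset.HasAntidiagonal.antidiagonal j, adL (h q.1) (S q.2)

theorem adSeq_smul_pow (h S : ℕ → A) (ε : ℝ) (j : ℕ) :
    adSeq (fun i => ε ^ i • h i) (fun i => ε ^ i • S i) j = ε ^ j • adSeq h S j := by
  simp only [adSeq, Finset.smul_sum]
  refine Finset.sum_congr rfl fun q hq => ?_
  rw [← Finset.HasAntidiagonal.mem_antidiagonal.1 hq, adL_apply, adL_apply, smul_mul_smul_comm, smul_mul_smul_comm,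
    smul_sub, pow_add, mul_comm (ε ^ q.2)]

theorem adSeq_hasSum {h S : ℕ → A} (hh : Summable fun j => ‖h j‖) (hS : Summable fun j => ‖S j‖) :
    HasSum (adSeq h S) (adL (∑' j, h j) (∑' j, S j)) ∧ Summable fun j => ‖adSeq h S j‖ := by
  have e : adSeq h S = fun j => (∑ q ∈ Finset.HasAntidiagonal.antidiagonal j, h q.1 * S q.2) -
      ∑ q ∈ Finset.HasAntidiagonal.antidiagonal j, S q.1 * h q.2 := by
    funext j
    have := Finset.Nat.sum_antidiagonal_swap (n := j) (f := fun q : ℕ × ℕ => S q.1 * h q.2)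
    simp only [Prod.fst_swap, Prod.snd_swap] at this
    rw [← this, ← Finset.sum_sub_distrib]
    rfl
  have s1 := summable_norm_sum_mul_antidiagonal_of_summable_norm hh hS
  have s2 := summable_norm_sum_mul_antidiagonal_of_summable_norm hS hh
  rw [e]
  refine ⟨?_, Summable.of_nonneg_of_le (fun _ => norm_nonneg _) (fun j => norm_sub_le _ _)
    (s1.add s2)⟩
  rw [adL_apply, tsum_mul_tsum_eq_tsum_sum_antidiagonal_of_summable_norm hh hS,
    tsum_mul_tsum_eq_tsum_sum_antidiagonal_of_summable_norm hS hh]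
  exact s1.of_norm.hasSum.sub s2.of_norm.hasSum

theorem adSeq_iterate_hasSum {h S : ℕ → A} (hh : Summable fun j => ‖h j‖)
    (hS : Summable fun j => ‖S j‖) (m : ℕ) :
    HasSum ((adSeq h)^[m] S) ((adL (∑' j, h j))^[m] (∑' j, S j)) ∧
      Summable fun j => ‖(adSeq h)^[m] S j‖ := by
  induction m with
  | zero => exact ⟨hS.of_norm.hasSum, hS⟩
  | succ m ih =>
    rw [Function.iterate_succ_apply', Function.iterate_succ_apply', ← ih.1.tsum_eq]
    exact adSeq_hasSum hh ih.2

theorem adSeq_iterate_smul_pow (h S : ℕ → A) (ε : ℝ) (m : ℕ) :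
    (adSeq fun i => ε ^ i • h i)^[m] (fun i => ε ^ i • S i) =
      fun j => ε ^ j • (adSeq h)^[m] S j := by
  induction m with
  | zero => rfl
  | succ m ih =>
    rw [Function.iterate_succ_apply', ih]
    funext j
    rw [adSeq_smul_pow, Function.iterate_succ_apply']

/-- A power series that vanishes to order `N` has no terms of degree below `N`. -/
theorem coeff_eq_zero_of_isBigO {E : Type*} [NormedAddCommGroup E] [NormedSpace ℝ E]
    {c : ℕ → E} (hc : Summable fun j => ‖c j‖) {f : ℝ → E}
    (hf : ∀ ε ∈ Ioc (0 : ℝ) 1, HasSum (fun j => ε ^ j • c j) (f ε)) {N : ℕ}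
    (hO : f =O[𝓝[>] 0] fun ε => ε ^ N) {j : ℕ} (hj : j < N) : c j = 0 := by
  induction j using Nat.strong_induction_on with
  | _ j ih =>
    set M := ∑' i, ‖c i‖
    have hM : ∀ i, ‖c i‖ ≤ M := fun i => hc.le_tsum i fun _ _ => norm_nonneg _
    obtain ⟨C, hC⟩ := hO.bound
    have h1 : ∀ᶠ ε : ℝ in 𝓝[>] 0, ‖c j‖ ≤ (|C| + M) * ε := by
      filter_upwards [hC, Ioo_mem_nhdsGT (zero_lt_one (α := ℝ))] with ε hε hε1
      have hs := hf ε ⟨hε1.1, hε1.2.le⟩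
      have hs1 := (hasSum_nat_add_iff' (j + 1)).2 hs
      have hz : ∑ i ∈ Finset.range (j + 1), ε ^ i • c i = ε ^ j • c j := by
        rw [Finset.sum_range_succ, Finset.sum_eq_zero fun i hi => ?_, zero_add]
        have hi' := Finset.mem_range.1 hi
        rw [ih i hi' (hi'.trans hj), smul_zero]
      rw [hz] at hs1
      have hb : ‖f ε - ε ^ j • c j‖ ≤ M * ε ^ (j + 1) := by
        have hsum : Summable fun i => ‖c (i + (j + 1))‖ * ε ^ (j + 1) :=
          ((summable_nat_add_iff (j + 1)).2 hc).mul_right _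
        refine (hs1.norm_le_of_bounded hsum.hasSum fun i => ?_).trans ?_
        · rw [norm_smul, Real.norm_of_nonneg (pow_nonneg hε1.1.le _), mul_comm, pow_add]
          gcongr
          exact mul_le_of_le_one_left (pow_nonneg hε1.1.le _) (pow_le_one₀ hε1.1.le hε1.2.le)
        · rw [tsum_mul_right]
          gcongr
          · exact pow_nonneg hε1.1.le _
          · simp only [M]
            rw [← hc.sum_add_tsum_nat_add (j + 1)]
            exact le_add_of_nonneg_left (Finset.sum_nonneg fun _ _ => norm_nonneg _)
      have hN : ‖f ε‖ ≤ |C| * ε ^ (j + 1) := by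
        refine hε.trans ?_
        rw [Real.norm_of_nonneg (pow_nonneg hε1.1.le _)]
        exact mul_le_mul (le_abs_self C) (pow_le_pow_of_le_one hε1.1.le hε1.2.le hj)
          (pow_nonneg hε1.1.le _) (abs_nonneg _)
      have h2 : ε ^ j * ‖c j‖ ≤ ε ^ j * ((|C| + M) * ε) := by
        calc ε ^ j * ‖c j‖ = ‖f ε - (f ε - ε ^ j • c j)‖ := by
              rw [sub_sub_cancel, norm_smul, Real.norm_of_nonneg (pow_nonneg hε1.1.le _)]
          _ ≤ |C| * ε ^ (j + 1) + M * ε ^ (j + 1) := (norm_sub_le _ _).trans (add_le_add hN hb)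
          _ = _ := by ring
      exact le_of_mul_le_mul_left h2 (pow_pos hε1.1 j)
    have h2 : Tendsto (fun ε : ℝ => (|C| + M) * ε) (𝓝[>] 0) (𝓝 0) := by
      have : Tendsto (fun ε : ℝ => (|C| + M) * ε) (𝓝 0) (𝓝 ((|C| + M) * 0)) :=
        (continuous_const.mul continuous_id).tendsto 0
      rw [mul_zero] at this
      exact this.mono_left nhdsWithin_le_nhds
    exact norm_le_zero_iff.1 (ge_of_tendsto h2 h1)

end Series

/-! ### Locality of graded series of commutators -/

section LocalSeries

variable {Λ : Type*} [Fintype Λ] [DecidableEq Λ] {d k : ℕ} {h S : ℕ → Op Λ d} {cc : ℕ → ℝ}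
  {c M : ℝ}

/-- The degree counts sites: every commutator contributing to degree j acts on at most jk sites, so
it costs at most 2kj times the strength of h. The weights 4^i in the hypothesis compensate the decay
4^(-j) lost when part of the degree is carried by h. -/
theorem loc_adSeq_iterate (hh : ∀ i, Loc k i (cc i) (h i))
    (hS : ∀ j, Loc k j (M * (1 / 4) ^ j) (S j))
    (hc : ∀ j, ∑ i ∈ Finset.range (j + 1), cc i * 4 ^ i ≤ c) (m j : ℕ) :
    Loc k j ((2 * k * j * c) ^ m * (M * (1 / 4) ^ j)) ((adSeq h)^[m] S j) := by
  have hc0 : 0 ≤ c := (Finset.sum_nonneg fun i _ => mul_nonneg (hh i).1 (by positivity)).trans (hc 0)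
  have hM : 0 ≤ M := by simpa using (hS 0).1
  induction m generalizing j with
  | zero => simpa using hS j
  | succ m ih =>
    rw [Function.iterate_succ_apply', adSeq]
    have h1 : ∀ q ∈ Finset.HasAntidiagonal.antidiagonal j, Loc k j
        ((2 * k * j) * (2 * k * j * c) ^ m * (M * (1 / 4) ^ j) * (cc q.1 * 4 ^ q.1))
        (adL (h q.1) ((adSeq h)^[m] S q.2)) := by
      intro q hq
      have hq' := Finset.HasAntidiagonal.mem_antidiagonal.1 hq
      have h2 := (hh q.1).adL (ih q.2)
      rw [← Nat.cast_add, hq'] at h2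
      refine h2.mono ?_
      have h3 : (q.2 : ℝ) ≤ j := by exact_mod_cast hq' ▸ Nat.le_add_left _ _
      have h4 : (1 / 4 : ℝ) ^ q.2 = (1 / 4) ^ j * 4 ^ q.1 := by
        rw [← hq', pow_add, mul_comm ((1 / 4 : ℝ) ^ q.1), mul_assoc, ← mul_pow]
        norm_num
      rw [h4]
      have := (hh q.1).1
      calc 2 * k * j * cc q.1 * ((2 * k * q.2 * c) ^ m * (M * ((1 / 4) ^ j * 4 ^ q.1)))
          ≤ 2 * k * j * cc q.1 * ((2 * k * j * c) ^ m * (M * ((1 / 4) ^ j * 4 ^ q.1))) := by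
            gcongr
        _ = _ := by ring
    refine (Loc.sum _ h1).mono ?_
    rw [← Finset.mul_sum, Finset.Nat.sum_antidiagonal_eq_sum_range_succ_mk]
    calc _ ≤ (2 * k * j) * (2 * k * j * c) ^ m * (M * (1 / 4) ^ j) * c := by
          gcongr
          exact hc j
      _ = _ := by ring

/-- The coefficients of `∑_m w_m ad_X^m S`. -/
noncomputable def adSum (w : ℕ → ℝ) (h S : ℕ → Op Λ d) (j : ℕ) : Op Λ d :=
  ∑' m, w m • (adSeq h)^[m] S j

theorem adSum_bound (hh : ∀ i, Loc k i (cc i) (h i)) (hS : ∀ j, Loc k j (M * (1 / 4) ^ j) (S j))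
    (hc : ∀ j, ∑ i ∈ Finset.range (j + 1), cc i * 4 ^ i ≤ c) {w : ℕ → ℝ}
    (hw : ∀ m : ℕ, |w m| ≤ (m.factorial : ℝ)⁻¹) (m j : ℕ) :
    Loc k j ((2 * k * j * c) ^ m / m.factorial * (M * (1 / 4) ^ j))
      (w m • (adSeq h)^[m] S j) := by
  have h1 := loc_adSeq_iterate hh hS hc m j
  refine (h1.smul (w m)).mono ((mul_le_mul_of_nonneg_right (hw m) h1.1).trans_eq ?_)
  ring

theorem hasSum_adSum_bound (k j : ℕ) (c M : ℝ) :
    HasSum (fun m : ℕ => (2 * k * j * c) ^ m / m.factorial * (M * (1 / 4) ^ j))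
      (M * (Real.exp (2 * k * c) / 4) ^ j) := by
  have h := (hasSum_exp (2 * k * j * c : ℝ)).mul_right (M * (1 / 4) ^ j)
  rw [← Real.exp_eq_exp_ℝ] at h
  have e : M * (Real.exp (2 * k * c) / 4) ^ j = Real.exp (2 * k * j * c) * (M * (1 / 4) ^ j) := by
    rw [show (2 * k * j * c : ℝ) = j * (2 * k * c) by ring, Real.exp_nat_mul, div_pow, one_div,
      inv_pow]
    ring
  rw [e]
  refine h.congr_fun fun m => ?_
  rw [smul_eq_mul]
  ring

/-- Summing (2kjc)^m / m! over m gives (e^(2kc))^j ≤ 2^j: in fixed degree the series in ad X only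
weakens the decay from 4^(-j) to 2^(-j). -/
theorem loc_adSum (hh : ∀ i, Loc k i (cc i) (h i)) (hS : ∀ j, Loc k j (M * (1 / 4) ^ j) (S j))
    (hc : ∀ j, ∑ i ∈ Finset.range (j + 1), cc i * 4 ^ i ≤ c) (hexp : Real.exp (2 * k * c) ≤ 2)
    {w : ℕ → ℝ} (hw : ∀ m : ℕ, |w m| ≤ (m.factorial : ℝ)⁻¹) (j : ℕ) :
    Loc k j (M * (1 / 2) ^ j) (adSum w h S j) := by
  have hM : 0 ≤ M := by simpa using (hS 0).1
  have h1 := adSum_bound hh hS hc hw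
  have h2 := hasSum_adSum_bound k j c M
  have h3 : Summable fun m => w m • (adSeq h)^[m] S j :=
    Summable.of_norm_bounded (h2.summable.mul_left (Fintype.card Λ : ℝ)) fun m => (h1 m j).norm_le
  refine (Loc.hasSum h3.hasSum h2 fun m => h1 m j).mono ?_
  refine mul_le_mul_of_nonneg_left (pow_le_pow_left₀ (by positivity) ?_ j) hM
  linarith

/-- Absolute summability over the pairs (j, m) justifies exchanging the expansion in ε with the
series in ad X. -/
theorem hasSum_adSum (hh : ∀ i, Loc k i (cc i) (h i)) (hS : ∀ j, Loc k j (M * (1 / 4) ^ j) (S j))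
    (hc : ∀ j, ∑ i ∈ Finset.range (j + 1), cc i * 4 ^ i ≤ c) (hexp : Real.exp (2 * k * c) ≤ 2)
    {w : ℕ → ℝ} (hw : ∀ m : ℕ, |w m| ≤ (m.factorial : ℝ)⁻¹) (hsum : Summable fun j => ‖h j‖)
    {ε : ℝ} (hε : ε ∈ Icc (0 : ℝ) 1) {X Y Z : Op Λ d} (hX : HasSum (fun j => ε ^ j • h j) X)
    (hY : HasSum (fun j => ε ^ j • S j) Y) (hZ : HasSum (fun m => w m • (adL X)^[m] Y) Z) :
    HasSum (fun j => ε ^ j • adSum w h S j) Z := by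
  have hM : 0 ≤ M := by simpa using (hS 0).1
  have hε' : ∀ j : ℕ, ‖ε ^ j‖ ≤ 1 := fun j => by
    rw [Real.norm_of_nonneg (pow_nonneg hε.1 _)]
    exact pow_le_one₀ hε.1 hε.2
  have h1 := adSum_bound hh hS hc hw
  have h2 := fun j => hasSum_adSum_bound k j c M
  set F : ℕ × ℕ → Op Λ d := fun q => ε ^ q.1 • w q.2 • (adSeq h)^[q.2] S q.1 with hF
  set b : ℕ × ℕ → ℝ := fun q =>
    Fintype.card Λ * ((2 * k * q.1 * c) ^ q.2 / q.2.factorial * (M * (1 / 4) ^ q.1)) with hb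
  have hb0 : 0 ≤ b := fun q => mul_nonneg (Nat.cast_nonneg _) (h1 q.2 q.1).1
  have hbs : Summable b := by
    refine (summable_prod_of_nonneg hb0).2 ⟨fun j => (h2 j).summable.mul_left _, ?_⟩
    have : (fun j => ∑' m, b (j, m)) =
        fun j => Fintype.card Λ * (M * (Real.exp (2 * k * c) / 4) ^ j) :=
      funext fun j => ((h2 j).mul_left _).tsum_eq
    rw [this]
    refine ((summable_geometric_of_lt_one (by positivity) ?_).mul_left M).mul_left _
    linarith
  have hFs : Summable F := Summable.of_norm_bounded hbs fun q => by
    rw [hF, norm_smul]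
    exact (mul_le_of_le_one_left (norm_nonneg _) (hε' _)).trans (h1 q.2 q.1).norm_le
  have h3 : HasSum (fun j => ε ^ j • adSum w h S j) (∑' q, F q) := by
    refine hFs.hasSum.prod_fiberwise fun j => ?_
    refine HasSum.const_smul (ε ^ j) (Summable.hasSum ?_)
    exact Summable.of_norm_bounded ((h2 j).summable.mul_left (Fintype.card Λ : ℝ))
      fun m => (h1 m j).norm_le
  have hSn : Summable fun j => ‖S j‖ := by
    refine Summable.of_nonneg_of_le (fun _ => norm_nonneg _) (fun j => (hS j).norm_le) ?_
    exact ((summable_geometric_of_lt_one (by norm_num) (by norm_num)).mul_left M).mul_left _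
  have hsc : ∀ g : ℕ → Op Λ d, (Summable fun j => ‖g j‖) → Summable fun j => ‖ε ^ j • g j‖ :=
    fun g hg => Summable.of_nonneg_of_le (fun _ => norm_nonneg _) (fun j => by
      rw [norm_smul]
      exact mul_le_of_le_one_left (norm_nonneg _) (hε' _)) hg
  have h4 : HasSum (fun m => w m • (adL X)^[m] Y) (∑' q, F q) := by
    have hsw : HasSum (F ∘ Prod.swap) (∑' q, F q) := (Equiv.prodComm ℕ ℕ).hasSum_iff.2 hFs.hasSum
    refine hsw.prod_fiberwise fun m => ?_
    have h5 := (adSeq_iterate_hasSum (hsc h hsum) (hsc S hSn) m).1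
    rw [adSeq_iterate_smul_pow, hX.tsum_eq, hY.tsum_eq] at h5
    exact (h5.const_smul (w m)).congr_fun fun j => smul_comm _ _ _
  rwa [hZ.unique h4]

end LocalSeries

/-! ### Expansion of the defect and the interpolation between the evolutions -/

section CoefficientSequences

variable {A : Type*} [NormedRing A] [NormedAlgebra ℝ A] [CompleteSpace A]

/-- The coefficient sequence of a polynomial or series without constant term. -/
def coeffSeq (x : ℕ → A) : ℕ → A
  | 0 => 0
  | p + 1 => x p

/-- The first `N` terms of a sequence. -/
def cutoff (x : ℕ → A) (N p : ℕ) : A := if p < N then x p else 0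

theorem hasSum_coeffSeq {x : ℕ → A} {ε : ℝ} {X : A} (h : HasSum (fun p => ε ^ p • x p) X) :
    HasSum (fun j => ε ^ j • coeffSeq x j) (ε • X) := by
  rw [← hasSum_nat_add_iff' 1]
  simp only [Finset.range_one, Finset.sum_singleton, coeffSeq, smul_zero, sub_zero]
  exact (h.const_smul ε).congr_fun fun p => by rw [smul_smul, pow_succ']

theorem hasSum_cutoff (x : ℕ → A) (N : ℕ) (ε : ℝ) :
    HasSum (fun p => ε ^ p • cutoff x N p) (∑ p ∈ Finset.range N, ε ^ p • x p) := by
  have h : HasSum (fun p => ε ^ p • cutoff x N p) (∑ p ∈ Finset.range N, ε ^ p • cutoff x N p) :=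
    hasSum_sum_of_ne_finset_zero fun p hp => by
      rw [cutoff, if_neg (by simpa using hp), smul_zero]
  rwa [Finset.sum_congr rfl fun p hp => by rw [cutoff, if_pos (Finset.mem_range.1 hp)]] at h

theorem hasSum_expoPoly (x : ℕ → A) (N : ℕ) (ε : ℝ) :
    HasSum (fun j => ε ^ j • coeffSeq (cutoff x N) j) (expoPoly x N ε) := by
  have h := hasSum_coeffSeq (hasSum_cutoff x N ε)
  rwa [Finset.smul_sum, Finset.sum_congr rfl fun p _ => by rw [smul_smul, ← pow_succ']] at h

theorem hasSum_smul_expoPolyDeriv (x : ℕ → A) (N : ℕ) (ε : ℝ) :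
    HasSum (fun j => ε ^ j • coeffSeq (cutoff (fun p => ((p : ℝ) + 1) • x p) N) j)
      (ε • expoPolyDeriv x N ε) := by
  rw [smul_expoPolyDeriv]
  exact hasSum_expoPoly _ N ε

theorem summable_norm_coeffSeq_cutoff (x : ℕ → A) (N : ℕ) :
    Summable fun j => ‖coeffSeq (cutoff x N) j‖ := by
  refine summable_of_ne_finset_zero (s := Finset.range (N + 1)) fun j hj => ?_
  cases j with
  | zero => simp [coeffSeq]
  | succ p =>
    have : ¬p < N := by simpa using hj
    simp [coeffSeq, cutoff, this]

theorem neg_clm_pow_apply (L : A →L[ℝ] A) (m : ℕ) (y : A) :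
    ((-L) ^ m) y = (-1 : ℝ) ^ m • L^[m] y := by
  induction m with
  | zero => simp
  | succ m ih =>
    rw [pow_succ', mul_apply_eq_comp, ih, Function.iterate_succ_apply', neg_apply, map_smul,
      pow_succ', neg_one_mul, neg_smul]

theorem hasSum_exp_neg_apply (L : A →L[ℝ] A) (y : A) :
    HasSum (fun m : ℕ => ((-1 : ℝ) ^ m / m.factorial) • L^[m] y) (NormedSpace.exp (-L) y) := by
  have h := (ContinuousLinearMap.apply ℝ A y).hasSum (hasSum_exp (-L))
  refine h.congr_fun fun m => ?_
  rw [ContinuousLinearMap.apply_apply, smul_apply, neg_clm_pow_apply, smul_smul]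
  congr 1
  ring

theorem hasSum_phi_neg_apply (L : A →L[ℝ] A) (y : A) :
    HasSum (fun m : ℕ => ((-1 : ℝ) ^ m / (m + 1).factorial) • L^[m] y) (phi (-L) y) := by
  have h := (ContinuousLinearMap.apply ℝ A y).hasSum (hasSum_phi (-L))
  refine h.congr_fun fun m => ?_
  rw [ContinuousLinearMap.apply_apply, smul_apply, neg_clm_pow_apply, smul_smul]
  congr 1
  ring

theorem leftProp_eps_zero {K : ℝ → A} (hK : LocBdd K) {t : ℝ} (ht : 0 ≤ t) :
    leftProp K 0 t = 1 := by
  rw [((leftProp_isPrimitive hK 0).congr_deriv (φ' := fun _ => 0)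
    fun s => zero_smul ℝ _).eq_of_deriv_eq_zero ht, leftProp_zero]

theorem rightProp_eps_zero {K : ℝ → A} (hK : LocBdd K) {t : ℝ} (ht : 0 ≤ t) :
    rightProp K 0 t = 1 := by
  rw [((rightProp_isPrimitive hK 0).congr_deriv (φ' := fun _ => 0)
    fun s => zero_smul ℝ _).eq_of_deriv_eq_zero ht, rightProp_zero]

/-- The defect `w⁻¹ (β̃ - β) w` of the generators in the frame of the exponential. -/
noncomputable def genDefect (K : ℝ → A) (T : ℝ) (x : ℕ → A) (N : ℕ) (ε : ℝ) : A :=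
  NormedSpace.exp (-adL (expoPoly x N ε))
    (phi (adL (expoPoly x N ε)) (expoPolyDeriv x N ε) - scaleGen K T ε)

theorem genDefect_eq (K : ℝ → A) (T : ℝ) (x : ℕ → A) (N : ℕ) (ε : ℝ) :
    genDefect K T x N ε = NormedSpace.exp (-expoPoly x N ε) *
      ((phi (adL (expoPoly x N ε)) (expoPolyDeriv x N ε) - scaleGen K T ε) *
        NormedSpace.exp (expoPoly x N ε)) := by
  have h := exp_mul_exp_neg_eq_exp_adL (-expoPoly x N ε)
    (phi (adL (expoPoly x N ε)) (expoPolyDeriv x N ε) - scaleGen K T ε)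
  rw [neg_neg, map_neg] at h
  exact h.symm

theorem smul_genDefect (K : ℝ → A) (T : ℝ) (x : ℕ → A) (N : ℕ) (ε : ℝ) :
    ε • genDefect K T x N ε = phi (-adL (expoPoly x N ε)) (ε • expoPolyDeriv x N ε) -
      NormedSpace.exp (-adL (expoPoly x N ε)) (ε • scaleGen K T ε) := by
  rw [genDefect, map_sub, smul_sub, map_smul, map_smul, ← exp_neg_mul_phi, mul_apply_eq_comp]

/-- The two generators enter with opposite signs, from u and from e^X. Moving their difference
through e^X leaves a commutator with O itself, which has not been evolved and is still supported on
its original region. -/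
theorem hasDerivAt_interpolation {K : ℝ → A} (hK : LocBdd K) {T : ℝ} (hT : 0 ≤ T) (x : ℕ → A)
    (N : ℕ) (O : A) (ε : ℝ) :
    HasDerivAt (fun e => leftProp K e T * NormedSpace.exp (expoPoly x N e) * O *
        (NormedSpace.exp (-expoPoly x N e) * rightProp K e T))
      (leftProp K ε T * NormedSpace.exp (expoPoly x N ε) * adL (genDefect K T x N ε) O *
        (NormedSpace.exp (-expoPoly x N ε) * rightProp K ε T)) ε := by
  have h1 := (hasDerivAt_leftProp hK hT ε).fun_mul (hasDerivAt_exp_comp (hasDerivAt_expoPoly x N ε))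
  have h2 := (hasDerivAt_exp_neg_comp (hasDerivAt_expoPoly x N ε)).fun_mul
    (hasDerivAt_rightProp hK hT ε)
  refine ((h1.mul_const O).fun_mul h2).congr_deriv ?_
  rw [genDefect_eq]
  set u := leftProp K ε T
  set v := rightProp K ε T
  set w := NormedSpace.exp (expoPoly x N ε)
  set w' := NormedSpace.exp (-expoPoly x N ε)
  set b := phi (adL (expoPoly x N ε)) (expoPolyDeriv x N ε)
  set g := scaleGen K T ε
  have hw : w * w' = 1 := exp_mul_exp_neg _
  have e1 : u * w * (w' * ((b - g) * w)) = u * (b - g) * w := by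
    rw [mul_assoc, ← mul_assoc w, hw, one_mul, mul_assoc]
  have e2 : w' * ((b - g) * w) * (w' * v) = w' * (b - g) * v := by
    rw [mul_assoc, mul_assoc, ← mul_assoc w, hw, one_mul, mul_assoc]
  calc _ = (u * (b - g) * w) * O * (w' * v) - u * w * O * (w' * (b - g) * v) := by
        noncomm_ring
    _ = _ := by
        rw [← e1, ← e2, adL_apply]
        noncomm_ring

end CoefficientSequences

/-! ### The exponentially small error over one period -/

section OnePeriod

variable {Λ : Type*} [Fintype Λ] [DecidableEq Λ] {d k : ℕ}

theorem norm_unitary_mul_mul {U V : Op Λ d} (hU : U ∈ unitary (Op Λ d)) (hV : V ∈ unitary (Op Λ d))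
    (Y : Op Λ d) : ‖U * Y * V‖ = ‖Y‖ := by
  rw [CStarRing.norm_mul_mem_unitary _ hV, CStarRing.norm_mem_unitary_mul _ hU]

/-- With `norm_propagator_conj_sub_le`, this covers truncation order 0, where both evolutions are
merely compared with the identity. -/
theorem norm_exp_conj_sub_le {x : Op Λ d} (hx : xᴴ = -x) (O : Op Λ d) :
    ‖NormedSpace.exp x * O * NormedSpace.exp (-x) - O‖ ≤ ‖adL x O‖ := by
  have h1 : ∀ s : ℝ, HasDerivAt (fun s : ℝ => NormedSpace.exp (s • adL x) O)
      (NormedSpace.exp (s • adL x) (adL x O)) s := fun s => by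
    have := (hasDerivAt_exp_smul_const (𝕂 := ℝ) (adL x) s)
    have h2 := ((ContinuousLinearMap.apply ℝ (Op Λ d) O).hasFDerivAt.comp_hasDerivAt s this)
    exact h2
  have h2 : ∀ (s : ℝ) (Y : Op Λ d), ‖NormedSpace.exp (s • adL x) Y‖ = ‖Y‖ := fun s Y => by
    have hs : (s • x)ᴴ = -(s • x) := by
      rw [Matrix.conjTranspose_smul, hx, star_trivial, smul_neg]
    have hs' : (-(s • x))ᴴ = - -(s • x) := by rw [Matrix.conjTranspose_neg, hs]
    rw [← map_smul, ← exp_mul_exp_neg_eq_exp_adL, ← mul_assoc]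
    exact norm_unitary_mul_mul (exp_mem_unitary hs) (exp_mem_unitary hs') Y
  have h3 := norm_image_sub_le_of_norm_deriv_le_segment_01' (f := fun s : ℝ =>
    NormedSpace.exp (s • adL x) O) (C := ‖adL x O‖) (fun s _ => (h1 s).hasDerivWithinAt)
    fun s _ => (h2 s _).le
  rw [one_smul, zero_smul ℝ (adL x), NormedSpace.exp_zero, ← exp_mul_exp_neg_eq_exp_adL,
    one_apply_eq_self, ← mul_assoc] at h3
  exact h3

theorem norm_propagator_conj_sub_le {K : ℝ → Op Λ d} (hK : LocBdd K) (hs : ∀ t, (K t)ᴴ = -K t)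
    {T : ℝ} (hT : 0 ≤ T) (O : Op Λ d) {c : ℝ} (hc : ∀ t, ‖adL (K t) O‖ ≤ c) :
    ‖rightProp K 1 T * O * leftProp K 1 T - O‖ ≤ c * T := by
  have h1 := ((conjProp_isPrimitive hK 1).clm_comp
    (ContinuousLinearMap.apply ℝ (Op Λ d) O)).eq_add_integral hT
  simp only [ContinuousLinearMap.apply_apply, conjProp_zero, one_apply_eq_self,
    one_smul] at h1
  rw [mul_assoc, ← conjProp_eq hK 1 hT, h1, add_sub_cancel_left]
  refine (intervalIntegral.norm_integral_le_of_norm_le_const (C := c) fun s hs' => ?_).trans_eq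
    (by rw [sub_zero, abs_of_nonneg hT])
  rw [uIoc_of_le hT] at hs'
  change ‖conjProp K 1 s (adL (K s) O)‖ ≤ c
  rw [conjProp_eq hK 1 hs'.1.le, ← mul_assoc, norm_unitary_mul_mul
    (rightProp_mem_unitary hK hs 1 hs'.1.le) (leftProp_mem_unitary hK hs 1 hs'.1.le)]
  exact hc s

/-- The role of the truncation order: up to p = n the factorial is at most n^p and is absorbed by
the small parameter. Beyond that order the divergence of the expansion is no longer controlled. -/
theorem pow_mul_factorial_le {μ : ℝ} (hμ : 0 ≤ μ) {n : ℕ} (h : 16 * n * μ ≤ 1) {p : ℕ}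
    (hp : p ≤ n) : μ ^ p * p.factorial ≤ (1 / 16) ^ p := by
  calc μ ^ p * p.factorial ≤ μ ^ p * (n : ℝ) ^ p := by
        gcongr
        exact_mod_cast (Nat.factorial_le_pow p).trans (Nat.pow_le_pow_left hp p)
    _ = (μ * n) ^ p := (mul_pow _ _ _).symm
    _ ≤ _ := by
        refine pow_le_pow_left₀ (by positivity) ?_ p
        linarith

theorem add_one_mul_pow_le (p : ℕ) : ((p : ℝ) + 1) * (1 / 16) ^ p ≤ (1 / 4) ^ p := by
  have h : (p : ℝ) + 1 ≤ 4 ^ p := by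
    exact_mod_cast (Nat.lt_pow_self (n := p) (a := 4) (by norm_num))
  calc ((p : ℝ) + 1) * (1 / 16) ^ p ≤ 4 ^ p * (1 / 16) ^ p := by gcongr
    _ = _ := by rw [← mul_pow]; norm_num

variable {H : ℝ → Op Λ d} {J T : ℝ}

/-- The coefficients of ε times the defect decay like 2^(-j) and vanish for j < n + 2. The
commutators of the remaining ones with O sum to a geometric tail. -/
theorem norm_adL_genDefect_le (hH : BddMeas H) (hJ : ∀ s, Loc k 1 J (H s))
    (hT : 0 < T) {n : ℕ} (hn : 0 < n) (hμ : 16 * n * (2 * k * J * T) ≤ 1) {X : Finset Λ}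
    {O : Op Λ d} (hO : SupportedOn X O) {ε : ℝ} (hε : ε ∈ Ioc (0 : ℝ) 1) :
    ‖adL (genDefect (fun s => Complex.I • H s) T (magnusCoeff H T) (n + 1) ε) O‖ ≤
      8 * J * T * X.card * (1 / 2) ^ n * ‖O‖ := by
  set K : ℝ → Op Λ d := fun s => Complex.I • H s with hKdef
  set x := magnusCoeff H T
  set N := n + 1
  have hJ0 : 0 ≤ J := (hJ 0).1
  have hK : LocBdd K := BddMeas.locBdd ⟨hH.meas.fun_const_smul _, hH.bdd.imp fun c h t => by
    simpa [norm_smul, hKdef] using h t⟩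
  have hKJ : ∀ s, Loc k 1 J (K s) := fun s => by simpa using (hJ s).csmul Complex.I
  set μ := 2 * k * J * T
  have hμ0 : 0 ≤ μ := by positivity
  have hμ16 : μ ≤ 1 / 16 := by
    have : (1 : ℝ) ≤ n := by exact_mod_cast hn
    nlinarith
  set h := coeffSeq (cutoff x N)
  set S₁ := coeffSeq (cutoff (fun p => ((p : ℝ) + 1) • x p) N)
  set S₂ := coeffSeq fun q => ∫ s in (0 : ℝ)..T, conjCoeff K q s (K s)
  set cc : ℕ → ℝ := fun j => if j = 0 then 0 else J * T * (1 / 16) ^ (j - 1)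
  have hx : ∀ p < N, Loc k (p + 1) (J * T * (1 / 16) ^ p) (x p) := fun p hp => by
    refine (loc_magnusCoeff hH hJ hT p).mono ?_
    rw [mul_assoc]
    exact mul_le_mul_of_nonneg_left (pow_mul_factorial_le hμ0 hμ (Nat.lt_succ_iff.1 hp))
      (by positivity)
  have hh : ∀ j, Loc k j (cc j) (h j) := fun j => by
    cases j with
    | zero => exact Loc.zero _ _ (by simp [cc])
    | succ p =>
      simp only [h, coeffSeq, cutoff, cc, Nat.succ_ne_zero, if_false, Nat.add_sub_cancel]
      split_ifs with hp
      · exact hx p hp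
      · exact Loc.zero _ _ (by positivity)
  have hS₁ : ∀ j, Loc k j (4 * J * T * (1 / 4) ^ j) (S₁ j) := fun j => by
    cases j with
    | zero => exact Loc.zero _ _ (by positivity)
    | succ p =>
      simp only [S₁, coeffSeq, cutoff]
      split_ifs with hp
      · refine ((hx p hp).smul _).mono ?_
        rw [abs_of_pos (by positivity)]
        calc _ = J * T * (((p : ℝ) + 1) * (1 / 16) ^ p) := by ring
          _ ≤ J * T * (1 / 4) ^ p := by gcongr; exact add_one_mul_pow_le p
          _ = _ := by ring
      · exact Loc.zero _ _ (by positivity)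
  have hS₂ : ∀ j, Loc k j (4 * J * T * (1 / 4) ^ j) (S₂ j) := fun j => by
    cases j with
    | zero => exact Loc.zero _ _ (by positivity)
    | succ q =>
      refine (loc_integral_conjCoeff hK hKJ hT.le q).mono ?_
      calc _ ≤ J * T * (1 / 4) ^ q := by gcongr; linarith
        _ = _ := by ring
  -- In degree i + 1 the strength JT 16^(-i) times 4^(i+1) is 4JT 4^(-i), and the geometric series
  -- contributes 4/3.
  have hc : ∀ j, ∑ i ∈ Finset.range (j + 1), cc i * 4 ^ i ≤ 16 / 3 * (J * T) := fun j => by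
    rw [Finset.sum_range_succ']
    simp only [cc, Nat.succ_ne_zero, if_false, Nat.add_sub_cancel, if_true, zero_mul, add_zero]
    have e : ∀ i ∈ Finset.range j, J * T * (1 / 16) ^ i * 4 ^ (i + 1) =
        4 * (J * T) * (1 / 4 : ℝ) ^ i := fun i _ => by
      rw [pow_succ, show (1 / 16 : ℝ) = 1 / 4 * (1 / 4) by norm_num, mul_pow]
      have : (1 / 4 : ℝ) ^ i * 4 ^ i = 1 := by rw [← mul_pow]; norm_num
      linear_combination (4 * J * T * (1 / 4) ^ i) * this
    rw [Finset.sum_congr rfl e, ← Finset.mul_sum]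
    have hg : ∑ i ∈ Finset.range j, (1 / 4 : ℝ) ^ i ≤ 4 / 3 := by
      have := (summable_geometric_of_lt_one (r := (1 / 4 : ℝ)) (by norm_num)
        (by norm_num)).sum_le_tsum (Finset.range j) fun _ _ => by positivity
      rw [tsum_geometric_of_lt_one (by norm_num) (by norm_num)] at this
      norm_num at this ⊢
      exact this
    calc _ ≤ 4 * (J * T) * (4 / 3) := by gcongr
      _ = _ := by ring
  -- The exponent is 16/3 · 2kJT ≤ 1/3, and e^(1/3) ≤ 3/2 follows from e^(-1/3) ≥ 2/3.
  have hexp : Real.exp (2 * k * (16 / 3 * (J * T))) ≤ 2 := by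
    have e1 : 2 * k * (16 / 3 * (J * T)) ≤ 1 / 3 := by
      have : 2 * k * (16 / 3 * (J * T)) = 16 / 3 * μ := by simp only [μ]; ring
      linarith
    have e2 : 1 - 1 / 3 ≤ Real.exp (-(1 / 3)) := by linarith [Real.add_one_le_exp (-(1 / 3) : ℝ)]
    have e3 : Real.exp (1 / 3) * Real.exp (-(1 / 3)) = 1 := by rw [← Real.exp_add]; simp
    have e4 := Real.exp_le_exp.2 e1
    nlinarith [Real.exp_pos (1 / 3)]
  set w₁ : ℕ → ℝ := fun m => (-1) ^ m / (m + 1).factorial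
  set w₂ : ℕ → ℝ := fun m => (-1) ^ m / m.factorial
  have hw₁ : ∀ m : ℕ, |w₁ m| ≤ (m.factorial : ℝ)⁻¹ := fun m => by
    simp only [w₁, abs_div, abs_pow, abs_neg, abs_one, one_pow, Nat.abs_cast, one_div]
    gcongr
    exact Nat.le_succ m
  have hw₂ : ∀ m : ℕ, |w₂ m| ≤ (m.factorial : ℝ)⁻¹ := fun m => by
    simp [w₂, abs_div]
  set κ : ℕ → Op Λ d := fun j => adSum w₁ h S₁ j - adSum w₂ h S₂ j
  have hκ : ∀ j, Loc k j (8 * J * T * (1 / 2) ^ j) (κ j) := fun j => by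
    have := (loc_adSum hh hS₁ hc hexp hw₁ j).add ((loc_adSum hh hS₂ hc hexp hw₂ j).smul (-1))
    have h' := this.mono (b := 8 * J * T * (1 / 2) ^ j) (by rw [abs_neg, abs_one]; linarith)
    rwa [neg_one_smul, ← sub_eq_add_neg] at h'
  have hsum : Summable fun j => ‖h j‖ := summable_norm_coeffSeq_cutoff x N
  have hκs : ∀ e ∈ Ioc (0 : ℝ) 1,
      HasSum (fun j => e ^ j • κ j) (e • genDefect K T x N e) := fun e he => by
    have he' : e ∈ Icc (0 : ℝ) 1 := ⟨he.1.le, he.2⟩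
    have hX := hasSum_expoPoly x N e
    have a1 := hasSum_adSum hh hS₁ hc hexp hw₁ hsum he' hX (hasSum_smul_expoPolyDeriv x N e)
      (hasSum_phi_neg_apply _ _)
    have a2 := hasSum_adSum hh hS₂ hc hexp hw₂ hsum he' hX
      (hasSum_coeffSeq (hasSum_scaleGen hK hT.le e)) (hasSum_exp_neg_apply _ _)
    rw [smul_genDefect]
    exact (a1.sub a2).congr_fun fun j => smul_sub _ _ _
  have hκn : Summable fun j => ‖κ j‖ := by
    refine Summable.of_nonneg_of_le (fun _ => norm_nonneg _) (fun j => (hκ j).norm_le) ?_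
    exact ((summable_geometric_of_lt_one (by norm_num) (by norm_num)).mul_left _).mul_left _
  have hO' : (fun e => e • genDefect K T x N e) =O[𝓝[>] 0] fun e : ℝ => e ^ (N + 1) := by
    have b1 := phi_magnus_sub_scaleGen_isBigO hH hT (N := N) (Nat.succ_pos n)
    have b2 : (fun e => NormedSpace.exp (-adL (expoPoly x N e))) =O[𝓝[>] 0]
        fun _ : ℝ => (1 : ℝ) := by
      have : Continuous (expoPoly x N) :=
        continuous_iff_continuousAt.2 fun e => (hasDerivAt_expoPoly x N e).continuousAt
      exact ((exp_continuous_real.comp (adL.continuous.comp this).neg).tendsto 0).isBigO_one ℝ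
        |>.mono nhdsWithin_le_nhds
    have b3 : (fun e => genDefect K T x N e) =O[𝓝[>] 0] fun e : ℝ => e ^ N := by
      have b4 : (fun e => genDefect K T x N e) =O[𝓝[>] 0] fun e : ℝ =>
          ‖NormedSpace.exp (-adL (expoPoly x N e))‖ *
            ‖phi (adL (expoPoly x N e)) (expoPolyDeriv x N e) - scaleGen K T e‖ :=
        IsBigO.of_bound 1 (Eventually.of_forall fun e => by
          rw [one_mul, norm_mul, norm_norm, norm_norm]
          exact ContinuousLinearMap.le_opNorm _ _)
      refine b4.trans ?_
      simpa using b2.norm_left.mul b1.norm_left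
    have b5 := (isBigO_refl (fun e : ℝ => e) (𝓝[>] 0)).smul b3
    refine b5.congr_right fun e => ?_
    exact (pow_succ' e N).symm
  -- The defect is of order ε^(n+1), and the extra factor ε raises the order to n + 2.
  have hzero : ∀ j < n + 2, κ j = 0 := fun j hj => coeff_eq_zero_of_isBigO hκn hκs hO' hj
  have hs := ((adL (A := Op Λ d)).flip O).hasSum (hκs ε hε)
  have hs1 := (hasSum_nat_add_iff' (n + 2)).2 hs
  rw [Finset.sum_eq_zero fun j hj => by
    simp [hzero j (Finset.mem_range.1 hj)], sub_zero] at hs1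
  set B := 16 * J * T * X.card * ‖O‖ * (1 / 2) ^ (n + 2) with hB
  have hB0 : 0 ≤ B := by positivity
  have hgeo : HasSum (fun j : ℕ => ε * (B * (1 / 2 : ℝ) ^ j)) (ε * (B * 2)) := by
    have := (hasSum_geometric_of_lt_one (r := (1 / 2 : ℝ)) (by norm_num) (by norm_num)).mul_left B
    norm_num at this
    simpa using this.mul_left ε
  have hfin := hs1.norm_le_of_bounded hgeo fun j => by
    simp only [ContinuousLinearMap.flip_apply, map_smul]
    rw [norm_smul, Real.norm_of_nonneg (pow_nonneg hε.1.le _)]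
    -- One factor ε is kept, to be cancelled against the ε in front of the defect.
    have e1 : ε ^ (j + (n + 2)) ≤ ε := by
      calc _ ≤ ε ^ 1 := pow_le_pow_of_le_one hε.1.le hε.2 (by lia)
        _ = ε := pow_one _
    refine mul_le_mul e1 (((hκ _).norm_adL_le hO).trans_eq ?_) (norm_nonneg _) hε.1.le
    rw [hB]
    ring
  rw [ContinuousLinearMap.flip_apply, map_smul, smul_apply, norm_smul,
    Real.norm_of_nonneg hε.1.le] at hfin
  refine (le_of_mul_le_mul_left hfin hε.1).trans_eq ?_
  rw [hB]
  ring

/-- Over one period, the truncated Floquet-Magnus expansion reproduces the evolution of local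
observables up to an exponentially small error. -/
theorem norm_step_sub_le (hH : BddMeas H) (hHerm : ∀ s, (H s).IsHermitian)
    (hJ : ∀ s, Loc k 1 J (H s)) (hT : 0 < T) {n : ℕ} (hμ : 16 * n * (2 * k * J * T) ≤ 1)
    {X : Finset Λ} {O : Op Λ d} (hO : SupportedOn X O) :
    ‖(propagator H T)ᴴ * O * propagator H T -
        (truncatedStep H T n)ᴴ * O * truncatedStep H T n‖ ≤
      12 * J * T * X.card * (1 / 2) ^ n * ‖O‖ := by
  set K : ℝ → Op Λ d := fun s => Complex.I • H s with hKdef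
  set x := magnusCoeff H T
  have hJ0 : 0 ≤ J := (hJ 0).1
  have hK : LocBdd K := BddMeas.locBdd ⟨hH.meas.fun_const_smul _, hH.bdd.imp fun c h t => by
    simpa [norm_smul, hKdef] using h t⟩
  have hKs : ∀ t, (K t)ᴴ = -K t := fun t => by
    simp only [hKdef, Matrix.conjTranspose_smul, (hHerm t).eq]
    simp
  have hKJ : ∀ s, Loc k 1 J (K s) := fun s => by simpa using (hJ s).csmul Complex.I
  have hxs : ∀ p, (x p)ᴴ = -x p := fun p => conjTranspose_magnusCoeff hH hHerm hT p
  have hX : ∀ e, (expoPoly x (n + 1) e)ᴴ = -expoPoly x (n + 1) e := conjTranspose_expoPoly hxs _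
  have hX' : ∀ e, (-expoPoly x (n + 1) e)ᴴ = - -expoPoly x (n + 1) e := fun e => by
    rw [Matrix.conjTranspose_neg, hX]
  rw [propagator_eq_leftProp, conjTranspose_leftProp hK hKs 1 hT.le, truncatedStep_eq,
    ← Matrix.exp_conjTranspose, hX', neg_neg]
  have hB0 : 0 ≤ J * T * X.card * (1 / 2) ^ n * ‖O‖ := by positivity
  rcases Nat.eq_zero_or_pos n with rfl | hn
  -- At order 0 each evolution moves O by at most 2JT|X|‖O‖, for a total of 4 ≤ 12.
  · have h1 := norm_propagator_conj_sub_le hK hKs hT.le O fun t => (hKJ t).norm_adL_le hO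
    have e0 : expoPoly x (0 + 1) 1 = x 0 := by simp [expoPoly]
    have h2 := norm_exp_conj_sub_le (hxs 0) O
    have h3 := (loc_magnusCoeff hH hJ hT 0).norm_adL_le hO
    simp only [pow_zero, mul_one, Nat.factorial_zero, Nat.cast_one] at h3
    rw [e0]
    have h4 := norm_sub_le_norm_sub_add_norm_sub (rightProp K 1 T * O * leftProp K 1 T) O
      (NormedSpace.exp (x 0) * O * NormedSpace.exp (-x 0))
    rw [norm_sub_rev O] at h4
    simp only [pow_zero, mul_one] at hB0 ⊢
    have h5 := h2.trans h3
    nlinarith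
  · set f : ℝ → Op Λ d := fun e => leftProp K e T * NormedSpace.exp (expoPoly x (n + 1) e) * O *
        (NormedSpace.exp (-expoPoly x (n + 1) e) * rightProp K e T)
    have hd := hasDerivAt_interpolation hK hT.le x (n + 1) O
    set B := 8 * J * T * X.card * (1 / 2) ^ n * ‖O‖ with hB
    -- The defect is bounded for positive ε only, so the interval starts at δ, which then tends to
    -- 0.
    have hbound : ∀ δ ∈ Ioo (0 : ℝ) 1, ‖f 1 - f δ‖ ≤ B := by
      intro δ hδ
      have h1 := norm_image_sub_le_of_norm_deriv_le_segment' (f := f) (C := B)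
        (fun e _ => (hd e).hasDerivWithinAt) (fun e he => ?_) 1 (right_mem_Icc.2 hδ.2.le)
      · refine h1.trans ?_
        have : 0 ≤ B := by positivity
        nlinarith [hδ.1]
      · have hw1 := exp_mem_unitary (hX e)
        have hw2 := exp_mem_unitary (hX' e)
        rw [norm_unitary_mul_mul (mul_mem (leftProp_mem_unitary hK hKs e hT.le) hw1)
          (mul_mem hw2 (rightProp_mem_unitary hK hKs e hT.le))]
        exact norm_adL_genDefect_le hH hJ hT hn hμ hO ⟨hδ.1.trans_le he.1, he.2.le⟩
    have hlim : Tendsto (fun δ => ‖f 1 - f δ‖) (𝓝[>] 0) (𝓝 ‖f 1 - f 0‖) :=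
      ((tendsto_const_nhds.sub (hd 0).continuousAt.tendsto).norm).mono_left nhdsWithin_le_nhds
    have h2 : ‖f 1 - f 0‖ ≤ B :=
      le_of_tendsto hlim (by
        filter_upwards [Ioo_mem_nhdsGT (zero_lt_one (α := ℝ))] with δ hδ using hbound δ hδ)
    have hf0 : f 0 = O := by
      simp only [f, leftProp_eps_zero hK hT.le, rightProp_eps_zero hK hT.le, expoPoly_zero, neg_zero,
        NormedSpace.exp_zero, one_mul, mul_one]
    have hu := leftProp_mem_unitary hK hKs 1 hT.le
    have hv := rightProp_mem_unitary hK hKs 1 hT.le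
    have hvu := rightProp_mul_leftProp hK 1 hT.le
    have e1 : rightProp K 1 T * (f 1 - f 0) * leftProp K 1 T =
        NormedSpace.exp (expoPoly x (n + 1) 1) * O * NormedSpace.exp (-expoPoly x (n + 1) 1) -
          rightProp K 1 T * O * leftProp K 1 T := by
      rw [hf0, mul_sub, sub_mul]
      congr 1
      simp only [f, ← mul_assoc]
      rw [hvu, one_mul, mul_assoc _ (rightProp K 1 T), hvu, mul_one]
    rw [norm_sub_rev, ← e1, norm_unitary_mul_mul hv hu]
    refine h2.trans ?_
    rw [hB]
    linarith

end OnePeriod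

/-! ### Duality for the trace norm -/

section TraceNorm

variable {n : Type*} [Fintype n] [DecidableEq n]

theorem norm_le_one_of_conjTranspose_mul_self {P : Matrix n n ℂ} (h : Pᴴ * P = 1) : ‖P‖ ≤ 1 := by
  have h1 := CStarRing.norm_star_mul_self (x := P)
  rw [Matrix.star_eq_conjTranspose, h] at h1
  rcases isEmpty_or_nonempty n with hn | hn
  · rw [Subsingleton.elim P 0, norm_zero]
    exact zero_le_one
  · rw [norm_one] at h1
    nlinarith [norm_nonneg P]

/-- The trace norm of a Hermitian matrix is attained at a Hermitian unitary. -/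
theorem exists_traceNorm_eq {R : Matrix n n ℂ} (hR : R.IsHermitian) :
    ∃ W : Matrix n n ℂ, W.IsHermitian ∧ W * W = 1 ∧ traceNorm R = (R * W).trace.re := by
  have hsa : IsSelfAdjoint R := hR
  have hc : ∀ f : ℝ → ℝ, ContinuousOn f (spectrum ℝ R) := fun f =>
    Matrix.finite_real_spectrum.continuousOn f
  -- The sign function takes the value 1 at 0, so that W is unitary even if R has a kernel.
  set s : ℝ → ℝ := fun x => if 0 ≤ x then 1 else -1
  refine ⟨cfc s R, cfc_predicate s R, ?_, ?_⟩
  · rw [← cfc_mul s s R (hc s) (hc s)]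
    have : (fun x => s x * s x) = fun _ => (1 : ℝ) := by
      funext x
      simp only [s]
      split_ifs <;> norm_num
    rw [this, cfc_const_one ℝ R]
  · have h1 : R * cfc s R = cfc (fun x => x * s x) R := by
      rw [cfc_mul (fun x => x) s R (hc _) (hc _), cfc_id' ℝ R]
    have h2 : (fun x : ℝ => x * s x) = fun x => ‖x‖ := by
      funext x
      simp only [s, Real.norm_eq_abs]
      split_ifs with h
      · rw [abs_of_nonneg h, mul_one]
      · rw [abs_of_neg (not_le.1 h), mul_neg_one]
    rw [traceNorm, CFC.abs_eq_cfc_norm R hsa, h1, h2]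

theorem re_trace_state_mul_le {ρ Y : Matrix n n ℂ} (hρ : ρ.PosSemidef) (htr : ρ.trace = 1)
    (hY : Y.IsHermitian) : (ρ * Y).trace.re ≤ ‖Y‖ := by
  obtain ⟨B, rfl⟩ := CStarAlgebra.nonneg_iff_eq_star_mul_self.1 hρ.nonneg
  rw [Matrix.star_eq_conjTranspose] at *
  have h1 : Y ≤ algebraMap ℝ (Matrix n n ℂ) ‖Y‖ := IsSelfAdjoint.le_algebraMap_norm_self hY
  have h2 := ((Matrix.le_iff.1 h1).mul_mul_conjTranspose_same B).trace_nonneg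
  have h3 : (B * (algebraMap ℝ (Matrix n n ℂ) ‖Y‖ - Y) * Bᴴ).trace =
      (‖Y‖ : ℂ) - (Bᴴ * B * Y).trace := by
    rw [Matrix.trace_mul_cycle, mul_sub, Matrix.trace_sub, Algebra.algebraMap_eq_smul_one,
      mul_smul_comm, mul_one, Matrix.trace_smul, htr]
    simp
  rw [h3] at h2
  have h4 := (Complex.le_def.1 h2).1
  simp at h4
  linarith

end TraceNorm

/-! ### Partial trace and reduced states -/

section Regions

variable {Λ : Type*} [Fintype Λ] [DecidableEq Λ] {d : ℕ}

/-- The operator `B ⊗ 1`. -/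
def extend (L : Finset Λ) (B : Op {i // i ∈ L} d) : Op Λ d :=
  (B ⊗ₖ (1 : Op {i // ¬ i ∈ L} d)).submatrix (splitting L) (splitting L)

theorem supportedOn_extend (L : Finset Λ) (B : Op {i // i ∈ L} d) : SupportedOn L (extend L B) :=
  ⟨B, rfl⟩

theorem extend_mul (L : Finset Λ) (B B' : Op {i // i ∈ L} d) :
    extend L B * extend L B' = extend L (B * B') := by
  rw [extend, extend, Matrix.submatrix_mul_equiv, ← Matrix.mul_kronecker_mul, one_mul]
  rfl

theorem extend_one (L : Finset Λ) : extend L (1 : Op {i // i ∈ L} d) = 1 := by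
  rw [extend, Matrix.one_kronecker_one, Matrix.submatrix_one_equiv]

theorem isHermitian_extend (L : Finset Λ) {B : Op {i // i ∈ L} d} (hB : B.IsHermitian) :
    (extend L B).IsHermitian := by
  rw [Matrix.IsHermitian, extend, Matrix.conjTranspose_submatrix, Matrix.conjTranspose_kronecker,
    hB.eq, Matrix.conjTranspose_one]

theorem trace_reducedTo_mul (L : Finset Λ) (A : Op Λ d) (B : Op {i // i ∈ L} d) :
    (reducedTo L A * B).trace = (A * extend L B).trace := by
  have h1 : (A * extend L B).trace =
      (A.submatrix (splitting L).symm (splitting L).symm * (B ⊗ₖ (1 : Op {i // ¬ i ∈ L} d))).trace := by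
    have : A = (A.submatrix (splitting L).symm (splitting L).symm).submatrix
        (splitting L) (splitting L) := by simp
    conv_lhs => rw [this]
    rw [extend, Matrix.submatrix_mul_equiv]
    exact Equiv.sum_comp (splitting L) (fun q => (A.submatrix (splitting L).symm (splitting L).symm *
      (B ⊗ₖ (1 : Op {i // ¬ i ∈ L} d))) q q)
  rw [h1]
  simp only [Matrix.trace, Matrix.diag_apply, Matrix.mul_apply, Fintype.sum_prod_type, reducedTo,
    Matrix.of_apply, Matrix.kroneckerMap_apply, Matrix.submatrix_apply, Matrix.one_apply, mul_ite,
    mul_one, mul_zero, Finset.sum_ite_eq', Finset.mem_univ, if_true, Finset.sum_mul]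
  refine Finset.sum_congr rfl fun a _ => ?_
  exact Finset.sum_comm

theorem reducedTo_sub (L : Finset Λ) (A B : Op Λ d) :
    reducedTo L A - reducedTo L B = reducedTo L (A - B) := by
  ext a b
  simp [reducedTo, Finset.sum_sub_distrib]

theorem isHermitian_reducedTo (L : Finset Λ) {A : Op Λ d} (hA : A.IsHermitian) :
    (reducedTo L A).IsHermitian := by
  refine Matrix.IsHermitian.ext fun a b => ?_
  simp only [reducedTo, Matrix.of_apply, star_sum]
  exact Finset.sum_congr rfl fun c _ => hA.apply _ _

/-- The distance of two evolved reduced states is bounded by the distance of the evolved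
observables. -/
theorem traceNorm_reducedTo_le {ρ U V : Op Λ d} (hρ : IsState ρ) (L : Finset Λ) {c : ℝ}
    (h : ∀ O : Op Λ d, SupportedOn L O → ‖O‖ ≤ 1 → ‖Uᴴ * O * U - Vᴴ * O * V‖ ≤ c) :
    traceNorm (reducedTo L (U * ρ * Uᴴ) - reducedTo L (V * ρ * Vᴴ)) ≤ c := by
  have hρh : ρ.IsHermitian := hρ.1.isHermitian
  have hA : (U * ρ * Uᴴ - V * ρ * Vᴴ).IsHermitian :=
    (Matrix.isHermitian_mul_mul_conjTranspose U hρh).sub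
      (Matrix.isHermitian_mul_mul_conjTranspose V hρh)
  rw [reducedTo_sub]
  obtain ⟨W, hW, hW2, htn⟩ := exists_traceNorm_eq (isHermitian_reducedTo L hA)
  have hO := isHermitian_extend L hW
  have hO1 : ‖extend L W‖ ≤ 1 := norm_le_one_of_conjTranspose_mul_self (by
    rw [hO.eq, extend_mul, hW2, extend_one])
  have hY : (Uᴴ * extend L W * U - Vᴴ * extend L W * V).IsHermitian :=
    (Matrix.isHermitian_conjTranspose_mul_mul U hO).sub
      (Matrix.isHermitian_conjTranspose_mul_mul V hO)
  have htr : ((U * ρ * Uᴴ - V * ρ * Vᴴ) * extend L W).trace =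
      (ρ * (Uᴴ * extend L W * U - Vᴴ * extend L W * V)).trace := by
    rw [sub_mul, mul_sub, Matrix.trace_sub, Matrix.trace_sub]
    congr 1
    · rw [mul_assoc, mul_assoc, Matrix.trace_mul_comm]
      simp only [mul_assoc]
    · rw [mul_assoc, mul_assoc, Matrix.trace_mul_comm]
      simp only [mul_assoc]
  rw [htn, trace_reducedTo_mul, htr]
  exact (re_trace_state_mul_le hρ.1 hρ.2 hY).trans (h _ (supportedOn_extend L W) hO1)

end Regions

/-! ### Telescoping over the periods -/

section Telescoping

variable {n : Type*} [Fintype n] [DecidableEq n]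

/-- The truncated step is always applied last, where it only needs to be unitary. The observables in
the hypothesis are evolved exactly, so no propagation bound for the truncated dynamics is required.
-/
theorem norm_pow_conj_sub_le {U V : Matrix n n ℂ} (hV : V ∈ unitary (Matrix n n ℂ))
    (O : Matrix n n ℂ) {c : ℝ} (m : ℕ)
    (h : ∀ j < m, ‖Uᴴ * ((U ^ j)ᴴ * O * U ^ j) * U - Vᴴ * ((U ^ j)ᴴ * O * U ^ j) * V‖ ≤ c) :
    ‖(U ^ m)ᴴ * O * U ^ m - (V ^ m)ᴴ * O * V ^ m‖ ≤ m * c := by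
  induction m with
  | zero => simp
  | succ m ih =>
    set A := (U ^ m)ᴴ * O * U ^ m
    set B := (V ^ m)ᴴ * O * V ^ m
    have e1 : (U ^ (m + 1))ᴴ * O * U ^ (m + 1) - (V ^ (m + 1))ᴴ * O * V ^ (m + 1) =
        (Uᴴ * A * U - Vᴴ * A * V) + Vᴴ * (A - B) * V := by
      simp only [A, B, pow_succ, Matrix.conjTranspose_mul, mul_sub, sub_mul, mul_assoc]
      abel
    have hV' : Vᴴ ∈ unitary (Matrix n n ℂ) := Unitary.star_mem hV
    rw [e1]
    refine (norm_add_le _ _).trans ?_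
    rw [CStarRing.norm_mul_mem_unitary _ hV, CStarRing.norm_mem_unitary_mul _ hV']
    have h1 := h m (Nat.lt_succ_self m)
    have h2 := ih fun j hj => h j (hj.trans (Nat.lt_succ_self m))
    push_cast
    linarith

end Telescoping

/-! ### Localization by averaging over signed translations -/

section Twirl

variable {Λ : Type*} [Fintype Λ] [DecidableEq Λ] {d : ℕ} [NeZero d] (Y : Finset Λ)

/-- The translation of the configuration in `Y`. -/
def shift (x : {i // i ∈ Y} → Fin d) (a : Λ → Fin d) : Λ → Fin d :=
  fun i => if h : i ∈ Y then a i + x ⟨i, h⟩ else a i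

/-- The configuration in `Y`. -/
def restr (a : Λ → Fin d) : {i // i ∈ Y} → Fin d := fun i => a i

/-- The unitary that translates the configuration in `Y` and changes its sign. -/
def signShift (q : (({i // i ∈ Y} → Fin d) → ℤˣ) × ({i // i ∈ Y} → Fin d)) : Op Λ d :=
  Matrix.of fun a b => if shift Y q.2 a = b then ((q.1 (restr Y b) : ℤ) : ℂ) else 0

variable {Y}

theorem shift_injective (x : {i // i ∈ Y} → Fin d) : Function.Injective (shift (Λ := Λ) Y x) := by
  intro a b h
  funext i
  have hi := congrFun h i
  simp only [shift] at hi
  split_ifs at hi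
  · exact add_right_cancel hi
  · exact hi

theorem shift_apply_of_notMem (x : {i // i ∈ Y} → Fin d) (a : Λ → Fin d) {i : Λ} (h : i ∉ Y) :
    shift Y x a i = a i := dif_neg h

theorem shift_apply_of_mem (x : {i // i ∈ Y} → Fin d) (a : Λ → Fin d) {i : Λ} (h : i ∈ Y) :
    shift Y x a i = a i + x ⟨i, h⟩ := dif_pos h

theorem supportedOn_signShift (q : (({i // i ∈ Y} → Fin d) → ℤˣ) × ({i // i ∈ Y} → Fin d)) :
    SupportedOn Y (signShift (Λ := Λ) Y q) := by
  refine .of_entries (fun a b i hi hne => ?_) fun a b a' b' ha hb h h' => ?_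
  · refine if_neg fun e => hne ?_
    rw [← e, shift_apply_of_notMem _ _ hi]
  · have e1 : restr Y b = restr Y b' := funext fun i => hb i i.2
    have e2 : shift Y q.2 a = b ↔ shift Y q.2 a' = b' := by
      simp only [funext_iff]
      refine forall_congr' fun i => ?_
      by_cases hi : i ∈ Y
      · rw [shift_apply_of_mem _ _ hi, shift_apply_of_mem _ _ hi, ha i hi, hb i hi]
      · rw [shift_apply_of_notMem _ _ hi, shift_apply_of_notMem _ _ hi, h i hi, h' i hi]
        simp
    simp only [signShift, Matrix.of_apply, e1, e2]

theorem signShift_conj_apply (q : (({i // i ∈ Y} → Fin d) → ℤˣ) × ({i // i ∈ Y} → Fin d))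
    (A : Op Λ d) (a b : Λ → Fin d) :
    (signShift Y q * A * (signShift Y q)ᴴ) a b =
      ((q.1 (restr Y (shift Y q.2 a)) : ℤ) : ℂ) * ((q.1 (restr Y (shift Y q.2 b)) : ℤ) : ℂ) *
        A (shift Y q.2 a) (shift Y q.2 b) := by
  simp only [Matrix.mul_apply, signShift, Matrix.conjTranspose_apply, Matrix.of_apply, ite_mul,
    zero_mul, Finset.sum_ite_eq, Finset.mem_univ, if_true, apply_ite star, star_zero, mul_ite,
    mul_zero]
  simp
  ring

theorem signShift_mul_conjTranspose
    (q : (({i // i ∈ Y} → Fin d) → ℤˣ) × ({i // i ∈ Y} → Fin d)) :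
    signShift Y q * (signShift (Λ := Λ) Y q)ᴴ = 1 := by
  ext a b
  have h := signShift_conj_apply q 1 a b
  rw [mul_one] at h
  rw [h, Matrix.one_apply, Matrix.one_apply]
  by_cases hab : a = b
  · subst hab
    rw [if_pos rfl, if_pos rfl, mul_one]
    rcases Int.units_eq_one_or (q.1 (restr Y (shift Y q.2 a))) with h | h <;> simp [h]
  · rw [if_neg hab, if_neg fun e => hab (shift_injective _ e), mul_zero]

/-- For α ≠ β, flipping the sign at α alone is a bijection of the sign functions that negates every
summand. -/
theorem sum_sign_mul_sign {Q : Type*} [Fintype Q] [DecidableEq Q] (α β : Q) :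
    ∑ s : Q → ℤˣ, ((s α : ℤ) : ℂ) * ((s β : ℤ) : ℂ) =
      if α = β then (Fintype.card (Q → ℤˣ) : ℂ) else 0 := by
  split_ifs with h
  · subst h
    have : ∀ s : Q → ℤˣ, ((s α : ℤ) : ℂ) * ((s α : ℤ) : ℂ) = 1 := fun s => by
      rcases Int.units_eq_one_or (s α) with h | h <;> simp [h]
    simp only [this]
    simp
  · have h1 := Equiv.sum_comp (Equiv.mulRight (Pi.mulSingle α (-1) : Q → ℤˣ))
      fun s : Q → ℤˣ => ((s α : ℤ) : ℂ) * ((s β : ℤ) : ℂ)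
    have h2 : ∀ s : Q → ℤˣ, (((s * Pi.mulSingle α (-1) : Q → ℤˣ) α : ℤ) : ℂ) *
        (((s * Pi.mulSingle α (-1) : Q → ℤˣ) β : ℤ) : ℂ) = -(((s α : ℤ) : ℂ) * ((s β : ℤ) : ℂ)) := by
      intro s
      rw [Pi.mul_apply, Pi.mul_apply, Pi.mulSingle_eq_same, Pi.mulSingle_eq_of_ne (Ne.symm h)]
      simp
    simp only [Equiv.coe_mulRight, h2, Finset.sum_neg_distrib] at h1
    exact self_eq_neg.1 h1.symm

/-- An operator that almost commutes with the unitaries on `Y` is close to one supported outside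
of `Y`. -/
theorem exists_supportedOn_compl (A : Op Λ d) {δ : ℝ}
    (h : ∀ P : Op Λ d, SupportedOn Y P → ‖P‖ ≤ 1 → ‖adL A P‖ ≤ δ) :
    ∃ E : Op Λ d, SupportedOn Yᶜ E ∧ ‖E‖ ≤ ‖A‖ ∧ ‖A - E‖ ≤ δ := by
  set ι := (({i // i ∈ Y} → Fin d) → ℤˣ) × ({i // i ∈ Y} → Fin d)
  set P : ι → Op Λ d := signShift Y
  have hP1 : ∀ q, ‖P q‖ ≤ 1 := fun q => by
    rw [← Matrix.l2_opNorm_conjTranspose]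
    exact norm_le_one_of_conjTranspose_mul_self (by
      rw [Matrix.conjTranspose_conjTranspose]
      exact signShift_mul_conjTranspose q)
  have hP1' : ∀ q, ‖(P q)ᴴ‖ ≤ 1 := fun q => by
    rw [Matrix.l2_opNorm_conjTranspose]
    exact hP1 q
  set c : ℝ := (Fintype.card ι : ℝ)⁻¹
  have hι : (Fintype.card ι : ℝ) ≠ 0 := by exact_mod_cast Fintype.card_ne_zero
  have hc0 : 0 ≤ c := by positivity
  have hcard : c * Fintype.card ι = 1 := inv_mul_cancel₀ hι
  have havg : ∀ (f : ι → Op Λ d) (b : ℝ), (∀ q, ‖f q‖ ≤ b) → ‖c • ∑ q, f q‖ ≤ b := by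
    intro f b hf
    rw [norm_smul, Real.norm_of_nonneg hc0]
    calc c * ‖∑ q, f q‖ ≤ c * ∑ _q : ι, b := by
          gcongr
          exact norm_sum_le_of_le _ fun q _ => hf q
      _ = c * Fintype.card ι * b := by simp [mul_assoc]
      _ = b := by rw [hcard, one_mul]
  set E : Op Λ d := c • ∑ q, P q * A * (P q)ᴴ with hE
  -- The average over signs removes the entries that change the configuration in Y; the average over
  -- translations makes the others independent of it. What is left acts trivially on Y.
  have hEapply : ∀ a b, E a b = if restr Y a = restr Y b then
      ((Fintype.card ({i // i ∈ Y} → Fin d) : ℂ))⁻¹ * ∑ x, A (shift Y x a) (shift Y x b) else 0 := by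
    intro a b
    have e1 : E a b = (c : ℂ) * ∑ x, ∑ s : ({i // i ∈ Y} → Fin d) → ℤˣ,
        ((s (restr Y (shift Y x a)) : ℤ) : ℂ) * ((s (restr Y (shift Y x b)) : ℤ) : ℂ) *
          A (shift Y x a) (shift Y x b) := by
      rw [hE, Matrix.smul_apply, Matrix.sum_apply, Fintype.sum_prod_type_right, Complex.real_smul]
      simp only [P, signShift_conj_apply]
    have e2 : ∀ x, restr Y (shift Y x a) = restr Y (shift Y x b) ↔ restr Y a = restr Y b := by
      intro x
      simp only [funext_iff, restr]
      refine forall_congr' fun i => ?_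
      rw [shift_apply_of_mem _ _ i.2, shift_apply_of_mem _ _ i.2, add_left_inj]
    simp only [← Finset.sum_mul, sum_sign_mul_sign, e2] at e1
    rw [e1]
    split_ifs with hab
    · rw [← Finset.mul_sum, ← mul_assoc]
      congr 1
      simp only [c, ι, Fintype.card_prod]
      have h1 : (Fintype.card (({i // i ∈ Y} → Fin d) → ℤˣ) : ℂ) ≠ 0 := by
        exact_mod_cast Fintype.card_ne_zero
      push_cast
      rw [mul_inv, mul_comm, ← mul_assoc, mul_inv_cancel₀ h1, one_mul]
    · simp
  refine ⟨E, .of_entries (fun a b i hi hne => ?_) fun a b a' b' ha hb hab hab' => ?_, ?_, ?_⟩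
  · rw [hEapply, if_neg fun e => hne ?_]
    have hi' : i ∈ Y := by simpa using hi
    exact congrFun e ⟨i, hi'⟩
  · have e1 : restr Y a = restr Y b := funext fun i => hab i (by simp)
    have e2 : restr Y a' = restr Y b' := funext fun i => hab' i (by simp)
    rw [hEapply, hEapply, if_pos e1, if_pos e2]
    congr 1
    -- Changing the common configuration in Y only relabels the translations.
    refine Fintype.sum_equiv (Equiv.addRight (restr Y a - restr Y a')) _ _ fun x => ?_
    have key : ∀ u u' : Λ → Fin d, (∀ i ∉ Y, u i = u' i) →
        restr Y u - restr Y u' = restr Y a - restr Y a' →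
        shift Y x u = shift Y (x + (restr Y a - restr Y a')) u' := by
      intro u u' hu hr
      funext i
      by_cases hi : i ∈ Y
      · rw [shift_apply_of_mem _ _ hi, shift_apply_of_mem _ _ hi, ← hr]
        simp only [Pi.add_apply, Pi.sub_apply, restr]
        abel
      · rw [shift_apply_of_notMem _ _ hi, shift_apply_of_notMem _ _ hi, hu i hi]
    rw [Equiv.coe_addRight, key a a' (fun i hi => ha i (by simpa using hi)) rfl,
      key b b' (fun i hi => hb i (by simpa using hi)) (by rw [e1, e2])]
  · refine havg _ _ fun q => ?_
    calc ‖P q * A * (P q)ᴴ‖ ≤ ‖P q‖ * ‖A‖ * ‖(P q)ᴴ‖ :=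
          (norm_mul_le _ _).trans (mul_le_mul_of_nonneg_right (norm_mul_le _ _) (norm_nonneg _))
      _ ≤ 1 * ‖A‖ * 1 := by gcongr; exacts [hP1 q, hP1' q]
      _ = ‖A‖ := by ring
  · have e1 : A - E = c • ∑ q, adL A (P q) * (P q)ᴴ := by
      have e2 : ∀ q, adL A (P q) * (P q)ᴴ = A - P q * A * (P q)ᴴ := fun q => by
        rw [adL_apply, sub_mul, mul_assoc A, signShift_mul_conjTranspose, mul_one]
      simp only [e2, Finset.sum_sub_distrib, smul_sub, Finset.sum_const, Finset.card_univ]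
      rw [← Nat.cast_smul_eq_nsmul ℝ, smul_smul, hcard, one_smul]
    rw [e1]
    refine havg _ _ fun q => (norm_mul_le _ _).trans ?_
    have h1 := h (P q) (supportedOn_signShift q) (hP1 q)
    calc _ ≤ δ * 1 := mul_le_mul h1 (hP1' q) (norm_nonneg _) ((norm_nonneg _).trans h1)
      _ = δ := mul_one δ

end Twirl

/-! ### Driven systems in the abstract setting -/

section SystemFacts

variable {Λ : Type*} [Fintype Λ] [DecidableEq Λ] {d k : ℕ} {J T : ℝ}

namespace DrivenSystem

variable (S : DrivenSystem Λ d k J T)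

theorem loc_hamiltonian (hJ : 0 ≤ J) (t : ℝ) : Loc k 1 J (S.hamiltonian t) := by
  refine ⟨hJ, fun X => S.h X + S.v X t, fun X => (S.h_supported X).add (S.v_supported X t),
    fun X hX => ?_, by simp [hamiltonian, Finset.sum_add_distrib], fun i => ?_⟩
  · rw [one_mul]
    by_cases h : S.h X = 0
    · exact S.v_fewBody X t (by simpa [h] using hX)
    · exact S.h_fewBody X h
  · exact (Finset.sum_le_sum fun X _ => norm_add_le _ _).trans (S.extensive i t)

theorem isHermitian_hamiltonian (t : ℝ) : (S.hamiltonian t).IsHermitian :=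
  S.static_hermitian.add (S.driving_hermitian t)

theorem hamiltonian_add_period (t : ℝ) : S.hamiltonian (t + T) = S.hamiltonian t := by
  simp only [hamiltonian, S.v_periodic]

theorem bddMeas_hamiltonian (hJ : 0 ≤ J) : BddMeas S.hamiltonian where
  meas := by
    have h1 : ∀ a b, Measurable fun t => S.hamiltonian t a b := fun a b => by
      simp only [hamiltonian, Matrix.add_apply, Matrix.sum_apply]
      exact measurable_const.add (Finset.measurable_sum _ fun X _ => S.v_measurable X a b)
    have h2 : S.hamiltonian = fun t => ∑ a, ∑ b, S.hamiltonian t a b • Matrix.single a b (1 : ℂ) := by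
      funext t
      conv_lhs => rw [Matrix.matrix_eq_sum_single (S.hamiltonian t)]
      simp [Matrix.smul_single]
    rw [h2]
    exact Finset.stronglyMeasurable_fun_sum _ fun a _ => Finset.stronglyMeasurable_fun_sum _
      fun b _ => (h1 a b).stronglyMeasurable.smul_const _
  bdd := ⟨_, fun t => (S.loc_hamiltonian hJ t).norm_le⟩

theorem evolution_nat_mul (hJ : 0 ≤ J) (hT : 0 ≤ T) (m : ℕ) :
    S.evolution (m * T) = S.evolution T ^ m := by
  have hH := S.bddMeas_hamiltonian hJ
  have hK : BddMeas fun s => Complex.I • S.hamiltonian s :=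
    ⟨hH.meas.fun_const_smul _, hH.bdd.imp fun c h t => by simpa [norm_smul] using h t⟩
  simp only [evolution, propagator_eq_leftProp]
  exact leftProp_nat_mul_period hK hT (fun t => by rw [S.hamiltonian_add_period]) 1 m

theorem evolution_mem_unitary (hJ : 0 ≤ J) {t : ℝ} (ht : 0 ≤ t) :
    S.evolution t ∈ unitary (Op Λ d) := by
  have hH := S.bddMeas_hamiltonian hJ
  have hK : BddMeas fun s => Complex.I • S.hamiltonian s :=
    ⟨hH.meas.fun_const_smul _, hH.bdd.imp fun c h t => by simpa [norm_smul] using h t⟩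
  rw [evolution, propagator_eq_leftProp]
  refine leftProp_mem_unitary hK.locBdd (fun s => ?_) 1 ht
  rw [Matrix.conjTranspose_smul, (S.isHermitian_hamiltonian s).eq]
  simp

theorem truncatedStep_mem_unitary (hJ : 0 ≤ J) (hT : 0 < T) (q : ℕ) :
    truncatedStep S.hamiltonian T q ∈ unitary (Op Λ d) := by
  rw [truncatedStep_eq]
  refine exp_mem_unitary ?_
  rw [Matrix.conjTranspose_neg, conjTranspose_expoPoly fun p =>
    conjTranspose_magnusCoeff (S.bddMeas_hamiltonian hJ) S.isHermitian_hamiltonian hT p]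

end DrivenSystem

end SystemFacts

/-! ### Counting sites near a region -/

section Geometry

variable {Λ : Type*} [Fintype Λ] [DecidableEq Λ] {Γ : SimpleGraph Λ}

/-- The sites at distance at least `l` from `L`. -/
noncomputable def farRegion (Γ : SimpleGraph Λ) (L : Finset Λ) (l : ℕ) : Finset Λ :=
  Finset.univ.filter fun j => ∀ i ∈ L, l ≤ Γ.dist i j

theorem mem_farRegion {L : Finset Λ} {l : ℕ} {j : Λ} :
    j ∈ farRegion Γ L l ↔ ∀ i ∈ L, l ≤ Γ.dist i j := by
  simp [farRegion]

/-- Monotonicity of the Lieb-Robinson function in the distance is not assumed, so the distance must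
be exactly l. If a closest far site j were further away than l, its neighbour on a geodesic towards
L would still be far and yet closer. -/
theorem regionDist_farRegion (hΓ : Γ.Connected) {L : Finset Λ} (hL : L.Nonempty) {l : ℕ}
    (hl : 1 ≤ l) (hY : (farRegion Γ L l).Nonempty) : regionDist Γ L (farRegion Γ L l) = l := by
  set S : Set ℕ := {r | ∃ i ∈ L, ∃ j ∈ farRegion Γ L l, Γ.dist i j = r} with hS
  have hne : S.Nonempty := by
    obtain ⟨i, hi⟩ := hL
    obtain ⟨j, hj⟩ := hY
    exact ⟨_, i, hi, j, hj, rfl⟩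
  obtain ⟨i, hi, j, hj, hij⟩ := Nat.sInf_mem hne
  have hmin : ∀ i' ∈ L, ∀ j' ∈ farRegion Γ L l, sInf S ≤ Γ.dist i' j' := fun i' hi' j' hj' =>
    Nat.sInf_le ⟨i', hi', j', hj', rfl⟩
  change sInf S = l
  have hge : l ≤ sInf S := hij ▸ mem_farRegion.1 hj i hi
  refine le_antisymm ?_ hge
  by_contra hlt
  push Not at hlt
  obtain ⟨p, hp⟩ := hΓ.exists_walk_length_eq_dist j i
  rw [SimpleGraph.dist_comm, hij] at hp
  cases p with
  | nil =>
    simp at hp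
    lia
  | cons hadj p =>
    rename_i z
    rw [SimpleGraph.Walk.length_cons] at hp
    have h1 : Γ.dist z i ≤ p.length := SimpleGraph.dist_le p
    have hz : z ∈ farRegion Γ L l := mem_farRegion.2 fun i' hi' => by
      have h2 := hmin i' hi' j hj
      have h3 := hΓ.dist_triangle (u := i') (v := z) (w := j)
      have h4 : Γ.dist z j = 1 := SimpleGraph.dist_eq_one_iff_adj.2 hadj.symm
      lia
    have h5 := hmin i hi z hz
    rw [SimpleGraph.dist_comm] at h5
    lia

/-- Distance less than l₀ means radius l₀ - 1, which is at most the number x = C^(-1/D) 2^(n/(2D))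
before rounding, and C x^D = 2^(n/2). -/
theorem card_ball_le (hΓ : Γ.Connected) {D : ℕ} (hD : 1 ≤ D) {C : ℝ} (hC : 0 < C)
    (hdim : HasDimension Γ D C) (n : ℕ) (i : Λ) :
    ((Finset.univ.filter fun j : Λ => Γ.dist i j < localityLength D C n).card : ℝ) ≤
      2 ^ ((n : ℝ) / 2) := by
  set x : ℝ := C ^ (-(1 / (D : ℝ))) * (2 : ℝ) ^ ((n : ℝ) / (2 * (D : ℝ))) with hx
  have hx0 : 0 < x := by positivity
  have hl : localityLength D C n = ⌈x⌉₊ := rfl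
  have hDr : (D : ℝ) ≠ 0 := by
    have : D ≠ 0 := by lia
    exact_mod_cast this
  have hl1 : 1 ≤ ⌈x⌉₊ := Nat.one_le_ceil_iff.2 hx0
  rw [hl]
  -- For l₀ = 1 the radius is 0, where the dimension bound says nothing; the ball is then a single
  -- site.
  rcases hl1.eq_or_lt with h1 | h1
  · have h2 : (Finset.univ.filter fun j : Λ => Γ.dist i j < ⌈x⌉₊) = {i} := by
      ext j
      rw [← h1]
      simp only [Finset.mem_filter, Finset.mem_univ, true_and, Nat.lt_one_iff, Finset.mem_singleton]
      rw [hΓ.dist_eq_zero_iff]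
      exact eq_comm
    rw [h2, Finset.card_singleton, Nat.cast_one]
    exact Real.one_le_rpow (by norm_num) (by positivity)
  · have h2 := hdim i (⌈x⌉₊ - 1) (by lia)
    have h3 : (Finset.univ.filter fun j : Λ => Γ.dist i j < ⌈x⌉₊) =
        Finset.univ.filter fun j : Λ => Γ.dist i j ≤ ⌈x⌉₊ - 1 := by
      ext j
      simp only [Finset.mem_filter, Finset.mem_univ, true_and]
      lia
    rw [h3]
    refine h2.trans ?_
    have h4 : ((⌈x⌉₊ - 1 : ℕ) : ℝ) ≤ x := by
      rw [Nat.cast_sub hl1, Nat.cast_one]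
      linarith [Nat.ceil_lt_add_one hx0.le]
    calc C * ((⌈x⌉₊ - 1 : ℕ) : ℝ) ^ D ≤ C * x ^ D := by gcongr
      _ = 2 ^ ((n : ℝ) / 2) := by
        rw [hx, mul_pow, ← Real.rpow_natCast, ← Real.rpow_natCast, ← Real.rpow_mul hC.le,
          ← Real.rpow_mul (by norm_num), neg_mul, one_div, inv_mul_cancel₀ hDr, ← mul_assoc,
          Real.rpow_neg_one, mul_inv_cancel₀ hC.ne', one_mul]
        congr 1
        field_simp

theorem card_compl_farRegion_le (hΓ : Γ.Connected) {D : ℕ} (hD : 1 ≤ D) {C : ℝ} (hC : 0 < C)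
    (hdim : HasDimension Γ D C) (n : ℕ) (L : Finset Λ) :
    (((farRegion Γ L (localityLength D C n))ᶜ.card : ℕ) : ℝ) ≤ L.card * 2 ^ ((n : ℝ) / 2) := by
  have h1 : (farRegion Γ L (localityLength D C n))ᶜ ⊆ L.biUnion fun i =>
      Finset.univ.filter fun j : Λ => Γ.dist i j < localityLength D C n := by
    intro j hj
    rw [Finset.mem_compl, mem_farRegion] at hj
    push Not at hj
    obtain ⟨i, hi, hij⟩ := hj
    exact Finset.mem_biUnion.2 ⟨i, hi, by simpa using hij⟩
  calc (((farRegion Γ L (localityLength D C n))ᶜ.card : ℕ) : ℝ)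
      ≤ ((∑ i ∈ L, (Finset.univ.filter fun j : Λ =>
          Γ.dist i j < localityLength D C n).card : ℕ) : ℝ) := by
        exact_mod_cast (Finset.card_le_card h1).trans Finset.card_biUnion_le
    _ ≤ ∑ _i ∈ L, (2 : ℝ) ^ ((n : ℝ) / 2) := by
        push_cast
        exact Finset.sum_le_sum fun i _ => card_ball_le hΓ hD hC hdim n i
    _ = _ := by simp

end Geometry

/-! ### Localization of evolved observables -/

section Localization

variable {Λ : Type*} [Fintype Λ] [DecidableEq Λ] {d k : ℕ} {J T : ℝ}

/-- Evolved local observables are approximately supported on a neighbourhood. -/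
theorem exists_localized [NeZero d] (S : DrivenSystem Λ d k J T) (hJ : 0 ≤ J) {Γ : SimpleGraph Λ}
    (hΓ : Γ.Connected) {G : ℕ → ℝ → ℝ} (hG : ∀ l t, 0 ≤ t → 0 ≤ G l t)
    (hLR : LiebRobinson S Γ G) {L : Finset Λ} {O : Op Λ d} (hO : SupportedOn L O) (hO1 : ‖O‖ ≤ 1)
    {l : ℕ} (hl : 1 ≤ l) {t : ℝ} (ht : 0 ≤ t) :
    ∃ E : Op Λ d, SupportedOn (farRegion Γ L l)ᶜ E ∧ ‖E‖ ≤ 1 ∧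
      ‖S.heisenberg t O - E‖ ≤ L.card * G l t := by
  have hU := S.evolution_mem_unitary hJ ht
  have hU' : (S.evolution t)ᴴ ∈ unitary (Op Λ d) := Unitary.star_mem hU
  have hn : ‖S.heisenberg t O‖ ≤ 1 := by
    rw [DrivenSystem.heisenberg, norm_unitary_mul_mul hU' hU]
    exact hO1
  have hδ : 0 ≤ L.card * G l t := mul_nonneg (Nat.cast_nonneg _) (hG l t ht)
  -- The Lieb-Robinson bound needs two non-empty regions. Without far sites the evolved observable
  -- itself serves as E.
  rcases (farRegion Γ L l).eq_empty_or_nonempty with hY | hY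
  · refine ⟨S.heisenberg t O, ?_, hn, by simpa using hδ⟩
    rw [hY, Finset.compl_empty]
    exact .of_entries (fun _ _ i hi => absurd (Finset.mem_univ i) hi) fun a b a' b' ha hb _ _ => by
      rw [funext fun i => ha i (Finset.mem_univ i), funext fun i => hb i (Finset.mem_univ i)]
  -- An observable supported on no site commutes with everything and does not evolve.
  rcases L.eq_empty_or_nonempty with rfl | hL
  · have h1 : S.heisenberg t O = O := by
      have hsupp : SupportedOn Finset.univ (S.evolution t) :=
        .of_entries (fun _ _ i hi => absurd (Finset.mem_univ i) hi) fun a b a' b' ha hb _ _ => by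
          rw [funext fun i => ha i (Finset.mem_univ i), funext fun i => hb i (Finset.mem_univ i)]
      rw [DrivenSystem.heisenberg, mul_assoc, hO.commute hsupp (by simp), ← mul_assoc]
      have := (Unitary.mem_iff.1 hU).1
      rw [Matrix.star_eq_conjTranspose] at this
      rw [this, one_mul]
    refine ⟨O, hO.mono (Finset.empty_subset _), hO1, ?_⟩
    rw [h1, sub_self, norm_zero]
    exact hδ
  · obtain ⟨E, hE1, hE2, hE3⟩ := exists_supportedOn_compl (Y := farRegion Γ L l)
      (S.heisenberg t O) (δ := L.card * G l t) fun P hP hP1 => by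
        have h1 := hLR L (farRegion Γ L l) hL hY O P hO hP t ht
        rw [regionDist_farRegion hΓ hL hl hY] at h1
        refine h1.trans ?_
        have h2 : ((min L.card (farRegion Γ L l).card : ℕ) : ℝ) ≤ L.card := by
          exact_mod_cast min_le_left _ _
        have h3 : ‖O‖ * ‖P‖ ≤ 1 := mul_le_one₀ hO1 (norm_nonneg _) hP1
        calc G l t * ((min L.card (farRegion Γ L l).card : ℕ) : ℝ) * (‖O‖ * ‖P‖)
            ≤ G l t * L.card * 1 := by
              have := hG l t ht
              gcongr
          _ = _ := by ring
    exact ⟨E, hE1, hE2.trans hn, hE3⟩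

end Localization

end Floquet

/-! ### The bound over many periods -/

theorem theorem2 {Λ : Type*} [Fintype Λ] [DecidableEq Λ] (d k : ℕ) (hk : 1 ≤ k)
    (J T : ℝ) (hJ : 0 < J) (hT : 0 < T)
    (S : Floquet.DrivenSystem Λ d k J T)
    (Γ : SimpleGraph Λ) (hΓ : Γ.Connected)
    (D : ℕ) (hD : 1 ≤ D) (C : ℝ) (hC : 0 < C) (hdim : Floquet.HasDimension Γ D C)
    (G : ℕ → ℝ → ℝ) (hG_nonneg : ∀ l t, 0 ≤ t → 0 ≤ G l t)
    (hG_mono : ∀ l, MonotoneOn (G l) (Set.Ici 0))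
    (hLR : Floquet.LiebRobinson S Γ G)
    (n₀ : ℕ) (hn₀ : n₀ = Floquet.truncationOrder k J T)
    (l₀ : ℕ) (hl₀ : l₀ = Floquet.localityLength D C n₀)
    (L : Finset Λ) (ρ : Floquet.Op Λ d) (hρ : Floquet.IsState ρ) (m : ℕ) :
    Floquet.traceNorm
        (Floquet.reducedTo L (S.exactState m ρ) - Floquet.reducedTo L (S.truncatedState n₀ m ρ)) ≤
      12 * J * (L.card : ℝ) * ((m : ℝ) * T) * (2 : ℝ) ^ (-((n₀ : ℝ) / 2)) +
        2 * (L.card : ℝ) * (m : ℝ) * G l₀ ((m : ℝ) * T) := by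
  have hΛ : Nonempty Λ := hΓ.nonempty
  -- For d = 0 there are no configurations, and no state has trace 1.
  have hd : NeZero d := ⟨by
    rintro rfl
    have : IsEmpty (Λ → Fin 0) := ⟨fun a => (a hΛ.some).elim0⟩
    have h := hρ.2
    rw [Matrix.trace, Finset.univ_eq_empty, Finset.sum_empty] at h
    exact zero_ne_one h⟩
  have hl : 1 ≤ l₀ := by
    rw [hl₀]
    exact Nat.one_le_ceil_iff.2 (by positivity)
  have hμ : 16 * (n₀ : ℝ) * (2 * k * J * T) ≤ 1 := by
    have hk' : (0 : ℝ) < k := by exact_mod_cast hk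
    have h1 : (n₀ : ℝ) ≤ 1 / (16 * (2 * k * J) * T) := by
      rw [hn₀]
      exact Nat.floor_le (by positivity)
    rw [le_div_iff₀ (by positivity)] at h1
    linarith
  have hmT : 0 ≤ (m : ℝ) * T := by positivity
  -- Each period contributes the one-period error on the localized observable and the localization
  -- error twice, once under each evolution.
  refine (Floquet.traceNorm_reducedTo_le hρ L fun O hO hO1 => ?_).trans_eq
    (show (m : ℝ) * (12 * J * T * L.card * (2 : ℝ) ^ (-((n₀ : ℝ) / 2)) +
      2 * (L.card * G l₀ ((m : ℝ) * T))) = _ by ring)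
  have hV := S.truncatedStep_mem_unitary hJ.le hT n₀
  have hU := S.evolution_mem_unitary hJ.le hT.le
  refine Floquet.norm_pow_conj_sub_le hV O m fun j hj => ?_
  have hjT : 0 ≤ (j : ℝ) * T := by positivity
  obtain ⟨E, hE1, hE2, hE3⟩ := Floquet.exists_localized S hJ.le hΓ hG_nonneg hLR hO hO1 hl hjT
  rw [Floquet.DrivenSystem.heisenberg, S.evolution_nat_mul hJ.le hT.le] at hE3
  set A := (S.evolution T ^ j)ᴴ * O * S.evolution T ^ j
  set U := S.evolution T with hUdef
  set V := Floquet.truncatedStep S.hamiltonian T n₀ with hVdef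
  have hU' : Uᴴ ∈ unitary (Floquet.Op Λ d) := Unitary.star_mem hU
  have hV' : Vᴴ ∈ unitary (Floquet.Op Λ d) := Unitary.star_mem hV
  have hstep := Floquet.norm_step_sub_le (S.bddMeas_hamiltonian hJ.le) S.isHermitian_hamiltonian
    (S.loc_hamiltonian hJ.le) hT hμ hE1
  have hGm : G l₀ ((j : ℝ) * T) ≤ G l₀ ((m : ℝ) * T) := by
    refine hG_mono l₀ hjT hmT ?_
    gcongr
  -- The growth of the support costs half of the exponential gain.
  have hpow : (2 : ℝ) ^ ((n₀ : ℝ) / 2) * (1 / 2) ^ n₀ = 2 ^ (-((n₀ : ℝ) / 2)) := by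
    rw [one_div, inv_pow, ← Real.rpow_natCast, ← Real.rpow_neg (by norm_num),
      ← Real.rpow_add (by norm_num)]
    congr 1
    ring
  have hcard := Floquet.card_compl_farRegion_le hΓ hD hC hdim n₀ L
  rw [← hl₀] at hcard
  have hmain : ‖Uᴴ * E * U - Vᴴ * E * V‖ ≤ 12 * J * T * L.card * (2 : ℝ) ^ (-((n₀ : ℝ) / 2)) := by
    refine hstep.trans ?_
    calc _ ≤ 12 * J * T * (L.card * 2 ^ ((n₀ : ℝ) / 2)) * (1 / 2) ^ n₀ * 1 := by gcongr
      _ = 12 * J * T * L.card * (2 ^ ((n₀ : ℝ) / 2) * (1 / 2) ^ n₀) := by ring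
      _ = _ := by rw [hpow]
  have e1 : Uᴴ * A * U - Vᴴ * A * V =
      Uᴴ * (A - E) * U + (Uᴴ * E * U - Vᴴ * E * V) - Vᴴ * (A - E) * V := by
    simp only [mul_sub, sub_mul]
    abel
  have e2 : ‖A - E‖ ≤ L.card * G l₀ ((m : ℝ) * T) := hE3.trans (by gcongr)
  rw [e1]
  calc _ ≤ ‖Uᴴ * (A - E) * U‖ + ‖Uᴴ * E * U - Vᴴ * E * V‖ + ‖Vᴴ * (A - E) * V‖ :=
        (norm_sub_le _ _).trans (by gcongr; exact norm_add_le _ _)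
    _ ≤ _ := by
        rw [Floquet.norm_unitary_mul_mul hU' hU, Floquet.norm_unitary_mul_mul hV' hV]
        linarith
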